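/- **Setting.** Let $d\ge 4$. On $d$-dimensional Minkowski spacetime use $u=t-r$, $r$, and points $x$ of the round unit sphere $S^{d-2}$; let $\mathcal D$ be the Levi-Civita derivative of $S^{d-2}$, $\mathcal D^2=\mathcal D^A\mathcal D_A$, and $\mathcal A_d=2\pi^{(d-1)/2}/\Gamma(\frac{d-1}{2})$ its area; $f|_{\ell=0}$ is the mean of $f$ over $S^{d-2}$. A coefficient $A_a^{(n)}(u,x)$ has components $A_u^{(n)},A_r^{(n)}$ (functions) and $A_A^{(n)}$ (a tangent field on $S^{d-2}$), taken along $\partial_u,\partial_r,r^{-1}\partial_{x^A}$. All coefficients and data are $C^\infty$ (on $\mathbb R\times S^{d-2}$, respectively $S^{d-2}$). The current is a formal series $j_a\sim\sum_{n\ge d-2,\,n\in\mathbb Z} r^{-n}j_a^{(n)}(u,x)$ with $\partial^aj_a=0$ at every order and $j_a^{(d-2)}(u,x)\to0$ as $u\to-\infty$. If $d=4$, assume moreover $j_u^{(2)}=0$ and $j_A^{(2)}=0$. The potential is a formal series $A_a\sim\sum_{n} r^{-n}A_a^{(n)}$, where for even $d$ the sum is over the integers $n\ge d/2-1$, and for odd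 $d$ over the half-integers $n\ge d/2-1$ together with the integers $p\ge d-3$ (whose coefficients are also written $\tilde A_a^{(p)}$). Coefficients at all other orders are $0$. The *recursion relations* (from $\Box A_a=-4\pi j_a$) are, for all orders $n$, $$[\mathcal D^2+(n-1)(n-d+2)]A_u^{(n-1)}+(2n-d+2)\partial_uA_u^{(n)}=-4\pi j_u^{(n+1)},$$ $$[\mathcal D^2+n(n-d+1)]A_r^{(n-1)}+(d-2)A_u^{(n-1)}+(2n-d+2)\partial_uA_r^{(n)}-2\mathcal D^AA_A^{(n-1)}=-4\pi j_r^{(n+1)},$$ $$[\mathcal D^2+(n-1)(n-d+2)-1]A_A^{(n-1)}-2\mathcal D_A(A_u^{(n-1)}-A_r^{(n-1)})+(2n-d+2)\partial_uA_A^{(n)}=-4\pi j_A^{(n+1)}$$ (the source being $0$ at half-integer orders). The *Lorenz condition* is $\psi^{(n)}=0$ for all $n$, where $$\psi^{(n)}=\mathcal D^AA_A^{(n-1)}+(d-n-1)(A_r^{(n-1)}-A_u^{(n-1)})-\partial_uA_r^{(n)}.$$ A *solution of Maxwell's equations in Lorenz gauge* satisfies the recursion relations and the Lorenz condition. The *constraint*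 at order $n$ is $$(C_n)\quad[\mathcal D^2-(n-d+2)(n-d+3)]A_r^{(n)}+(2n-d+2)(n-d+3)A_u^{(n)}+(2n-d+2)\mathcal D^AA_A^{(n)}=-4\pi j_r^{(n+2)}.$$ For Coulombic-order data $A_a^{(d-3)}$ in even $d$, *charge conservation* is $$(Q)\quad\partial_u\mathcal Q(u)=-\mathcal A_d\,j_u^{(d-2)}\big|_{\ell=0},\qquad \mathcal Q(u)=\frac{\mathcal A_d}{4\pi}\big[A_r^{(d-3)}+(d-4)A_u^{(d-3)}\big]\big|_{\ell=0}.$$ **Theorem.** Fix $u_0\in\mathbb R$. 1. *Radiative order data.* Specify $A_a^{(d/2-1)}(u,x)$ satisfying $(C_{d/2-1})$ for all $u$; specify $A_a^{(n)}(u_0,x)$ for all $n>d/2-1$ (integers for even $d$, half-integers for odd $d$) satisfying $(C_n)$ at $u_0$; for odd $d$ also specify $\tilde A_a^{(p)}(u_0,x)$ for all integers $p\ge d-3$, satisfying $(C_p)$ at $u_0$. Then exactly one potential with these data satisfies the recursion relations and the constraints $(C_n)$ at all its orders and all $u$. Moreover, if $d>4$, or if $d=4$ and the data $A_a^{(1)}$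 satisfy $(Q)$, there is exactly one solution of Maxwell's equations in Lorenz gauge with these data. 2. *Coulombic order data.* (a) For even $d$: specify $A_a^{(d-3)}(u,x)$ satisfying $(C_{d-3})$ for all $u$ and $(Q)$; specify $A_a^{(n)}(u_0,x)$ for all integers $n>d-3$, satisfying $(C_n)$ at $u_0$. Then there is exactly one solution of Maxwell's equations in Lorenz gauge with these data. (b) For odd $d$: for any half-integer $m\ge d/2-1$, specify $A_a^{(m)}(u,x)$ satisfying $(C_m)$ for all $u$; specify $A_a^{(n)}(u_0,x)$ for all half-integers $n>m$, satisfying $(C_n)$ at $u_0$; specify $\tilde A_a^{(p)}(u_0,x)$ for all integers $p\ge d-3$, satisfying $(C_p)$ at $u_0$. Then there is exactly one solution of Maxwell's equations in Lorenz gauge with these data. -/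

import Mathlib

open scoped ContDiff

noncomputable section

namespace LorenzMaxwell

/-- Euclidean space `ℝ^(d-1)`, a constant-time slice of `d`-dimensional Minkowski spacetime. -/
abbrev Space (d : ℕ) : Type := EuclideanSpace ℝ (Fin (d - 1))

/-- The round unit `(d-2)`-sphere. -/
abbrev Sph (d : ℕ) : Type := Metric.sphere (0 : Space d) 1

/-! ### Calculus on the round unit sphere

Tangent vectors at `x` are the vectors of `ℝ^(d-1)` orthogonal to `x`; the Levi-Civita derivative
`𝒟` of the round metric is the tangential projection of the derivative in `ℝ^(d-1)`. -/

/-- Extension of a function on the sphere to `ℝ^(d-1)`, constant along rays (zero at the origin). -/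
def radialExt {d : ℕ} {F : Type*} [Zero F] (f : Sph d → F) (y : Space d) : F :=
  if h : y = 0 then 0
  else f ⟨‖y‖⁻¹ • y, by
    rw [mem_sphere_zero_iff_norm, norm_smul, norm_inv, norm_norm,
      inv_mul_cancel₀ (norm_ne_zero_iff.mpr h)]⟩

/-- Orthogonal projection `v ↦ v - ⟪x, v⟫ x` onto the tangent space of the sphere at `x`. -/
def tangentProj {d : ℕ} (x : Sph d) : Space d →L[ℝ] Space d :=
  ContinuousLinearMap.id ℝ (Space d) - (innerSL ℝ (x : Space d)).smulRight (x : Space d)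

/-- The gradient `𝒟_A f` on the sphere, as a tangent vector. -/
def sphGrad {d : ℕ} (f : Sph d → ℝ) (x : Sph d) : Space d :=
  gradient (radialExt f) (x : Space d)

/-- The covariant derivative `𝒟_A V_B` of a tangent field: the map `w ↦ 𝒟_w V` on tangent vectors
(extended by zero in the normal direction). -/
def covDeriv {d : ℕ} (V : Sph d → Space d) (x : Sph d) : Space d →L[ℝ] Space d :=
  (tangentProj x).comp ((fderiv ℝ (radialExt V) (x : Space d)).comp (tangentProj x))

/-- The divergence `𝒟^A V_A` of a tangent field. -/
def sphDiv {d : ℕ} (V : Sph d → Space d) (x : Sph d) : ℝ :=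
  LinearMap.trace ℝ (Space d) (covDeriv V x : Space d →ₗ[ℝ] Space d)

/-- The Laplacian `𝒟² f = 𝒟^A 𝒟_A f` on functions. -/
def sphLap {d : ℕ} (f : Sph d → ℝ) (x : Sph d) : ℝ := sphDiv (sphGrad f) x

/-- The Laplacian `𝒟² V_A = 𝒟^B 𝒟_B V_A` on tangent fields: the trace of the second covariant
derivative, where the covariant derivative of the tensor field `𝒟V` is the tangential projection
of its derivative in `ℝ^(d-1)`. -/
def sphVecLap {d : ℕ} (V : Sph d → Space d) (x : Sph d) : Space d :=
  tangentProj x (∑ i : Fin (d - 1),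
    (fderiv ℝ (radialExt (covDeriv V)) (x : Space d)
        (tangentProj x (EuclideanSpace.single i (1 : ℝ))))
      (tangentProj x (EuclideanSpace.single i (1 : ℝ))))

/-- The area `𝒜_d` of the unit `(d-2)`-sphere. -/
def sphArea (d : ℕ) : ℝ :=
  2 * Real.pi ^ (((d : ℝ) - 1) / 2) / Real.Gamma (((d : ℝ) - 1) / 2)

/-- The `ℓ = 0` part of a function on the sphere, i.e. its mean over the sphere. -/
def monopole {d : ℕ} (f : Sph d → ℝ) : ℝ :=
  ⨍ x, f x ∂((MeasureTheory.volume : MeasureTheory.Measure (Space d)).toSphere)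

/-! ### Expansion coefficients -/

/-- An expansion coefficient of a one-form at one retarded time `u`: its components along
`∂/∂u`, `∂/∂r` and `(1/r) ∂/∂x^A`, as functions on the sphere. -/
@[ext]
structure Coeff (d : ℕ) where
  u : Sph d → ℝ
  r : Sph d → ℝ
  ang : Sph d → Space d

instance (d : ℕ) : Zero (Coeff d) := ⟨⟨0, 0, 0⟩⟩

/-- The angular part is tangent to the sphere and all components are smooth on the sphere. -/
structure Coeff.IsSmooth {d : ℕ} (s : Coeff d) : Prop where
  tangent : ∀ x : Sph d, inner ℝ (x : Space d) (s.ang x) = 0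
  smooth_u : ContDiffOn ℝ ∞ (radialExt s.u) {y | y ≠ 0}
  smooth_r : ContDiffOn ℝ ∞ (radialExt s.r) {y | y ≠ 0}
  smooth_ang : ContDiffOn ℝ ∞ (radialExt s.ang) {y | y ≠ 0}

/-- A coefficient depending on `u ∈ ℝ`: the angular part is tangent to the sphere and all
components are jointly smooth on `ℝ ×` sphere. -/
structure IsSmoothField {d : ℕ} (a : ℝ → Coeff d) : Prop where
  tangent : ∀ (u : ℝ) (x : Sph d), inner ℝ (x : Space d) ((a u).ang x) = 0
  smooth_u : ContDiffOn ℝ ∞ (fun p : ℝ × Space d => radialExt (a p.1).u p.2) {p | p.2 ≠ 0}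
  smooth_r : ContDiffOn ℝ ∞ (fun p : ℝ × Space d => radialExt (a p.1).r p.2) {p | p.2 ≠ 0}
  smooth_ang : ContDiffOn ℝ ∞ (fun p : ℝ × Space d => radialExt (a p.1).ang p.2) {p | p.2 ≠ 0}

/-- The formal expansion `∑_n r^(-n) A^(n)(u, x)` of a one-form: `A n u` is the coefficient
`A^(n)` at retarded time `u`. Orders are real numbers; which ones occur is fixed by the
conditions below. -/
abbrev Expansion (d : ℕ) : Type := ℝ → ℝ → Coeff d

/-- The orders `d/2 - 1, d/2, d/2 + 1, …` (integers for even `d`, half-integers for odd `d`). -/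
def radOrders (d : ℕ) : Set ℝ := {n | ∃ k : ℕ, n = (d : ℝ) / 2 - 1 + k}

/-- The integer orders `d - 3, d - 2, …`. -/
def coulOrders (d : ℕ) : Set ℝ := {n | ∃ k : ℕ, n = (d : ℝ) - 3 + k}

/-- The orders occurring in the vector potential. For even `d` this is just `radOrders d`. For odd
`d` it is a disjoint union, the half-integer orders carrying the coefficients `A^(n)` and the
integer orders the coefficients `Ã^(p)`. -/
def orders (d : ℕ) : Set ℝ := radOrders d ∪ coulOrders d

/-- The coefficient at order `n` of the divergence `∂^a A_a`. -/
def divergence {d : ℕ} (A : Expansion d) (n u : ℝ) (x : Sph d) : ℝ :=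
  sphDiv (A (n - 1) u).ang x + ((d : ℝ) - n - 1) * ((A (n - 1) u).r x - (A (n - 1) u).u x)
    - deriv (fun v => (A n v).r x) u

/-- A smooth charge-current `j_a ∼ ∑_{n = d-2}^∞ r^(-n) j_a^(n)` over integers `n`, with
`∂^a j_a = 0` at every order and `j_a^(d-2) → 0` as `u → -∞`. -/
structure IsCurrent {d : ℕ} (j : Expansion d) : Prop where
  smooth : ∀ n, IsSmoothField (j n)
  ansatz : ∀ n, (¬ ∃ k : ℕ, n = (d : ℝ) - 2 + k) → j n = 0
  conserved : ∀ (n u : ℝ) (x : Sph d), divergence j n u x = 0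
  decay_u : ∀ x, Filter.Tendsto (fun u => (j ((d : ℝ) - 2) u).u x) Filter.atBot (nhds 0)
  decay_r : ∀ x, Filter.Tendsto (fun u => (j ((d : ℝ) - 2) u).r x) Filter.atBot (nhds 0)
  decay_ang : ∀ x, Filter.Tendsto (fun u => (j ((d : ℝ) - 2) u).ang x) Filter.atBot (nhds 0)

/-- `A` is of the form `∑_{n ≥ d/2-1} r^(-n) A^(n)` for even `d`, and
`∑_{n ≥ d/2-1} r^(-n) A^(n) + ∑_{p ≥ d-3} r^(-p) Ã^(p)` for odd `d`, with smooth coefficients,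
and satisfies the recursion relations arising from `□ A_a = -4π j_a`. -/
structure IsRecursionSolution {d : ℕ} (j A : Expansion d) : Prop where
  smooth : ∀ n, IsSmoothField (A n)
  ansatz : ∀ n, n ∉ orders d → A n = 0
  rec_u : ∀ (n u : ℝ) (x : Sph d),
    sphLap (A (n - 1) u).u x + (n - 1) * (n - d + 2) * (A (n - 1) u).u x
      + (2 * n - d + 2) * deriv (fun v => (A n v).u x) u
      = -4 * Real.pi * (j (n + 1) u).u x
  rec_r : ∀ (n u : ℝ) (x : Sph d),
    sphLap (A (n - 1) u).r x + n * (n - d + 1) * (A (n - 1) u).r x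
      + ((d : ℝ) - 2) * (A (n - 1) u).u x
      + (2 * n - d + 2) * deriv (fun v => (A n v).r x) u
      - 2 * sphDiv (A (n - 1) u).ang x
      = -4 * Real.pi * (j (n + 1) u).r x
  rec_ang : ∀ (n u : ℝ) (x : Sph d),
    sphVecLap (A (n - 1) u).ang x + ((n - 1) * (n - d + 2) - 1) • (A (n - 1) u).ang x
      - (2 : ℝ) • (sphGrad (A (n - 1) u).u x - sphGrad (A (n - 1) u).r x)
      + (2 * n - d + 2) • deriv (fun v => (A n v).ang x) u
      = (-4 * Real.pi) • (j (n + 1) u).ang x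

/-- The constraint at order `n` on a coefficient `s`, with source `jr = j_r^(n+2)`. -/
def Constraint {d : ℕ} (n : ℝ) (s : Coeff d) (jr : Sph d → ℝ) : Prop :=
  ∀ x : Sph d,
    sphLap s.r x - (n - d + 2) * (n - d + 3) * s.r x
      + (2 * n - d + 2) * (n - d + 3) * s.u x
      + (2 * n - d + 2) * sphDiv s.ang x
      = -4 * Real.pi * jr x

/-- The constraint holds at all orders and all retarded times. -/
def SatisfiesConstraints {d : ℕ} (j A : Expansion d) : Prop :=
  ∀ n ∈ orders d, ∀ u : ℝ, Constraint n (A n u) (j (n + 2) u).r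

/-- A solution of Maxwell's equations in Lorenz gauge: the recursion relations arising from
`□ A_a = -4π j_a` together with `∂^a A_a = 0` at every order. -/
structure IsLorenzSolution {d : ℕ} (j A : Expansion d) : Prop
    extends IsRecursionSolution j A where
  lorenz : ∀ (n u : ℝ) (x : Sph d), divergence A n u x = 0

/-- The charge `𝒬` computed from the Coulombic order coefficient at one retarded time. -/
def charge {d : ℕ} (s : Coeff d) : ℝ :=
  sphArea d / (4 * Real.pi) * monopole (fun x => s.r x + ((d : ℝ) - 4) * s.u x)

/-- Charge conservation `∂_u 𝒬(u) = -𝒜_d j_u^(d-2)|_{ℓ=0}` for Coulombic order data `a`. -/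
def ChargeConservation {d : ℕ} (j : Expansion d) (a : ℝ → Coeff d) : Prop :=
  ∀ u : ℝ, HasDerivAt (fun v => charge (a v))
    (-sphArea d * monopole (j ((d : ℝ) - 2) u).u) u

/-- The orders at which data are given only at `u = u₀`, when the order-`m` coefficient is given
for all `u`: all `n > m` in `radOrders d`, and for odd `d` also all integers `p ≥ d - 3`. -/
def initialOrders (d : ℕ) (m : ℝ) : Set ℝ :=
  {n | n ∈ radOrders d ∧ m < n} ∪ {p | Odd d ∧ p ∈ coulOrders d}

/-- Smooth data satisfying the constraints: `a` is the order-`m` coefficient for all `u`, and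
`b n` is the order-`n` coefficient at `u₀` for `n ∈ initialOrders d m`. -/
structure IsData {d : ℕ} (j : Expansion d) (u₀ m : ℝ) (a : ℝ → Coeff d) (b : ℝ → Coeff d) :
    Prop where
  smooth : IsSmoothField a
  constraint : ∀ u, Constraint m (a u) (j (m + 2) u).r
  smooth_init : ∀ n ∈ initialOrders d m, (b n).IsSmooth
  constraint_init : ∀ n ∈ initialOrders d m, Constraint n (b n) (j (n + 2) u₀).r

/-- `A` takes the given data. -/
def HasData {d : ℕ} (A : Expansion d) (u₀ m : ℝ) (a : ℝ → Coeff d) (b : ℝ → Coeff d) : Prop :=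
  A m = a ∧ ∀ n ∈ initialOrders d m, A n u₀ = b n

end LorenzMaxwell

end

open LorenzMaxwell

noncomputable section

namespace LorenzMaxwell

section

/-! ### The algebra of smooth functions away from the axis -/

/-- The points `(u, y)` of `ℝ × ℝ^(d-1)` with `y ≠ 0`. -/
def Om (d : ℕ) : Set (ℝ × Space d) := {p | p.2 ≠ 0}

theorem isOpen_Om {d : ℕ} : IsOpen (Om d) := isOpen_ne_fun continuous_snd continuous_const

open Classical in
/-- Extension by zero of a function on `Om d`. -/
def zext {d : ℕ} (F : Om d → ℝ) (p : ℝ × Space d) : ℝ := if h : p ∈ Om d then F ⟨p, h⟩ else 0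

theorem zext_of_mem {d : ℕ} (F : Om d → ℝ) {p : ℝ × Space d} (h : p ∈ Om d) :
    zext F p = F ⟨p, h⟩ := dif_pos h

/-- Smooth real functions on `Om d`, as a subalgebra of all functions. -/
def smoothSubalgebra (d : ℕ) : Subalgebra ℝ (Om d → ℝ) where
  carrier := {F | ContDiffOn ℝ ∞ (zext F) (Om d)}
  mul_mem' {F G} hF hG := (ContDiffOn.mul hF hG).congr fun p hp => by simp [zext_of_mem _ hp]
  add_mem' {F G} hF hG := (ContDiffOn.add hF hG).congr fun p hp => by simp [zext_of_mem _ hp]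
  algebraMap_mem' c := (contDiffOn_const (c := c)).congr fun p hp => by simp [zext_of_mem _ hp]

/-- Smooth real functions on `Om d`. -/
def Sm (d : ℕ) : Type := smoothSubalgebra d

namespace Sm

variable {d : ℕ}

instance : CommRing (Sm d) := inferInstanceAs (CommRing (smoothSubalgebra d))
instance : Algebra ℝ (Sm d) := inferInstanceAs (Algebra ℝ (smoothSubalgebra d))

/-- The underlying function, extended by zero. -/
def eval (F : Sm d) : ℝ × Space d → ℝ := zext F.1

instance : CoeFun (Sm d) (fun _ => ℝ × Space d → ℝ) := ⟨eval⟩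

theorem eval_of_mem (F : Sm d) {p : ℝ × Space d} (h : p ∈ Om d) : F p = F.1 ⟨p, h⟩ :=
  zext_of_mem _ h

theorem eval_of_notMem (F : Sm d) {p : ℝ × Space d} (h : p ∉ Om d) : F p = 0 := dif_neg h

theorem contDiffOn (F : Sm d) : ContDiffOn ℝ ∞ F (Om d) := F.2

theorem contDiffAt (F : Sm d) {p : ℝ × Space d} (hp : p ∈ Om d) : ContDiffAt ℝ ∞ F p :=
  F.contDiffOn.contDiffAt (isOpen_Om.mem_nhds hp)

theorem differentiableAt (F : Sm d) {p : ℝ × Space d} (hp : p ∈ Om d) : DifferentiableAt ℝ F p :=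
  (F.contDiffAt hp).differentiableAt (by simp)

/-- A smooth function on `Om d` from a function on the whole space. -/
def mk (f : ℝ × Space d → ℝ) (hf : ContDiffOn ℝ ∞ f (Om d)) : Sm d :=
  ⟨fun p => f p, hf.congr fun p hp => by simp [zext_of_mem _ hp]⟩

theorem mk_apply (f : ℝ × Space d → ℝ) (hf : ContDiffOn ℝ ∞ f (Om d)) {p : ℝ × Space d}
    (hp : p ∈ Om d) : mk f hf p = f p := zext_of_mem _ hp

theorem ext {F G : Sm d} (h : ∀ p ∈ Om d, F p = G p) : F = G := by
  apply Subtype.ext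
  funext p
  have := h p p.2
  rwa [eval_of_mem _ p.2, eval_of_mem _ p.2] at this

theorem add_apply (F G : Sm d) (p : ℝ × Space d) : (F + G) p = F p + G p := by
  by_cases h : p ∈ Om d
  · rw [eval_of_mem _ h, eval_of_mem _ h, eval_of_mem _ h]; rfl
  · simp [eval_of_notMem _ h]

theorem mul_apply (F G : Sm d) (p : ℝ × Space d) : (F * G) p = F p * G p := by
  by_cases h : p ∈ Om d
  · rw [eval_of_mem _ h, eval_of_mem _ h, eval_of_mem _ h]; rfl
  · simp [eval_of_notMem _ h]

theorem smul_apply (c : ℝ) (F : Sm d) (p : ℝ × Space d) : (c • F) p = c * F p := by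
  by_cases h : p ∈ Om d
  · rw [eval_of_mem _ h, eval_of_mem _ h]; rfl
  · simp [eval_of_notMem _ h]

theorem neg_apply (F : Sm d) (p : ℝ × Space d) : (-F) p = -F p := by
  by_cases h : p ∈ Om d
  · rw [eval_of_mem _ h, eval_of_mem _ h]; rfl
  · simp [eval_of_notMem _ h]

theorem sub_apply (F G : Sm d) (p : ℝ × Space d) : (F - G) p = F p - G p := by
  rw [sub_eq_add_neg, add_apply, neg_apply, sub_eq_add_neg]

theorem zero_apply (p : ℝ × Space d) : (0 : Sm d) p = 0 := by
  by_cases h : p ∈ Om d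
  · rw [eval_of_mem _ h]; rfl
  · simp [eval_of_notMem _ h]

theorem one_apply {p : ℝ × Space d} (hp : p ∈ Om d) : (1 : Sm d) p = 1 := by
  rw [eval_of_mem _ hp]; rfl

/-- Evaluation at a point, as a linear map. -/
def evalLin (p : ℝ × Space d) : Sm d →ₗ[ℝ] ℝ where
  toFun F := F p
  map_add' F G := add_apply F G p
  map_smul' c F := smul_apply c F p

theorem sum_apply {ι : Type*} (s : Finset ι) (F : ι → Sm d) (p : ℝ × Space d) :
    (∑ i ∈ s, F i) p = ∑ i ∈ s, F i p :=
  map_sum (evalLin p) F s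

theorem coe_add (F G : Sm d) : ((F + G : Sm d) : ℝ × Space d → ℝ) = (F : ℝ × Space d → ℝ) + G :=
  funext (add_apply F G)

theorem coe_mul (F G : Sm d) : ((F * G : Sm d) : ℝ × Space d → ℝ) = (F : ℝ × Space d → ℝ) * G :=
  funext (mul_apply F G)

theorem coe_smul (c : ℝ) (F : Sm d) :
    ((c • F : Sm d) : ℝ × Space d → ℝ) = c • (F : ℝ × Space d → ℝ) :=
  funext (smul_apply c F)

/-- The derivative of a smooth function along a constant vector. -/
def dirFun (v : ℝ × Space d) (F : Sm d) : Sm d :=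
  mk (fun p => fderiv ℝ F p v)
    ((F.contDiffOn.fderiv_of_isOpen isOpen_Om (m := ∞) (by simp)).clm_apply contDiffOn_const)

theorem dirFun_apply (v : ℝ × Space d) (F : Sm d) {p : ℝ × Space d} (hp : p ∈ Om d) :
    dirFun v F p = fderiv ℝ F p v := mk_apply _ _ hp

/-- The derivative along a constant vector, as a derivation of the algebra of smooth functions. -/
def dir (v : ℝ × Space d) : Derivation ℝ (Sm d) (Sm d) :=
  Derivation.mk'
    { toFun := dirFun v
      map_add' := fun F G => ext fun p hp => by
        rw [add_apply, dirFun_apply _ _ hp, dirFun_apply _ _ hp, dirFun_apply _ _ hp, coe_add,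
          fderiv_add (F.differentiableAt hp) (G.differentiableAt hp)]
        rfl
      map_smul' := fun c F => ext fun p hp => by
        rw [RingHom.id_apply, smul_apply, dirFun_apply _ _ hp, dirFun_apply _ _ hp, coe_smul,
          fderiv_const_smul (F.differentiableAt hp)]
        rfl }
    fun F G => ext fun p hp => by
      change dirFun v (F * G) p = (F * dirFun v G + G * dirFun v F) p
      rw [add_apply, mul_apply, mul_apply, dirFun_apply _ _ hp, dirFun_apply _ _ hp,
        dirFun_apply _ _ hp, coe_mul, fderiv_mul (F.differentiableAt hp) (G.differentiableAt hp)]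
      simp

theorem dir_apply (v : ℝ × Space d) (F : Sm d) {p : ℝ × Space d} (hp : p ∈ Om d) :
    dir v F p = fderiv ℝ F p v := dirFun_apply v F hp

theorem dir_apply_of_eventuallyEq (v : ℝ × Space d) (F : Sm d) {p : ℝ × Space d} (hp : p ∈ Om d)
    {f : ℝ × Space d → ℝ} (h : (F : ℝ × Space d → ℝ) =ᶠ[nhds p] f) :
    dir v F p = fderiv ℝ f p v := by
  rw [dir_apply v F hp, h.fderiv_eq]

theorem eventuallyEq_mk (f : ℝ × Space d → ℝ) (hf : ContDiffOn ℝ ∞ f (Om d)) {p : ℝ × Space d}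
    (hp : p ∈ Om d) : (mk f hf : ℝ × Space d → ℝ) =ᶠ[nhds p] f := by
  filter_upwards [isOpen_Om.mem_nhds hp] with q hq using mk_apply f hf hq

theorem dir_mul (v : ℝ × Space d) (F G : Sm d) :
    dir v (F * G) = F * dir v G + G * dir v F := by
  rw [Derivation.leibniz, smul_eq_mul, smul_eq_mul]

theorem dir_comm (v w : ℝ × Space d) (F : Sm d) : dir v (dir w F) = dir w (dir v F) := by
  apply ext
  intro p hp
  have key : ∀ v w : ℝ × Space d, dir v (dir w F) p = fderiv ℝ (fderiv ℝ F) p v w := by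
    intro v w
    have h : (dir w F : ℝ × Space d → ℝ) =ᶠ[nhds p] fun q => fderiv ℝ F q w := by
      filter_upwards [isOpen_Om.mem_nhds hp] with q hq using dir_apply w F hq
    rw [dir_apply_of_eventuallyEq v _ hp h]
    have hd : DifferentiableAt ℝ (fderiv ℝ F) p :=
      ((F.contDiffAt hp).fderiv_right (m := ∞) (by simp)).differentiableAt (by simp)
    rw [fderiv_clm_apply hd (differentiableAt_const w)]
    simp
  rw [key, key]
  exact (F.contDiffAt hp).isSymmSndFDerivAt (by simpa using WithTop.coe_le_coe.2 (le_top : (2 : ℕ∞) ≤ ⊤)) v w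

/-- The partial derivative in the `i`-th Cartesian direction. -/
def Dx (i : Fin (d - 1)) : Derivation ℝ (Sm d) (Sm d) := dir (0, EuclideanSpace.single i 1)

/-- The derivative in retarded time. -/
def Dt : Derivation ℝ (Sm d) (Sm d) := dir (1, 0)

theorem Dx_mul (i : Fin (d - 1)) (F G : Sm d) : Dx i (F * G) = F * Dx i G + G * Dx i F :=
  dir_mul _ F G

theorem Dt_mul (F G : Sm d) : Dt (F * G) = F * Dt G + G * Dt F := dir_mul _ F G

theorem Dx_smul (i : Fin (d - 1)) (c : ℝ) (F : Sm d) : Dx i (c • F) = c • Dx i F :=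
  (Dx i).map_smul c F

theorem Dt_smul (c : ℝ) (F : Sm d) : Dt (c • F) = c • Dt F := Dt.map_smul c F

theorem Dx_comm (i j : Fin (d - 1)) (F : Sm d) : Dx i (Dx j F) = Dx j (Dx i F) := dir_comm _ _ F

theorem Dx_Dt (i : Fin (d - 1)) (F : Sm d) : Dx i (Dt F) = Dt (Dx i F) := dir_comm _ _ F

/-- The Laplacian in the Cartesian coordinates. -/
def lap : Sm d →ₗ[ℝ] Sm d :=
  ∑ i : Fin (d - 1), (Dx i).toLinearMap.comp (Dx i).toLinearMap

theorem lap_apply (F : Sm d) : lap F = ∑ i, Dx i (Dx i F) := by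
  simp [lap, LinearMap.sum_apply]

theorem lap_Dx (i : Fin (d - 1)) (F : Sm d) : lap (Dx i F) = Dx i (lap F) := by
  rw [lap_apply, lap_apply, map_sum]
  exact Finset.sum_congr rfl fun j _ => by rw [Dx_comm j i, Dx_comm j i]

theorem lap_Dt (F : Sm d) : lap (Dt F) = Dt (lap F) := by
  rw [lap_apply, lap_apply, map_sum]
  exact Finset.sum_congr rfl fun j _ => by rw [Dx_Dt, Dx_Dt]

theorem lap_mul (F G : Sm d) :
    lap (F * G) = F * lap G + G * lap F + (2 : ℝ) • ∑ i, Dx i F * Dx i G := by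
  simp only [lap_apply, Finset.mul_sum, Finset.smul_sum, ← Finset.sum_add_distrib]
  refine Finset.sum_congr rfl fun i _ => ?_
  rw [Dx_mul, map_add, Dx_mul, Dx_mul, two_smul]
  ring

/-- The `i`-th Cartesian coordinate. -/
def Y (i : Fin (d - 1)) : Sm d :=
  mk (fun p => p.2 i) (by fun_prop)

theorem Y_apply (i : Fin (d - 1)) {p : ℝ × Space d} (hp : p ∈ Om d) : Y i p = p.2 i :=
  mk_apply _ _ hp

theorem contDiffOn_norm_rpow (α : ℝ) :
    ContDiffOn ℝ ∞ (fun p : ℝ × Space d => ‖p.2‖ ^ α) (Om d) := fun p hp =>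
  (((contDiffAt_norm ℝ hp).comp p contDiffAt_snd).rpow_const_of_ne
    (norm_ne_zero_iff.2 hp)).contDiffWithinAt

/-- The power `|y|^α` of the radius. -/
def rp (α : ℝ) : Sm d := mk (fun p => ‖p.2‖ ^ α) (contDiffOn_norm_rpow α)

theorem rp_apply (α : ℝ) {p : ℝ × Space d} (hp : p ∈ Om d) : rp α p = ‖p.2‖ ^ α :=
  mk_apply _ _ hp

theorem rp_mul (α β : ℝ) : (rp α * rp β : Sm d) = rp (α + β) := ext fun p hp => by
  rw [mul_apply, rp_apply _ hp, rp_apply _ hp, rp_apply _ hp,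
    Real.rpow_add (norm_pos_iff.2 hp)]

theorem rp_zero : (rp 0 : Sm d) = 1 := ext fun p hp => by
  rw [rp_apply _ hp, one_apply hp, Real.rpow_zero]

theorem sum_Y_mul_Y : (∑ i, Y i * Y i : Sm d) = rp 2 := ext fun p hp => by
  rw [sum_apply, rp_apply _ hp]
  simp only [mul_apply, Y_apply _ hp]
  rw [Real.rpow_two, EuclideanSpace.real_norm_sq_eq]
  exact Finset.sum_congr rfl fun i _ => (sq _).symm

theorem Dx_Y (i j : Fin (d - 1)) : Dx i (Y j : Sm d) = if i = j then 1 else 0 := by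
  refine ext fun p hp => ?_
  rw [Dx, dir_apply_of_eventuallyEq _ (Y j) hp (eventuallyEq_mk _ _ hp)]
  have : (fun p : ℝ × Space d => p.2 j)
      = ((EuclideanSpace.proj j : Space d →L[ℝ] ℝ).comp (ContinuousLinearMap.snd ℝ ℝ (Space d))) :=
    rfl
  rw [this, ContinuousLinearMap.fderiv]
  by_cases h : i = j
  · subst h; simp [one_apply hp]
  · simp [h, zero_apply, Ne.symm h]

theorem Dt_Y (j : Fin (d - 1)) : Dt (Y j : Sm d) = 0 := by
  refine ext fun p hp => ?_
  rw [Dt, dir_apply_of_eventuallyEq _ (Y j) hp (eventuallyEq_mk _ _ hp)]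
  have : (fun p : ℝ × Space d => p.2 j)
      = ((EuclideanSpace.proj j : Space d →L[ℝ] ℝ).comp (ContinuousLinearMap.snd ℝ ℝ (Space d))) :=
    rfl
  rw [this, ContinuousLinearMap.fderiv]
  simp [zero_apply]

theorem fderiv_norm_rpow_snd (α : ℝ) {p : ℝ × Space d} (hp : p ∈ Om d) (v : ℝ × Space d) :
    fderiv ℝ (fun p : ℝ × Space d => ‖p.2‖ ^ α) p v
      = α * (inner ℝ p.2 v.2 * ‖p.2‖ ^ (α - 2)) := by
  have hpos : 0 < ‖p.2‖ := norm_pos_iff.2 hp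
  have h1 : (fun p : ℝ × Space d => ‖p.2‖ ^ α) = fun p => (‖p.2‖ ^ 2) ^ (α / 2) := by
    funext q
    rw [← Real.rpow_natCast, ← Real.rpow_mul (norm_nonneg _)]
    congr 1; push_cast; ring
  have h2 : HasFDerivAt (fun p : ℝ × Space d => ‖p.2‖ ^ 2)
      (2 • (innerSL ℝ p.2).comp (ContinuousLinearMap.snd ℝ ℝ (Space d))) p :=
    ((hasStrictFDerivAt_norm_sq p.2).hasFDerivAt).comp p hasFDerivAt_snd
  rw [h1, (h2.rpow_const (p := α / 2) (Or.inl (by positivity))).fderiv]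
  have h3 : (‖p.2‖ ^ 2) ^ (α / 2 - 1) = ‖p.2‖ ^ (α - 2) := by
    rw [← Real.rpow_natCast, ← Real.rpow_mul (norm_nonneg _)]
    congr 1; push_cast; ring
  simp [h3]
  ring

theorem Dx_rp (i : Fin (d - 1)) (α : ℝ) : Dx i (rp α : Sm d) = α • (Y i * rp (α - 2)) := by
  refine ext fun p hp => ?_
  rw [Dx, dir_apply_of_eventuallyEq _ (rp α) hp (eventuallyEq_mk _ _ hp),
    fderiv_norm_rpow_snd α hp, smul_apply, mul_apply, rp_apply _ hp, Y_apply _ hp]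
  simp [EuclideanSpace.inner_single_right]

theorem Dt_rp (α : ℝ) : Dt (rp α : Sm d) = 0 := by
  refine ext fun p hp => ?_
  rw [Dt, dir_apply_of_eventuallyEq _ (rp α) hp (eventuallyEq_mk _ _ hp),
    fderiv_norm_rpow_snd α hp, zero_apply]
  simp

end Sm

end

section

namespace Sm

variable {d : ℕ}

/-! ### Homogeneous functions -/

/-- Homogeneity of degree `σ` in `y`. -/
def Hom (σ : ℝ) (F : Sm d) : Prop :=
  ∀ p ∈ Om d, ∀ t : ℝ, 0 < t → F (p.1, t • p.2) = t ^ σ * F p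

theorem smul_mem_Om {p : ℝ × Space d} (hp : p ∈ Om d) {t : ℝ} (ht : 0 < t) :
    (p.1, t • p.2) ∈ Om d := smul_ne_zero ht.ne' hp

/-- The Euler operator `y^i ∂_i`. -/
def euler (F : Sm d) : Sm d := ∑ i, Y i * Dx i F

theorem euler_apply (F : Sm d) {p : ℝ × Space d} (hp : p ∈ Om d) :
    euler F p = fderiv ℝ F p (0, p.2) := by
  have h : ((0 : ℝ), p.2) = ∑ i, p.2 i • ((0 : ℝ), EuclideanSpace.single i (1 : ℝ)) := by
    refine Prod.ext (by simp [Prod.fst_sum]) ?_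
    ext j
    simp [Prod.snd_sum, Finset.sum_apply, Pi.single_apply]
  rw [h, map_sum, euler, sum_apply]
  refine Finset.sum_congr rfl fun i _ => ?_
  rw [mul_apply, Y_apply _ hp, Dx, dir_apply _ _ hp, map_smul, smul_eq_mul]

theorem hasDerivAt_ray (F : Sm d) {p : ℝ × Space d} (hp : p ∈ Om d) {t : ℝ} (ht : 0 < t) :
    HasDerivAt (fun s : ℝ => F (p.1, s • p.2)) (t⁻¹ * euler F (p.1, t • p.2)) t := by
  have h1 : HasDerivAt (fun s : ℝ => (p.1, s • p.2)) ((0 : ℝ), p.2) t := by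
    simpa using (hasDerivAt_const t p.1).prodMk ((hasDerivAt_id t).smul_const p.2)
  have h2 := (F.differentiableAt (smul_mem_Om hp ht)).hasFDerivAt.comp_hasDerivAt t h1
  rw [euler_apply F (smul_mem_Om hp ht)]
  refine h2.congr_deriv ?_
  have : ((0 : ℝ), (p.1, t • p.2).2) = t • ((0 : ℝ), p.2) := by simp
  rw [this, map_smul, smul_eq_mul, inv_mul_cancel_left₀ ht.ne']

theorem Hom.euler_eq {σ : ℝ} {F : Sm d} (h : Hom σ F) : euler F = σ • F := by
  refine ext fun p hp => ?_
  have h1 := hasDerivAt_ray F hp one_pos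
  have h2 : HasDerivAt (fun t : ℝ => t ^ σ * F p) (σ * F p) 1 := by
    simpa using (Real.hasDerivAt_rpow_const (p := σ) (x := 1) (Or.inl one_ne_zero)).mul_const (F p)
  have h3 : (fun s : ℝ => F (p.1, s • p.2)) =ᶠ[nhds 1] fun t : ℝ => t ^ σ * F p := by
    filter_upwards [lt_mem_nhds one_pos] with t ht using h p hp t ht
  have h4 := (h2.congr_of_eventuallyEq h3).unique h1
  rw [smul_apply, h4]
  simp

theorem hom_of_euler {σ : ℝ} {F : Sm d} (h : euler F = σ • F) : Hom σ F := by
  intro p hp t ht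
  have hd : ∀ s ∈ Set.Ioi (0 : ℝ),
      HasDerivAt (fun s : ℝ => s ^ (-σ) * F (p.1, s • p.2)) 0 s := by
    intro s hs
    have h1 := (Real.hasDerivAt_rpow_const (p := -σ) (x := s) (Or.inl (ne_of_gt hs))).mul
      (hasDerivAt_ray F hp hs)
    refine h1.congr_deriv ?_
    symm
    rw [h, smul_apply, Real.rpow_sub_one (ne_of_gt hs)]
    field_simp
    ring
  have hc := (convex_Ioi (0 : ℝ)).is_const_of_fderivWithin_eq_zero (𝕜 := ℝ)
    (f := fun s : ℝ => s ^ (-σ) * F (p.1, s • p.2))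
    (fun s hs => (hd s hs).differentiableAt.differentiableWithinAt)
    (fun s hs => by
      have h1 := (hd s hs).hasDerivWithinAt (s := Set.Ioi (0 : ℝ))
      have h2 := h1.hasFDerivWithinAt.fderivWithin (isOpen_Ioi.uniqueDiffWithinAt hs)
      rw [h2]; ext; simp)
    (Set.mem_Ioi.2 ht) (Set.mem_Ioi.2 one_pos)
  simp only [Real.one_rpow, one_smul, one_mul, Real.rpow_neg ht.le] at hc
  have : t ^ σ ≠ 0 := (Real.rpow_pos_of_pos ht σ).ne'
  field_simp at hc
  exact hc

theorem Hom.congr {σ τ : ℝ} {F : Sm d} (h : Hom σ F) (hst : σ = τ) : Hom τ F := hst ▸ h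

theorem Hom.zero {σ : ℝ} : Hom σ (0 : Sm d) := fun p _ t _ => by
  rw [zero_apply, zero_apply, mul_zero]

theorem Hom.add {σ : ℝ} {F G : Sm d} (hF : Hom σ F) (hG : Hom σ G) : Hom σ (F + G) :=
  fun p hp t ht => by rw [add_apply, add_apply, hF p hp t ht, hG p hp t ht]; ring

theorem Hom.smul {σ : ℝ} {F : Sm d} (c : ℝ) (hF : Hom σ F) : Hom σ (c • F) :=
  fun p hp t ht => by rw [smul_apply, smul_apply, hF p hp t ht]; ring

theorem Hom.sub {σ : ℝ} {F G : Sm d} (hF : Hom σ F) (hG : Hom σ G) : Hom σ (F - G) :=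
  fun p hp t ht => by rw [sub_apply, sub_apply, hF p hp t ht, hG p hp t ht]; ring

theorem Hom.sum {ι : Type*} {s : Finset ι} {σ : ℝ} {F : ι → Sm d} (h : ∀ i ∈ s, Hom σ (F i)) :
    Hom σ (∑ i ∈ s, F i) := fun p hp t ht => by
  rw [sum_apply, sum_apply, Finset.mul_sum]
  exact Finset.sum_congr rfl fun i hi => h i hi p hp t ht

theorem Hom.mul {σ τ : ℝ} {F G : Sm d} (hF : Hom σ F) (hG : Hom τ G) : Hom (σ + τ) (F * G) :=
  fun p hp t ht => by
    rw [mul_apply, mul_apply, hF p hp t ht, hG p hp t ht, Real.rpow_add ht]; ring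

theorem hom_Y (i : Fin (d - 1)) : Hom 1 (Y i : Sm d) := fun p hp t ht => by
  rw [Y_apply _ hp, Y_apply _ (smul_mem_Om hp ht), Real.rpow_one]; rfl

theorem hom_rp (α : ℝ) : Hom α (rp α : Sm d) := fun p hp t ht => by
  rw [rp_apply _ hp, rp_apply _ (smul_mem_Om hp ht)]
  simp only [norm_smul, Real.norm_of_nonneg ht.le]
  rw [Real.mul_rpow ht.le (norm_nonneg _)]

theorem Hom.Dx {σ : ℝ} {F : Sm d} (h : Hom σ F) (i : Fin (d - 1)) : Hom (σ - 1) (Dx i F) := by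
  apply hom_of_euler
  have h1 := congrArg (Sm.Dx i) h.euler_eq
  simp only [euler, map_sum, Dx_mul, Dx_Y, Finset.sum_add_distrib] at h1
  rw [Dx_smul] at h1
  have h2 : ∑ j, Sm.Dx j F * (if i = j then 1 else 0 : Sm d) = Sm.Dx i F := by simp
  rw [h2] at h1
  simp only [euler]
  rw [sub_smul, one_smul, ← h1, add_sub_cancel_right]
  exact Finset.sum_congr rfl fun j _ => by rw [Dx_comm]

theorem Hom.Dt {σ : ℝ} {F : Sm d} (h : Hom σ F) : Hom σ (Dt F) := by
  apply hom_of_euler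
  have h1 := congrArg Sm.Dt h.euler_eq
  simp only [euler, map_sum, Dt_mul, Dt_Y, mul_zero, add_zero] at h1
  rw [Dt_smul] at h1
  rw [← h1, euler]
  exact Finset.sum_congr rfl fun j _ => by rw [Dx_Dt]

theorem Hom.lap {σ : ℝ} {F : Sm d} (h : Hom σ F) : Hom (σ - 2) (lap F) := by
  rw [lap_apply]
  exact Hom.sum fun i _ => ((h.Dx i).Dx i).congr (by ring)

theorem apply_eq_of_hom {σ : ℝ} {F : Sm d} (h : Hom σ F) {p : ℝ × Space d} (hp : p ∈ Om d) :
    F p = ‖p.2‖ ^ σ * F (p.1, ‖p.2‖⁻¹ • p.2) := by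
  have hpos : 0 < ‖p.2‖ := norm_pos_iff.2 hp
  have := h (p.1, ‖p.2‖⁻¹ • p.2) (smul_mem_Om hp (inv_pos.2 hpos)) _ hpos
  simp only [smul_smul, mul_inv_cancel₀ hpos.ne', one_smul] at this
  exact this

theorem coe_mem_Om (u : ℝ) (x : Sph d) : (u, (x : Space d)) ∈ Om d :=
  ne_zero_of_mem_unit_sphere x

theorem Hom.ext {σ : ℝ} {F G : Sm d} (hF : Hom σ F) (hG : Hom σ G)
    (h : ∀ (u : ℝ) (x : Sph d), F (u, x) = G (u, x)) : F = G := by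
  refine Sm.ext fun p hp => ?_
  rw [apply_eq_of_hom hF hp, apply_eq_of_hom hG hp]
  have hpos : ‖p.2‖ ≠ 0 := norm_ne_zero_iff.2 hp
  have := h p.1 ⟨‖p.2‖⁻¹ • p.2, by
    rw [mem_sphere_zero_iff_norm, norm_smul, norm_inv, norm_norm, inv_mul_cancel₀ hpos]⟩
  rw [this]

theorem rp_apply_sphere (α u : ℝ) (x : Sph d) : (rp α : Sm d) (u, x) = 1 := by
  rw [rp_apply _ (coe_mem_Om u x)]
  simp

/-! ### The Laplacian and powers of the radius -/

theorem sum_Dx_Y : (∑ i, Dx i (Y i) : Sm d) = ((d - 1 : ℕ) : ℝ) • 1 := by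
  simp [Dx_Y, Nat.cast_smul_eq_nsmul]

theorem lap_Y (i : Fin (d - 1)) : lap (Y i : Sm d) = 0 := by
  rw [lap_apply]
  refine Finset.sum_eq_zero fun j _ => ?_
  rw [Dx_Y]
  split_ifs <;> simp

theorem lap_rp (α : ℝ) :
    lap (rp α : Sm d) = (α * (α + ((d - 1 : ℕ) : ℝ) - 2)) • rp (α - 2) := by
  have h : ∀ i : Fin (d - 1), Dx i (Dx i (rp α : Sm d))
      = α • (Dx i (Y i) * rp (α - 2) + (α - 2) • ((Y i * Y i) * rp (α - 4))) := by
    intro i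
    rw [Dx_rp, Dx_smul, Dx_mul, Dx_rp, show α - 2 - 2 = α - 4 by ring]
    simp only [mul_smul_comm]
    rw [add_comm, mul_comm (rp (α - 2)), mul_assoc]
  rw [lap_apply]
  simp only [h]
  rw [← Finset.smul_sum, Finset.sum_add_distrib, ← Finset.sum_mul, ← Finset.smul_sum,
    ← Finset.sum_mul, sum_Dx_Y, sum_Y_mul_Y, rp_mul, show 2 + (α - 4) = α - 2 by ring,
    smul_mul_assoc, one_mul, ← add_smul, smul_smul]
  congr 1
  ring

theorem lap_rp_mul {σ : ℝ} {F : Sm d} (hF : Hom σ F) (α : ℝ) :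
    lap (rp α * F) = rp α * lap F
      + (α * (α + ((d - 1 : ℕ) : ℝ) - 2 + 2 * σ)) • (rp (α - 2) * F) := by
  have h : ∑ i, Dx i (rp α) * Dx i F = (α * σ) • (rp (α - 2) * F) := by
    have : ∀ i, Dx i (rp α) * Dx i F = α • (rp (α - 2) * (Y i * Dx i F)) := fun i => by
      rw [Dx_rp, smul_mul_assoc]; congr 1; ring
    simp only [this]
    rw [← Finset.smul_sum, ← Finset.mul_sum, ← euler, hF.euler_eq, mul_smul_comm, smul_smul]
  rw [lap_mul, h, lap_rp, mul_smul_comm, smul_smul, mul_comm F, add_assoc, ← add_smul]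
  congr 2
  ring

/-! ### Solvability of the Poisson equation in a degree of homogeneity -/

/-- The homogeneous Poisson equation has only the trivial solution of degree `σ`. -/
def LapInj (d : ℕ) (σ : ℝ) : Prop := ∀ F : Sm d, Hom σ F → lap F = 0 → F = 0

/-- The Poisson equation is solvable in degree `σ`. -/
def LapSurj (d : ℕ) (σ : ℝ) : Prop :=
  ∀ G : Sm d, Hom (σ - 2) G → ∃ F : Sm d, Hom σ F ∧ lap F = G

theorem lap_kelvin {σ : ℝ} {F : Sm d} (hF : Hom σ F) :
    lap (rp (2 - ((d - 1 : ℕ) : ℝ) - 2 * σ) * F)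
      = rp (2 - ((d - 1 : ℕ) : ℝ) - 2 * σ) * lap F := by
  rw [lap_rp_mul hF]
  have : (2 - ((d - 1 : ℕ) : ℝ) - 2 * σ) *
    (2 - ((d - 1 : ℕ) : ℝ) - 2 * σ + ((d - 1 : ℕ) : ℝ) - 2 + 2 * σ) = 0 := by ring
  rw [this, zero_smul, add_zero]

theorem rp_mul_cancel (α : ℝ) (F : Sm d) : rp α * (rp (-α) * F) = F := by
  rw [← mul_assoc, rp_mul, add_neg_cancel, rp_zero, one_mul]

theorem LapInj.kelvin {σ τ : ℝ} (h : LapInj d σ) (hτ : τ = 2 - ((d - 1 : ℕ) : ℝ) - σ) :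
    LapInj d τ := by
  intro F hF h0
  have h1 := lap_kelvin hF
  rw [h0, mul_zero] at h1
  have h2 := h _ (((hom_rp _).mul hF).congr (by rw [hτ]; ring)) h1
  have h3 := rp_mul_cancel (-(2 - ((d - 1 : ℕ) : ℝ) - 2 * τ)) F
  rw [neg_neg, h2, mul_zero] at h3
  exact h3.symm

theorem LapSurj.kelvin {σ τ : ℝ} (h : LapSurj d σ) (hτ : τ = 2 - ((d - 1 : ℕ) : ℝ) - σ) :
    LapSurj d τ := by
  intro G hG
  obtain ⟨F, hF, hl⟩ := h (rp (-(2 - ((d - 1 : ℕ) : ℝ) - 2 * σ)) * G)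
    (((hom_rp _).mul hG).congr (by rw [hτ]; ring))
  refine ⟨_, ((hom_rp (2 - ((d - 1 : ℕ) : ℝ) - 2 * σ)).mul hF).congr (by rw [hτ]; ring), ?_⟩
  rw [lap_kelvin hF, hl, rp_mul_cancel]

theorem LapInj.succ {σ : ℝ} (h : LapInj d σ) (h0 : σ + 1 ≠ 0) : LapInj d (σ + 1) := by
  intro F hF hl
  have h1 : ∀ i, Dx i F = 0 := fun i =>
    h _ ((hF.Dx i).congr (by ring)) (by rw [lap_Dx, hl, map_zero])
  have h2 := hF.euler_eq
  simp only [euler, h1, mul_zero, Finset.sum_const_zero] at h2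
  exact (smul_eq_zero.1 h2.symm).resolve_left h0

theorem LapSurj.succ {σ : ℝ} (hs : LapSurj d σ) (hi : LapInj d (σ - 1)) (h0 : σ + 1 ≠ 0)
    (h2 : σ - 1 ≠ 0) : LapSurj d (σ + 1) := by
  intro G hG
  choose H hH hl using fun i => hs (Dx i G) ((hG.Dx i).congr (by ring))
  have hcurl : ∀ i j, Dx i (H j) = Dx j (H i) := fun i j => by
    refine sub_eq_zero.1 (hi _ (((hH j).Dx i).sub ((hH i).Dx j)) ?_)
    rw [map_sub, lap_Dx, lap_Dx, hl, hl, Dx_comm, sub_self]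
  have hdiv : (∑ i, Dx i (H i)) = G := by
    refine sub_eq_zero.1 ?_
    have hhom : Hom (σ - 1) (∑ i, Dx i (H i) - G) :=
      (Hom.sum fun i _ => (hH i).Dx i).sub (hG.congr (by ring))
    have hD : ∀ j, Dx j (∑ i, Dx i (H i) - G) = 0 := fun j => by
      rw [map_sub, map_sum, ← hl j, lap_apply, sub_eq_zero]
      exact Finset.sum_congr rfl fun i _ => by rw [Dx_comm, hcurl j i]
    have := hhom.euler_eq
    simp only [euler, hD, mul_zero, Finset.sum_const_zero] at this
    exact (smul_eq_zero.1 this.symm).resolve_left h2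
  refine ⟨(σ + 1)⁻¹ • ∑ i, Y i * H i, Hom.smul _ (Hom.sum fun i _ =>
    ((hom_Y i).mul (hH i)).congr (by ring)), ?_⟩
  have hD : ∀ j, Dx j ((σ + 1)⁻¹ • ∑ i, Y i * H i) = H j := fun j => by
    rw [Dx_smul, map_sum]
    simp only [Dx_mul, Dx_Y, Finset.sum_add_distrib, hcurl j]
    have h3 : ∑ i, H i * (if j = i then 1 else 0 : Sm d) = H j := by simp
    rw [h3, ← euler, (hH j).euler_eq]
    nth_rewrite 2 [← one_smul ℝ (H j)]
    rw [← add_smul, smul_smul, inv_mul_cancel₀ h0, one_smul]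
  rw [lap_apply]
  simp only [hD]
  exact hdiv

end Sm

end

section

namespace Sm

variable {d : ℕ}

/-! ### Cartesian components and the divergence -/

theorem Dx_unit (i j : Fin (d - 1)) : Dx j (rp (-1) * Y i : Sm d)
    = (if j = i then rp (-1) else 0) - rp (-3) * (Y i * Y j) := by
  rw [Dx_mul, Dx_Y, Dx_rp, show (-1 : ℝ) - 2 = -3 by norm_num]
  split_ifs <;> simp <;> ring

theorem lap_unit (i : Fin (d - 1)) : lap (rp (-1) * Y i : Sm d)
    = (-(((d - 1 : ℕ) : ℝ) - 1)) • (rp (-3) * Y i) := by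
  rw [lap_rp_mul (hom_Y i), lap_Y, mul_zero, zero_add, show (-1 : ℝ) - 2 = -3 by norm_num]
  congr 1
  ring

theorem lap_radial {σ : ℝ} {G : Fin (d - 1) → Sm d} (hG : ∀ i, Hom σ (G i)) :
    lap (∑ i, rp (-1) * Y i * G i) = ∑ i, rp (-1) * Y i * lap (G i)
      + (2 : ℝ) • (rp (-1) * ∑ i, Dx i (G i))
      - (((d - 1 : ℕ) : ℝ) - 1 + 2 * σ) • (rp (-3) * ∑ i, Y i * G i) := by
  have h : ∀ i, lap (rp (-1) * Y i * G i) = rp (-1) * Y i * lap (G i)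
      + (2 : ℝ) • (rp (-1) * Dx i (G i))
      - (((d - 1 : ℕ) : ℝ) - 1 + 2 * σ) • (rp (-3) * (Y i * G i)) := by
    intro i
    have h1 : ∑ j, Dx j (rp (-1) * Y i) * Dx j (G i)
        = rp (-1) * Dx i (G i) - rp (-3) * (Y i * (σ • G i)) := by
      rw [← (hG i).euler_eq, euler]
      simp only [Dx_unit, sub_mul, Finset.sum_sub_distrib, Finset.mul_sum, ite_mul, zero_mul,
        Finset.sum_ite_eq', Finset.mem_univ, if_true]
      congr 1
      exact Finset.sum_congr rfl fun j _ => by ring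
    rw [lap_mul, h1, lap_unit]
    refine Sm.ext fun p _ => ?_
    simp only [add_apply, sub_apply, mul_apply, smul_apply]
    ring
  rw [map_sum]
  simp only [h, Finset.sum_sub_distrib, Finset.sum_add_distrib, Finset.mul_sum, Finset.smul_sum]

/-- The Cartesian divergence of the wave `∑ r^(-n) F n`, at order `n`. -/
def cdiv (F : ℝ → Option (Fin (d - 1)) → Sm d) (n : ℝ) : Sm d :=
  ∑ i, Dx i (F (n - 1) (some i)) - Dt (F n none) - ∑ i, rp (-1) * Y i * Dt (F n (some i))

/-- The wave operator at order `n`. -/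
def wave (F : ℝ → Sm d) (n : ℝ) : Sm d :=
  lap (F (n - 1)) + (2 * n - d + 2) • (rp (-1) * Dt (F n))

theorem hom_cdiv {F : ℝ → Option (Fin (d - 1)) → Sm d} (hF : ∀ n c, Hom (-n) (F n c)) (n : ℝ) :
    Hom (-n) (cdiv F n) :=
  ((Hom.sum fun i _ => ((hF _ _).Dx i).congr (by ring)).sub (hF _ _).Dt).sub
    (Hom.sum fun i _ => (((hom_rp _).mul (hom_Y i)).mul (hF _ _).Dt).congr (by ring))

theorem hom_wave {F : ℝ → Sm d} (hF : ∀ n, Hom (-n) (F n)) (n : ℝ) :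
    Hom (-n - 1) (wave F n) :=
  ((hF (n - 1)).lap.congr (by ring)).add
    ((((hom_rp _).mul (hF n).Dt).smul _).congr (by ring))

theorem wave_cdiv (hd : 1 ≤ d) {F J : ℝ → Option (Fin (d - 1)) → Sm d} {κ : ℝ}
    (hF : ∀ n c, Hom (-n) (F n c)) (hw : ∀ n c, wave (fun m => F m c) n = κ • J (n + 1) c)
    (hJ : ∀ n, cdiv J n = 0) (n : ℝ) : wave (cdiv F) n = 0 := by
  have hN : ((d - 1 : ℕ) : ℝ) = d - 1 := by rw [Nat.cast_sub hd, Nat.cast_one]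
  have e1 : ∀ c, lap (F (n - 1 - 1) c)
      = κ • J n c - (2 * (n - 1) - d + 2) • (rp (-1) * Dt (F (n - 1) c)) := fun c => by
    have := hw (n - 1) c
    rw [wave, sub_add_cancel] at this
    rw [← this, add_sub_cancel_right]
  have e2 : ∀ c, lap (F (n - 1) c)
      = κ • J (n + 1) c - (2 * n - d + 2) • (rp (-1) * Dt (F n c)) := fun c => by
    rw [← hw n c, wave, add_sub_cancel_right]
  have e3 := hJ (n + 1)
  rw [cdiv, add_sub_cancel_right] at e3
  have e4 : ∀ i, Dx i (lap (F (n - 1 - 1) (some i))) = κ • Dx i (J n (some i))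
      - (2 * (n - 1) - d + 2) • (rp (-1) * Dt (Dx i (F (n - 1) (some i)))
        - rp (-3) * (Y i * Dt (F (n - 1) (some i)))) := fun i => by
    rw [e1, map_sub, Dx_smul, Dx_smul, Dx_mul, Dx_rp, Dx_Dt, show (-1 : ℝ) - 2 = -3 by norm_num]
    congr 2
    rw [neg_smul, one_smul]
    ring
  have e5 : lap (cdiv F (n - 1)) = ∑ i, Dx i (lap (F (n - 1 - 1) (some i)))
      - Dt (lap (F (n - 1) none)) - lap (∑ i, rp (-1) * Y i * Dt (F (n - 1) (some i))) := by
    rw [cdiv, map_sub, map_sub, map_sum, lap_Dt]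
    simp only [lap_Dx]
  have e6 : ∀ i, lap (Dt (F (n - 1) (some i))) = κ • Dt (J (n + 1) (some i))
      - (2 * n - d + 2) • (rp (-1) * Dt (Dt (F n (some i)))) := fun i => by
    rw [lap_Dt, e2, map_sub, Dt_smul, Dt_smul, Dt_mul, Dt_rp, mul_zero, add_zero]
  have e7 : Dt (lap (F (n - 1) none)) = κ • Dt (J (n + 1) none)
      - (2 * n - d + 2) • (rp (-1) * Dt (Dt (F n none))) := by
    rw [e2, map_sub, Dt_smul, Dt_smul, Dt_mul, Dt_rp, mul_zero, add_zero]
  have e8 : Dt (cdiv F n) = ∑ i, Dt (Dx i (F (n - 1) (some i))) - Dt (Dt (F n none))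
      - ∑ i, rp (-1) * Y i * Dt (Dt (F n (some i))) := by
    simp [cdiv, Dt_rp, Dt_Y]
  rw [wave, e5, e7, e8, lap_radial fun i => (hF (n - 1) (some i)).Dt]
  simp only [e4, e6]
  refine Sm.ext fun p hp => ?_
  have e9 := congrArg (fun G : Sm d => G p) e3
  simp only [add_apply, sub_apply, mul_apply, smul_apply, sum_apply, zero_apply, mul_sub,
    Finset.sum_sub_distrib, Dx_Dt] at e9 ⊢
  have p1 : ∀ (c : ℝ) (f : Fin (d - 1) → ℝ), ∑ i, c * f i = c * ∑ i, f i := fun c f =>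
    (Finset.mul_sum _ _ _).symm
  have r1 : ∀ i, rp (-1) p * Y i p * (κ * Dt (J (n + 1) (some i)) p)
      = κ * (rp (-1) p * Y i p * Dt (J (n + 1) (some i)) p) := fun i => by ring
  have r2 : ∀ i, rp (-1) p * Y i p * ((2 * n - d + 2) * (rp (-1) p * Dt (Dt (F n (some i))) p))
      = ((2 * n - d + 2) * rp (-1) p) * (rp (-1) p * Y i p * Dt (Dt (F n (some i))) p) :=
    fun i => by ring
  simp only [r1, r2, p1, hN]
  linear_combination κ * e9

end Sm

end

section

open MeasureTheory

section ParametricIntegral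

variable {E Z F : Type} [NormedAddCommGroup Z] [MeasurableSpace Z] [BorelSpace Z]
  [NormedAddCommGroup F] [NormedSpace ℝ F]

theorem aestronglyMeasurable_weight_smul {μ : Measure Z} {K : Set Z} (hK : IsCompact K)
    {w : Z → ℝ} (hw : AEStronglyMeasurable w μ) (hw0 : ∀ z ∉ K, w z = 0) {f : Z → F}
    (hf : ContinuousOn f K) : AEStronglyMeasurable (fun z => w z • f z) μ := by
  have h1 : (fun z => w z • f z) = K.indicator fun z => w z • f z := by
    funext z
    by_cases hz : z ∈ K
    · simp [hz]
    · simp [hz, hw0 z hz]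
  rw [h1, aestronglyMeasurable_indicator_iff hK.measurableSet]
  exact hw.restrict.smul (hf.aestronglyMeasurable_of_isCompact hK hK.measurableSet)

theorem integrable_weight_smul {μ : Measure Z} {K : Set Z} (hK : IsCompact K)
    {w : Z → ℝ} (hw : Integrable w μ) (hw0 : ∀ z ∉ K, w z = 0) {f : Z → F}
    (hf : ContinuousOn f K) : Integrable (fun z => w z • f z) μ := by
  obtain ⟨C, hC⟩ := hK.exists_bound_of_continuousOn hf
  refine (hw.norm.mul_const C).mono'
    (aestronglyMeasurable_weight_smul hK hw.1 hw0 hf) (Filter.Eventually.of_forall fun z => ?_)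
  rw [norm_smul]
  by_cases hz : z ∈ K
  · exact mul_le_mul_of_nonneg_left (hC z hz) (norm_nonneg _)
  · simp [hw0 z hz]

variable [NormedAddCommGroup E] [NormedSpace ℝ E] [FiniteDimensional ℝ E] [NormedSpace ℝ Z]

theorem hasFDerivAt_weighted_integral {μ : Measure Z} {K : Set Z} (hK : IsCompact K)
    {U : Set E} (hU : IsOpen U) {V : Set Z} (hV : IsOpen V) (hKV : K ⊆ V)
    {w : Z → ℝ} (hw : Integrable w μ) (hw0 : ∀ z ∉ K, w z = 0) {Φ : E × Z → F}
    (hΦ : ContDiffOn ℝ ∞ Φ (U ×ˢ V)) {p : E} (hp : p ∈ U) :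
    HasFDerivAt (fun q => ∫ z, w z • Φ (q, z) ∂μ)
      (∫ z, w z • (fderiv ℝ Φ (p, z)).comp (ContinuousLinearMap.inl ℝ E Z) ∂μ) p := by
  have hUV : IsOpen (U ×ˢ V) := hU.prod hV
  have hd : ContDiffOn ℝ ∞ (fun q => (fderiv ℝ Φ q).comp (ContinuousLinearMap.inl ℝ E Z))
      (U ×ˢ V) :=
    (hΦ.fderiv_of_isOpen hUV (m := ∞) (by simp)).clm_comp contDiffOn_const
  have hslice : ∀ q ∈ U, Set.MapsTo (fun z : Z => (q, z)) K (U ×ˢ V) :=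
    fun q hq z hz => ⟨hq, hKV hz⟩
  have hcont : ∀ q : E, ContinuousOn (fun z : Z => (q, z)) K := fun q => by fun_prop
  obtain ⟨r, hr, hrU⟩ := Metric.nhds_basis_closedBall.mem_iff.1 (hU.mem_nhds hp)
  have hsub : Metric.closedBall p r ×ˢ K ⊆ U ×ˢ V := Set.prod_mono hrU hKV
  obtain ⟨C, hC⟩ := ((isCompact_closedBall p r).prod hK).exists_bound_of_continuousOn
    (hd.continuousOn.mono hsub)
  have hball : Metric.ball p r ∈ nhds p := Metric.ball_mem_nhds p hr
  refine hasFDerivAt_integral_of_dominated_of_fderiv_le (𝕜 := ℝ)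
    (F := fun q z => w z • Φ (q, z))
    (F' := fun q z => w z • (fderiv ℝ Φ (q, z)).comp (ContinuousLinearMap.inl ℝ E Z))
    (bound := fun z => ‖w z‖ * C) hball
    ?_ ?_ ?_ ?_ (hw.norm.mul_const C) ?_
  · filter_upwards [hball] with q hq
    exact aestronglyMeasurable_weight_smul hK hw.1 hw0
      (hΦ.continuousOn.comp (hcont q) (hslice q (hrU (Metric.ball_subset_closedBall hq))))
  · exact integrable_weight_smul hK hw hw0 (hΦ.continuousOn.comp (hcont p) (hslice p hp))
  · exact aestronglyMeasurable_weight_smul hK hw.1 hw0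
      (hd.continuousOn.comp (hcont p) (hslice p hp))
  · refine Filter.Eventually.of_forall fun z q hq => ?_
    rw [norm_smul]
    by_cases hz : z ∈ K
    · exact mul_le_mul_of_nonneg_left (hC (q, z) ⟨Metric.ball_subset_closedBall hq, hz⟩)
        (norm_nonneg _)
    · simp [hw0 z hz]
  · refine Filter.Eventually.of_forall fun z q hq => ?_
    by_cases hz : z ∈ K
    · have hm : (q, z) ∈ U ×ˢ V := ⟨hrU (Metric.ball_subset_closedBall hq), hKV hz⟩
      have h1 : HasFDerivAt Φ (fderiv ℝ Φ (q, z)) (q, z) :=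
        ((hΦ.contDiffAt (hUV.mem_nhds hm)).differentiableAt (by simp)).hasFDerivAt
      exact (h1.comp q (hasFDerivAt_prodMk_left q z)).const_smul (w z)
    · simp only [hw0 z hz, zero_smul]
      exact hasFDerivAt_const 0 q

theorem contDiffOn_weighted_integral_nat {μ : Measure Z} {K : Set Z} (hK : IsCompact K)
    {U : Set E} (hU : IsOpen U) {V : Set Z} (hV : IsOpen V) (hKV : K ⊆ V)
    {w : Z → ℝ} (hw : Integrable w μ) (hw0 : ∀ z ∉ K, w z = 0) (n : ℕ) :
    ∀ (F : Type) [NormedAddCommGroup F] [NormedSpace ℝ F] (Φ : E × Z → F),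
      ContDiffOn ℝ ∞ Φ (U ×ˢ V) → ContDiffOn ℝ n (fun q => ∫ z, w z • Φ (q, z) ∂μ) U := by
  induction n with
  | zero =>
    intro F _ _ Φ hΦ
    rw [Nat.cast_zero, contDiffOn_zero]
    exact fun q hq => (hasFDerivAt_weighted_integral hK hU hV hKV hw hw0 hΦ
      hq).continuousAt.continuousWithinAt
  | succ n ih =>
    intro F _ _ Φ hΦ
    rw [Nat.cast_succ, contDiffOn_succ_iff_fderiv_of_isOpen hU]
    refine ⟨fun q hq => (hasFDerivAt_weighted_integral hK hU hV hKV hw hw0 hΦ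
      hq).differentiableAt.differentiableWithinAt, by simp, ?_⟩
    refine (ih _ (fun q => (fderiv ℝ Φ q).comp (ContinuousLinearMap.inl ℝ E Z))
      ((hΦ.fderiv_of_isOpen (hU.prod hV) (m := ∞) (by simp)).clm_comp contDiffOn_const)).congr
      fun q hq => ?_
    exact (hasFDerivAt_weighted_integral hK hU hV hKV hw hw0 hΦ hq).fderiv

theorem contDiffOn_weighted_integral {μ : Measure Z} {K : Set Z} (hK : IsCompact K)
    {U : Set E} (hU : IsOpen U) {V : Set Z} (hV : IsOpen V) (hKV : K ⊆ V)
    {w : Z → ℝ} (hw : Integrable w μ) (hw0 : ∀ z ∉ K, w z = 0) {Φ : E × Z → F}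
    (hΦ : ContDiffOn ℝ ∞ Φ (U ×ˢ V)) : ContDiffOn ℝ ∞ (fun q => ∫ z, w z • Φ (q, z) ∂μ) U :=
  contDiffOn_infty.2 fun n => contDiffOn_weighted_integral_nat hK hU hV hKV hw hw0 n F Φ hΦ

theorem fderiv_weighted_integral_apply {μ : Measure Z} {K : Set Z} (hK : IsCompact K)
    {U : Set E} (hU : IsOpen U) {V : Set Z} (hV : IsOpen V) (hKV : K ⊆ V)
    {w : Z → ℝ} (hw : Integrable w μ) (hw0 : ∀ z ∉ K, w z = 0) {Φ : E × Z → ℝ}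
    (hΦ : ContDiffOn ℝ ∞ Φ (U ×ˢ V)) {p : E} (hp : p ∈ U) (v : E) :
    fderiv ℝ (fun q => ∫ z, w z * Φ (q, z) ∂μ) p v = ∫ z, w z * fderiv ℝ Φ (p, z) (v, 0) ∂μ := by
  have h := hasFDerivAt_weighted_integral hK hU hV hKV hw hw0 hΦ hp
  simp only [smul_eq_mul] at h
  have hi : Integrable
      (fun z => w z • (fderiv ℝ Φ (p, z)).comp (ContinuousLinearMap.inl ℝ E Z)) μ :=
    integrable_weight_smul hK hw hw0
      (((hΦ.fderiv_of_isOpen (hU.prod hV) (m := ∞) (by simp)).clm_comp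
        contDiffOn_const).continuousOn.comp (f := fun z : Z => (p, z)) (by fun_prop)
          fun z hz => ⟨hp, hKV hz⟩)
  rw [h.fderiv, ContinuousLinearMap.integral_apply hi]
  simp

theorem fderiv_fderiv_weighted_integral {μ : Measure Z} {K : Set Z} (hK : IsCompact K)
    {U : Set E} (hU : IsOpen U) {V : Set Z} (hV : IsOpen V) (hKV : K ⊆ V)
    {w : Z → ℝ} (hw : Integrable w μ) (hw0 : ∀ z ∉ K, w z = 0) {Φ : E × Z → ℝ}
    (hΦ : ContDiffOn ℝ ∞ Φ (U ×ˢ V)) {p : E} (hp : p ∈ U) (v : E) :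
    fderiv ℝ (fun q => fderiv ℝ (fun q => ∫ z, w z * Φ (q, z) ∂μ) q v) p v
      = ∫ z, w z * fderiv ℝ (fun r => fderiv ℝ Φ r (v, 0)) (p, z) (v, 0) ∂μ := by
  have h1 : (fun q => fderiv ℝ (fun q => ∫ z, w z * Φ (q, z) ∂μ) q v)
      =ᶠ[nhds p] fun q => ∫ z, w z * fderiv ℝ Φ (q, z) (v, 0) ∂μ := by
    filter_upwards [hU.mem_nhds hp] with q hq using
      fderiv_weighted_integral_apply hK hU hV hKV hw hw0 hΦ hq v
  rw [h1.fderiv_eq]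
  exact fderiv_weighted_integral_apply (Φ := fun r => fderiv ℝ Φ r (v, 0)) hK hU hV hKV hw hw0
    ((hΦ.fderiv_of_isOpen (hU.prod hV) (m := ∞) (by simp)).clm_apply contDiffOn_const) hp v

end ParametricIntegral

section Slices

variable {E Z : Type} [NormedAddCommGroup E] [NormedSpace ℝ E] [NormedAddCommGroup Z]
  [NormedSpace ℝ Z]

theorem contDiffOn_fderiv_fderiv {U : Set E} (hU : IsOpen U) {Φ : E → ℝ}
    (hΦ : ContDiffOn ℝ ∞ Φ U) (v : E) :
    ContDiffOn ℝ ∞ (fun q => fderiv ℝ (fun r => fderiv ℝ Φ r v) q v) U :=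
  (((hΦ.fderiv_of_isOpen hU (m := ∞) (by simp)).clm_apply
    contDiffOn_const).fderiv_of_isOpen hU (m := ∞) (by simp)).clm_apply contDiffOn_const

theorem fderiv_slice {U : Set (E × Z)} (hU : IsOpen U) {Φ : E × Z → ℝ}
    (hΦ : ContDiffOn ℝ ∞ Φ U) {p : E} {z : Z} (hp : (p, z) ∈ U) (v : E) :
    fderiv ℝ Φ (p, z) (v, 0) = fderiv ℝ (fun q => Φ (q, z)) p v := by
  have h1 : HasFDerivAt Φ (fderiv ℝ Φ (p, z)) (p, z) :=
    ((hΦ.contDiffAt (hU.mem_nhds hp)).differentiableAt (by simp)).hasFDerivAt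
  have h2 := h1.comp p (hasFDerivAt_prodMk_left (𝕜 := ℝ) p z)
  have h3 : fderiv ℝ (fun q => Φ (q, z)) p = _ := h2.fderiv
  rw [h3]
  simp

theorem fderiv_fderiv_slice {U : Set (E × Z)} (hU : IsOpen U) {Φ : E × Z → ℝ}
    (hΦ : ContDiffOn ℝ ∞ Φ U) {p : E} {z : Z} (hp : (p, z) ∈ U) (v : E) :
    fderiv ℝ (fun r => fderiv ℝ Φ r (v, 0)) (p, z) (v, 0)
      = fderiv ℝ (fun q => fderiv ℝ (fun q => Φ (q, z)) q v) p v := by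
  have h1 : ContDiffOn ℝ ∞ (fun r => fderiv ℝ Φ r (v, 0)) U :=
    (hΦ.fderiv_of_isOpen hU (m := ∞) (by simp)).clm_apply contDiffOn_const
  rw [fderiv_slice hU h1 hp v]
  have h2 : (fun q => fderiv ℝ Φ (q, z) (v, 0))
      =ᶠ[nhds p] fun q => fderiv ℝ (fun q => Φ (q, z)) q v := by
    have hc : Continuous fun q : E => (q, z) := by fun_prop
    filter_upwards [hc.continuousAt.preimage_mem_nhds (hU.mem_nhds hp)] with q hq using
      fderiv_slice hU hΦ hq v
  rw [h2.fderiv_eq]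

end Slices

end

section

open MeasureTheory

namespace Sm

variable {d : ℕ}

/-! ### Integration in retarded time -/

theorem hasDerivAt_time (F : Sm d) {p : ℝ × Space d} (hp : p ∈ Om d) :
    HasDerivAt (fun v => F (v, p.2)) (Dt F p) p.1 := by
  have h1 : HasDerivAt (fun v : ℝ => (v, p.2)) ((1 : ℝ), (0 : Space d)) p.1 :=
    (hasDerivAt_id p.1).prodMk (hasDerivAt_const p.1 p.2)
  rw [Dt, dir_apply _ _ hp]
  exact (F.differentiableAt hp).hasFDerivAt.comp_hasDerivAt p.1 h1

theorem eq_of_Dt_eq {F G : Sm d} {u₀ : ℝ} (h : Dt F = Dt G)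
    (h0 : ∀ y : Space d, y ≠ 0 → F (u₀, y) = G (u₀, y)) : F = G := by
  refine Sm.ext fun p hp => ?_
  have hd : ∀ v : ℝ, HasDerivAt (fun v => F (v, p.2) - G (v, p.2)) 0 v := fun v => by
    have hv : (v, p.2) ∈ Om d := hp
    have := (hasDerivAt_time F hv).sub (hasDerivAt_time G hv)
    rwa [h, sub_self] at this
  have hc := is_const_of_deriv_eq_zero (fun v => (hd v).differentiableAt)
    (fun v => (hd v).deriv) p.1 u₀
  rw [h0 _ hp, sub_self] at hc
  exact sub_eq_zero.1 hc

theorem exists_Dt_eq (u₀ : ℝ) {σ : ℝ} {G B : Sm d} (hG : Hom σ G) (hB : Hom σ B) :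
    ∃ F : Sm d, Hom σ F ∧ Dt F = G ∧ ∀ y : Space d, y ≠ 0 → F (u₀, y) = B (u₀, y) := by
  set w : ℝ → ℝ := (Set.Icc (0 : ℝ) 1).indicator fun _ => 1 with hw
  have hwi : Integrable w volume :=
    (integrable_indicator_iff measurableSet_Icc).2 (integrableOn_const (by simp))
  have hΦ : ContDiffOn ℝ ∞ (fun q : (ℝ × Space d) × ℝ => G (u₀ + (q.1.1 - u₀) * q.2, q.1.2))
      (Om d ×ˢ Set.univ) :=
    G.contDiffOn.comp (by fun_prop) fun q hq => hq.1
  have hI := contDiffOn_weighted_integral (μ := volume) (isCompact_Icc (a := (0 : ℝ)) (b := 1))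
    isOpen_Om isOpen_univ (Set.subset_univ _) hwi (fun z hz => Set.indicator_of_notMem hz _) hΦ
  have hB0 : ContDiffOn ℝ ∞ (fun p : ℝ × Space d => B (u₀, p.2)) (Om d) :=
    B.contDiffOn.comp (by fun_prop) fun q hq => hq
  have hint : ∀ p : ℝ × Space d, (p.1 - u₀) * ∫ t, w t • G (u₀ + (p.1 - u₀) * t, p.2)
      = ∫ s in u₀..p.1, G (s, p.2) := fun p => by
    have h1 : ∀ t, w t • G (u₀ + (p.1 - u₀) * t, p.2)
        = (Set.Icc (0 : ℝ) 1).indicator (fun t => G (u₀ + (p.1 - u₀) * t, p.2)) t := fun t => by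
      by_cases ht : t ∈ Set.Icc (0 : ℝ) 1 <;> simp [hw, ht]
    simp only [h1]
    rw [integral_indicator measurableSet_Icc, integral_Icc_eq_integral_Ioc,
      ← intervalIntegral.integral_of_le zero_le_one, ← smul_eq_mul,
      intervalIntegral.smul_integral_comp_add_mul (fun s => G (s, p.2))]
    simp
  have hF : ContDiffOn ℝ ∞ (fun p : ℝ × Space d => B (u₀, p.2) + ∫ s in u₀..p.1, G (s, p.2))
      (Om d) := by
    refine (hB0.add ((contDiffOn_fst.sub (contDiffOn_const (c := u₀))).mul hI)).congr
      fun p _ => ?_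
    rw [← hint]
  refine ⟨mk _ hF, fun p hp t ht => ?_, Sm.ext fun p hp => ?_, fun y hy => ?_⟩
  · rw [mk_apply _ _ hp, mk_apply _ _ (smul_mem_Om hp ht)]
    have h1 : ∀ s : ℝ, G (s, t • p.2) = t ^ σ * G (s, p.2) := fun s => hG (s, p.2) hp t ht
    simp only [h1, intervalIntegral.integral_const_mul]
    rw [hB (u₀, p.2) hp t ht, mul_add]
  · have hcont : Continuous fun s : ℝ => G (s, p.2) :=
      continuous_iff_continuousAt.2 fun s =>
        (hasDerivAt_time G (p := (s, p.2)) hp).continuousAt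
    have h1 : HasDerivAt (fun v => B (u₀, p.2) + ∫ s in u₀..v, G (s, p.2)) (G p) p.1 :=
      (intervalIntegral.integral_hasDerivAt_right (hcont.intervalIntegrable _ _)
        hcont.aestronglyMeasurable.stronglyMeasurableAtFilter hcont.continuousAt).const_add _
    refine (hasDerivAt_time (mk _ hF) hp).unique (h1.congr_of_eventuallyEq ?_)
    exact Filter.Eventually.of_forall fun v => mk_apply _ hF (p := (v, p.2)) hp
  · rw [mk_apply _ hF (p := (u₀, y)) hy]
    simp

/-! ### Weighted integrals over a spherical shell -/

/-- A smooth bump supported in `[1, 2]`. -/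
def radialBump : ContDiffBump (3 / 2 : ℝ) := ⟨1 / 4, 1 / 2, by norm_num, by norm_num⟩

/-- A smooth rotation-invariant weight supported in the shell `1 ≤ |z| ≤ 2`. -/
def wt (z : Space d) : ℝ := radialBump ‖z‖

/-- The closed shell `1 ≤ |z| ≤ 2`. -/
def shell (d : ℕ) : Set (Space d) := {z | 1 ≤ ‖z‖ ∧ ‖z‖ ≤ 2}

theorem isCompact_shell : IsCompact (shell d) := by
  refine (isCompact_closedBall (0 : Space d) 2).of_isClosed_subset ?_ fun z hz => ?_
  · exact (isClosed_le continuous_const continuous_norm).inter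
      (isClosed_le continuous_norm continuous_const)
  · simpa using hz.2

theorem shell_subset : shell d ⊆ {z | z ≠ 0} := fun z hz h => by
  have := hz.1
  rw [h, norm_zero] at this
  linarith

theorem wt_eq_zero {z : Space d} (hz : z ∉ shell d) : wt z = 0 := by
  refine radialBump.zero_of_le_dist ?_
  rw [Real.dist_eq]
  change (1 / 2 : ℝ) ≤ _
  by_contra! h
  rw [abs_lt] at h
  exact hz ⟨by linarith [h.1], by linarith [h.2]⟩

theorem wt_nonneg (z : Space d) : 0 ≤ wt z := radialBump.nonneg

theorem continuous_wt : Continuous (wt : Space d → ℝ) :=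
  radialBump.continuous.comp continuous_norm

theorem integrable_wt : Integrable (wt : Space d → ℝ) := by
  refine continuous_wt.integrable_of_hasCompactSupport
    (HasCompactSupport.of_support_subset_isCompact isCompact_shell fun z hz => ?_)
  by_contra h
  exact hz (wt_eq_zero h)

theorem isOpen_ne_zero : IsOpen {z : Space d | z ≠ 0} := isOpen_ne

theorem Om_eq : Om d = Set.univ ×ˢ {z : Space d | z ≠ 0} := by
  ext p; simp [Om]

/-- The weighted integral of a smooth function over the shell. -/
def shellInt (F : Sm d) (u : ℝ) : ℝ := ∫ z, wt z * F (u, z)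

theorem continuousOn_slice (F : Sm d) (u : ℝ) :
    ContinuousOn (fun z => F (u, z)) {z : Space d | z ≠ 0} :=
  F.contDiffOn.continuousOn.comp (by fun_prop) fun _ hz => hz

theorem integrable_wt_mul (F : Sm d) (u : ℝ) : Integrable fun z => wt z * F (u, z) :=
  integrable_weight_smul isCompact_shell integrable_wt (fun _ => wt_eq_zero)
    ((continuousOn_slice F u).mono shell_subset)

theorem shellInt_add (F G : Sm d) (u : ℝ) :
    shellInt (F + G) u = shellInt F u + shellInt G u := by
  rw [shellInt, shellInt, shellInt, ← integral_add (integrable_wt_mul F u) (integrable_wt_mul G u)]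
  simp only [add_apply, mul_add]

theorem shellInt_smul (c : ℝ) (F : Sm d) (u : ℝ) : shellInt (c • F) u = c * shellInt F u := by
  rw [shellInt, shellInt, ← integral_const_mul]
  simp only [smul_apply, mul_left_comm]

theorem shellInt_zero (u : ℝ) : shellInt (0 : Sm d) u = 0 := by simp [shellInt, zero_apply]

theorem shellInt_neg (F : Sm d) (u : ℝ) : shellInt (-F) u = -shellInt F u := by
  rw [← neg_one_smul ℝ, shellInt_smul, neg_one_mul]

theorem shellInt_sub (F G : Sm d) (u : ℝ) :
    shellInt (F - G) u = shellInt F u - shellInt G u := by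
  rw [sub_eq_add_neg, shellInt_add, shellInt_neg, sub_eq_add_neg]

theorem hasDerivAt_shellInt (F : Sm d) (u : ℝ) :
    HasDerivAt (shellInt F) (shellInt (Dt F) u) u := by
  have hΦ : ContDiffOn ℝ ∞ F (Set.univ ×ˢ {z : Space d | z ≠ 0}) := Om_eq ▸ F.contDiffOn
  have h1 := hasFDerivAt_weighted_integral (μ := volume) isCompact_shell isOpen_univ isOpen_ne_zero
    shell_subset integrable_wt (fun _ => wt_eq_zero) hΦ (Set.mem_univ u)
  have h2 := fderiv_weighted_integral_apply (μ := volume) isCompact_shell isOpen_univ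
    isOpen_ne_zero shell_subset integrable_wt (fun _ => wt_eq_zero) hΦ (Set.mem_univ u) 1
  have h3 := h1.differentiableAt.hasDerivAt
  simp only [smul_eq_mul] at h3
  refine h3.congr_deriv ?_
  rw [← fderiv_apply_one_eq_deriv, h2]
  refine integral_congr_ae (Filter.Eventually.of_forall fun z => ?_)
  by_cases hz : z ∈ shell d
  · have hp : (u, z) ∈ Om d := shell_subset hz
    simp only [Dt, dir_apply _ _ hp]
  · simp only [wt_eq_zero hz, zero_mul]

theorem contDiffOn_cutoff :
    ContDiffOn ℝ ∞ (fun p : ℝ × Space d => wt p.2) (Om d) := fun p hp =>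
  (radialBump.contDiff.contDiffAt.comp p
    ((contDiffAt_norm ℝ hp).comp p contDiffAt_snd)).contDiffWithinAt

/-- The weight as a smooth function. -/
def cutoff : Sm d := mk _ contDiffOn_cutoff

theorem cutoff_apply (p : ℝ × Space d) : (cutoff : Sm d) p = wt p.2 := by
  by_cases hp : p ∈ Om d
  · exact mk_apply _ _ hp
  · rw [eval_of_notMem _ hp, wt_eq_zero fun h => hp (shell_subset h)]

theorem cutoff_mul_eventuallyEq_zero (F : Sm d) (u : ℝ) :
    (fun z => (cutoff * F : Sm d) (u, z)) =ᶠ[nhds 0] fun _ => 0 := by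
  filter_upwards [Metric.ball_mem_nhds (0 : Space d) one_pos] with z hz
  rw [mul_apply, cutoff_apply, wt_eq_zero, zero_mul]
  rintro ⟨h, -⟩
  simp only [Metric.mem_ball, dist_zero_right] at hz
  simp only at h
  linarith

theorem contDiff_cutoff_mul (F : Sm d) (u : ℝ) :
    ContDiff ℝ 1 fun z => (cutoff * F : Sm d) (u, z) := by
  refine contDiff_iff_contDiffAt.2 fun z => ?_
  by_cases hz : z = 0
  · rw [hz]
    exact contDiffAt_const.congr_of_eventuallyEq (cutoff_mul_eventuallyEq_zero F u)
  · have hp : (u, z) ∈ Om d := hz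
    exact (((cutoff * F : Sm d).contDiffAt hp).comp z
      (contDiffAt_const.prodMk contDiffAt_id)).of_le (by simp)

theorem integrable_and_integral_Dx_cutoff_mul (F : Sm d) (u : ℝ) (i : Fin (d - 1)) :
    Integrable (fun z => Dx i (cutoff * F) (u, z)) ∧ ∫ z, Dx i (cutoff * F) (u, z) = 0 := by
  set f : Space d → ℝ := fun z => (cutoff * F : Sm d) (u, z) with hf
  have hc : ContDiff ℝ 1 f := contDiff_cutoff_mul F u
  have hs : HasCompactSupport f :=
    HasCompactSupport.of_support_subset_isCompact isCompact_shell fun z hz => by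
      by_contra h
      exact hz (by simp only [hf, mul_apply, cutoff_apply, wt_eq_zero h, zero_mul])
  set v : Space d := EuclideanSpace.single i 1
  have hs' : HasCompactSupport fun z => fderiv ℝ f z v := hs.fderiv_apply (𝕜 := ℝ) v
  have hc' : Continuous fun z => fderiv ℝ f z v :=
    (hc.continuous_fderiv one_ne_zero).clm_apply continuous_const
  have h1 := integral_mul_fderiv_eq_neg_fderiv_mul_of_integrable (μ := volume)
    (f := fun _ : Space d => (1 : ℝ)) (g := f) (v := v) (by simp)
    (by simpa using hc'.integrable_of_hasCompactSupport hs')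
    (by simpa using hc.continuous.integrable_of_hasCompactSupport hs)
    (fun _ _ => differentiableAt_const 1) (fun z _ => (hc.differentiable one_ne_zero) z)
  simp only [one_mul, fderiv_fun_const, Pi.zero_apply, _root_.zero_apply, zero_mul,
    integral_zero, neg_zero] at h1
  have h0 : (fun z => Dx i (cutoff * F) (u, z)) = fun z => fderiv ℝ f z v := by
    funext z
    by_cases hz : z = 0
    · rw [hz, eval_of_notMem _ (by simp [Om]), (cutoff_mul_eventuallyEq_zero F u).fderiv_eq]
      simp
    · have hp : (u, z) ∈ Om d := hz
      rw [Dx, dir_apply _ _ hp]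
      have h2 : HasFDerivAt f ((fderiv ℝ (cutoff * F : Sm d) (u, z)).comp
          (ContinuousLinearMap.inr ℝ ℝ (Space d))) z :=
        (((cutoff * F : Sm d).differentiableAt hp).hasFDerivAt).comp z
          (hasFDerivAt_prodMk_right u z)
      rw [h2.fderiv]
      simp [v]
  rw [h0]
  exact ⟨hc'.integrable_of_hasCompactSupport hs', h1⟩

theorem Dx_cutoff : ∃ S : Sm d, ∀ i, Dx i (cutoff : Sm d) = Y i * S := by
  have hS : ContDiffOn ℝ ∞ (fun p : ℝ × Space d => deriv radialBump ‖p.2‖ * ‖p.2‖⁻¹) (Om d) :=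
    fun p hp => by
      have h1 : ContDiffAt ℝ ∞ (fun p : ℝ × Space d => ‖p.2‖) p :=
        (contDiffAt_norm ℝ hp).comp p contDiffAt_snd
      have h2 : ContDiff ℝ ∞ (deriv radialBump) :=
        (contDiff_infty_iff_deriv.1 radialBump.contDiff).2
      exact ((h2.contDiffAt.comp p h1).mul (h1.inv (norm_ne_zero_iff.2 hp))).contDiffWithinAt
  refine ⟨mk _ hS, fun i => Sm.ext fun p hp => ?_⟩
  rw [Dx, dir_apply_of_eventuallyEq _ cutoff hp (eventuallyEq_mk _ _ hp), mul_apply,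
    mk_apply _ _ hp, Y_apply _ hp]
  have h1 : HasFDerivAt (fun p : ℝ × Space d => ‖p.2‖)
      (fderiv ℝ (fun p : ℝ × Space d => ‖p.2‖) p) p :=
    (((contDiffAt_norm ℝ hp).comp p contDiffAt_snd).differentiableAt
      (n := 1) one_ne_zero).hasFDerivAt
  have h2 : HasDerivAt radialBump (deriv radialBump ‖p.2‖) ‖p.2‖ :=
    (radialBump.contDiff (n := 1)).differentiable one_ne_zero _ |>.hasDerivAt
  have h3 : HasFDerivAt (fun p : ℝ × Space d => wt p.2) _ p := h2.comp_hasFDerivAt p h1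
  have h4 := fderiv_norm_rpow_snd (1 : ℝ) hp ((0 : ℝ), (EuclideanSpace.single i 1 : Space d))
  simp only [Real.rpow_one, one_mul] at h4
  rw [h3.fderiv, _root_.smul_apply, h4]
  rw [show (1 : ℝ) - 2 = -1 by norm_num, Real.rpow_neg_one]
  simp [EuclideanSpace.inner_single_right]
  ring

theorem shellInt_div {V : Fin (d - 1) → Sm d} (hV : ∑ i, Y i * V i = 0) (u : ℝ) :
    shellInt (∑ i, Dx i (V i)) u = 0 := by
  obtain ⟨S, hS⟩ := Dx_cutoff (d := d)
  have h1 : cutoff * ∑ i, Dx i (V i) = ∑ i, Dx i (cutoff * V i) := by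
    simp only [Dx_mul, hS, Finset.sum_add_distrib, Finset.mul_sum]
    have : ∑ i, V i * (Y i * S) = (∑ i, Y i * V i) * S := by
      rw [Finset.sum_mul]
      exact Finset.sum_congr rfl fun i _ => by ring
    rw [this, hV, zero_mul, add_zero]
  have h2 : shellInt (∑ i, Dx i (V i)) u = ∫ z, (∑ i, Dx i (cutoff * V i)) (u, z) := by
    rw [← h1, shellInt]
    simp only [mul_apply, cutoff_apply]
  rw [h2]
  simp only [sum_apply]
  rw [integral_finsetSum _ fun i _ => (integrable_and_integral_Dx_cutoff_mul (V i) u i).1]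
  exact Finset.sum_eq_zero fun i _ => (integrable_and_integral_Dx_cutoff_mul (V i) u i).2

theorem shellInt_lap {F : Sm d} (hF : Hom 0 F) (u : ℝ) : shellInt (rp 2 * lap F) u = 0 := by
  have he : ∑ i, Y i * Dx i F = 0 := by
    have := hF.euler_eq
    rwa [zero_smul] at this
  have h1 : rp 2 * lap F = ∑ i, Dx i (rp 2 * Dx i F) := by
    have : ∀ i, Dx i F * (Y i * (1 : Sm d)) = Y i * Dx i F := fun i => by ring
    simp only [Dx_mul, Dx_rp, sub_self, rp_zero, mul_smul_comm, Finset.sum_add_distrib, this]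
    rw [← Finset.smul_sum, he, smul_zero, add_zero, lap_apply, Finset.mul_sum]
  rw [h1]
  refine shellInt_div ?_ u
  have : ∀ i, Y i * (rp 2 * Dx i F) = rp 2 * (Y i * Dx i F) := fun i => by ring
  simp only [this]
  rw [← Finset.mul_sum, he, mul_zero]

theorem continuous_wt_mul (F : Sm d) (u : ℝ) : Continuous fun z => wt z * F (u, z) := by
  simpa only [mul_apply, cutoff_apply] using (contDiff_cutoff_mul F u).continuous

theorem wt_pos {z : Space d} (hz : ‖z‖ = 3 / 2) : 0 < wt z := by
  refine radialBump.pos_of_mem_ball ?_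
  rw [hz]
  exact Metric.mem_ball_self radialBump.rOut_pos

theorem eq_zero_of_shellInt_eq_zero {σ : ℝ} {F : Sm d} (hF : Hom σ F) (h0 : ∀ p, 0 ≤ F p)
    (hI : ∀ u, shellInt F u = 0) : F = 0 := by
  refine Sm.ext fun p hp => ?_
  rw [zero_apply]
  have hpos : 0 < ‖p.2‖ := norm_pos_iff.2 hp
  have hn : 0 ≤ fun z => wt z * F (p.1, z) := fun z => mul_nonneg (wt_nonneg z) (h0 _)
  have hz := (integral_eq_zero_iff_of_nonneg hn (integrable_wt_mul F p.1)).1 (hI p.1)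
  have hz' := (continuous_wt_mul F p.1).ae_eq_iff_eq volume continuous_zero |>.1 hz
  have h1 := congrFun hz' ((3 / 2 * ‖p.2‖⁻¹) • p.2)
  have ht : 0 < 3 / 2 * ‖p.2‖⁻¹ := by positivity
  have h2 : wt ((3 / 2 * ‖p.2‖⁻¹) • p.2) ≠ 0 := by
    refine (wt_pos ?_).ne'
    rw [norm_smul, Real.norm_of_nonneg ht.le, mul_assoc, inv_mul_cancel₀ hpos.ne', mul_one]
  have h3 := (mul_eq_zero.1 h1).resolve_left h2
  rw [hF p hp _ ht] at h3
  exact (mul_eq_zero.1 h3).resolve_left (Real.rpow_pos_of_pos ht σ).ne'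

theorem sum_sq_Dx_eq_zero {F : Sm d} (hF : Hom 0 F) {κ : ℝ} (hκ : 0 ≤ κ)
    (h : lap F = κ • (rp (-2) * F)) :
    κ • (F * F) + rp 2 * ∑ i, Dx i F * Dx i F = 0 := by
  have hr : rp 2 * (rp (-2) * F) = F := rp_mul_cancel 2 F
  have h1 : rp 2 * lap (F * F) = (2 : ℝ) • (κ • (F * F) + rp 2 * ∑ i, Dx i F * Dx i F) := by
    rw [lap_mul, h]
    refine Sm.ext fun p _ => ?_
    have hr' := congrArg (fun G : Sm d => G p) hr
    simp only [add_apply, mul_apply, smul_apply] at hr' ⊢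
    linear_combination (2 * κ * F p) * hr'
  refine eq_zero_of_shellInt_eq_zero (σ := 0) ?_ (fun p => ?_) fun u => ?_
  · exact (Hom.smul _ ((hF.mul hF).congr (add_zero 0))).add
      (((hom_rp 2).mul (Hom.sum fun i _ => ((hF.Dx i).mul (hF.Dx i)))).congr (by ring))
  · simp only [add_apply, mul_apply, smul_apply, sum_apply]
    have : 0 ≤ rp 2 p := by
      by_cases hp : p ∈ Om d
      · rw [rp_apply _ hp]; positivity
      · rw [eval_of_notMem _ hp]
    have h2 : 0 ≤ ∑ i, Dx i F p * Dx i F p := Finset.sum_nonneg fun i _ => mul_self_nonneg _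
    have := mul_self_nonneg (F p)
    positivity
  · have h2 := shellInt_lap ((hF.mul hF).congr (add_zero 0)) u
    rw [h1, shellInt_smul] at h2
    linarith

theorem Dx_eq_zero_of_lap {F : Sm d} (hF : Hom 0 F) {κ : ℝ} (hκ : 0 ≤ κ)
    (h : lap F = κ • (rp (-2) * F)) (i : Fin (d - 1)) : Dx i F = 0 := by
  refine Sm.ext fun p hp => ?_
  have h1 := congrArg (fun G : Sm d => G p) (sum_sq_Dx_eq_zero hF hκ h)
  simp only [add_apply, mul_apply, smul_apply, sum_apply, zero_apply, rp_apply _ hp] at h1 ⊢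
  have h2 : 0 < ‖p.2‖ ^ (2 : ℝ) := Real.rpow_pos_of_pos (norm_pos_iff.2 hp) _
  have h3 : 0 ≤ ∑ i, Dx i F p * Dx i F p := Finset.sum_nonneg fun i _ => mul_self_nonneg _
  have h4 : ∑ i, Dx i F p * Dx i F p = 0 := by
    have := mul_nonneg hκ (mul_self_nonneg (F p))
    have := mul_nonneg h2.le h3
    exact (mul_eq_zero.1 (by linarith : ‖p.2‖ ^ (2 : ℝ) * _ = 0)).resolve_left h2.ne'
  have h5 := (Finset.sum_eq_zero_iff_of_nonneg fun i _ => mul_self_nonneg (Dx i F p)).1 h4 i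
    (Finset.mem_univ i)
  exact mul_self_eq_zero.1 h5

/-- Away from the spectrum of the sphere Laplacian: negative constants. -/
theorem eq_zero_of_lap_eq {F : Sm d} (hF : Hom 0 F) {κ : ℝ} (hκ : 0 < κ)
    (h : lap F = κ • (rp (-2) * F)) : F = 0 := by
  have h1 := sum_sq_Dx_eq_zero hF hκ.le h
  simp only [Dx_eq_zero_of_lap hF hκ.le h, mul_zero, Finset.sum_const_zero, add_zero] at h1
  have h2 := (smul_eq_zero.1 h1).resolve_left hκ.ne'
  refine Sm.ext fun p _ => ?_
  have h3 := congrArg (fun G : Sm d => G p) h2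
  simp only [mul_apply, zero_apply] at h3 ⊢
  exact mul_self_eq_zero.1 h3

theorem lapInj_of_neg {σ : ℝ} (h : σ * (σ + ((d - 1 : ℕ) : ℝ) - 2) < 0) : LapInj d σ := by
  intro F hF hl
  have h1 := lap_rp_mul hF (-σ)
  rw [hl, mul_zero, zero_add] at h1
  have h2 : rp (-σ) * F = 0 := by
    refine eq_zero_of_lap_eq (((hom_rp (-σ)).mul hF).congr (by ring)) (neg_pos.2 h) ?_
    rw [h1, ← mul_assoc, rp_mul, show -2 + -σ = -σ - 2 by ring]
    congr 1
    ring
  have h3 := rp_mul_cancel σ F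
  rw [h2, mul_zero] at h3
  exact h3.symm

theorem eq_zero_of_lap_eq_zero (hd : 3 ≤ d) {F : Sm d} (hF : Hom 0 F) (h : lap F = 0)
    (hI : ∀ u, shellInt F u = 0) : F = 0 := by
  have hD := Dx_eq_zero_of_lap hF le_rfl (by rw [h, zero_smul])
  refine Sm.ext fun p hp => ?_
  rw [zero_apply]
  have hpre : IsPreconnected {z : Space d | z ≠ 0} := by
    refine (isConnected_compl_singleton_of_one_lt_rank ?_ (0 : Space d)).isPreconnected
    rw [← Module.finrank_eq_rank, finrank_euclideanSpace_fin]
    exact_mod_cast (by omega : 1 < d - 1)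
  have hfd : ∀ z : Space d, z ≠ 0 → HasFDerivAt (fun z => F (p.1, z)) (0 : Space d →L[ℝ] ℝ) z := by
    intro z hz
    have hq : (p.1, z) ∈ Om d := hz
    have h2 := ((F.differentiableAt hq).hasFDerivAt).comp z (hasFDerivAt_prodMk_right p.1 z)
    refine h2.congr_fderiv ?_
    refine ContinuousLinearMap.coe_injective
      ((EuclideanSpace.basisFun (Fin (d - 1)) ℝ).toBasis.ext fun i => ?_)
    have h3 := congrArg (fun G : Sm d => G (p.1, z)) (hD i)
    simp only [Dx, dir_apply _ _ hq, zero_apply] at h3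
    simpa using h3
  have hconst : ∀ z : Space d, z ≠ 0 → F (p.1, z) = F p := fun z hz =>
    isOpen_ne_zero.is_const_of_fderiv_eq_zero (𝕜 := ℝ) (f := fun z => F (p.1, z)) hpre
      (fun z hz => (hfd z hz).differentiableAt.differentiableWithinAt)
      (fun z hz => (hfd z hz).fderiv) hz hp
  have h1 : shellInt F p.1 = F p * ∫ z : Space d, wt z := by
    rw [shellInt, ← integral_const_mul]
    refine integral_congr_ae (Filter.Eventually.of_forall fun z => ?_)
    by_cases hz : z = 0
    · simp only [hz, wt_eq_zero fun h => shell_subset h rfl, zero_mul, mul_zero]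
    · simp only [hconst z hz, mul_comm]
  rw [hI] at h1
  refine (mul_eq_zero.1 h1.symm).resolve_right fun h2 => ?_
  have hz := (integral_eq_zero_iff_of_nonneg (fun z => wt_nonneg z) integrable_wt).1 h2
  have hz' := continuous_wt.ae_eq_iff_eq volume continuous_zero |>.1 hz
  have h1 := congrFun hz' ((3 / 2 * ‖p.2‖⁻¹) • p.2)
  have hpos : 0 < ‖p.2‖ := norm_pos_iff.2 hp
  have ht : 0 < 3 / 2 * ‖p.2‖⁻¹ := by positivity
  refine (wt_pos ?_).ne' h1
  rw [norm_smul, Real.norm_of_nonneg ht.le, mul_assoc, inv_mul_cancel₀ hpos.ne', mul_one]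

end Sm

end

section

open MeasureTheory

namespace Sm

variable {d : ℕ}

/-! ### The Green kernel of the conformal Laplacian on the sphere -/

/-- The squared chordal distance kernel `A |x| - 2 ⟪x, z / |z|⟫`. -/
def kq (A : ℝ) (x z : Space d) : ℝ := A * ‖x‖ - 2 * inner ℝ x (‖z‖⁻¹ • z)

theorem norm_inv_smul_le (z : Space d) : ‖‖z‖⁻¹ • z‖ ≤ 1 := by
  rw [norm_smul, norm_inv, norm_norm]
  exact inv_mul_le_one

theorem norm_inv_smul_eq {z : Space d} (hz : z ≠ 0) : ‖‖z‖⁻¹ • z‖ = 1 := by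
  rw [norm_smul, norm_inv, norm_norm, inv_mul_cancel₀ (norm_ne_zero_iff.2 hz)]

theorem le_kq (A : ℝ) (x z : Space d) : (A - 2) * ‖x‖ ≤ kq A x z := by
  have h1 := real_inner_le_norm x (‖z‖⁻¹ • z)
  have h2 := mul_le_mul_of_nonneg_left (norm_inv_smul_le z) (norm_nonneg x)
  rw [kq]
  linarith

theorem kq_nonneg {A : ℝ} (hA : 2 ≤ A) (x z : Space d) : 0 ≤ kq A x z :=
  (mul_nonneg (by linarith) (norm_nonneg _)).trans (le_kq A x z)

theorem kq_pos {A : ℝ} (hA : 2 < A) {x : Space d} (hx : x ≠ 0) (z : Space d) : 0 < kq A x z :=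
  (mul_pos (by linarith) (norm_pos_iff.2 hx)).trans_le (le_kq A x z)

theorem kq_isometry (A : ℝ) (R : Space d ≃ₗᵢ[ℝ] Space d) (x z : Space d) :
    kq A (R x) (R z) = kq A x z := by
  rw [kq, kq, R.norm_map, R.norm_map, ← map_smul R, R.inner_map_map]

theorem kq_smul {t : ℝ} (ht : 0 ≤ t) (A : ℝ) (x z : Space d) : kq A (t • x) z = t * kq A x z := by
  rw [kq, kq, norm_smul, Real.norm_of_nonneg ht, real_inner_smul_left]
  ring

theorem kq_two {x z : Space d} (hx : ‖x‖ = 1) (hz : z ≠ 0) :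
    kq 2 x z = ‖x - ‖z‖⁻¹ • z‖ ^ 2 := by
  rw [norm_sub_sq_real, kq, hx, norm_inv_smul_eq hz]
  ring

theorem measurable_kq (A : ℝ) (x : Space d) : Measurable (kq A x) := by
  unfold kq
  fun_prop

/-- The weight `χ(|z|) (A |x| - 2 ⟪x, z / |z|⟫)^(-a)`. -/
def kw (a A : ℝ) (x z : Space d) : ℝ := wt z * kq A x z ^ (-a)

theorem kw_eq_zero (a A : ℝ) (x : Space d) {z : Space d} (hz : z ∉ shell d) : kw a A x z = 0 := by
  rw [kw, wt_eq_zero hz, zero_mul]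

theorem kw_nonneg (a : ℝ) {A : ℝ} (hA : 2 ≤ A) (x z : Space d) : 0 ≤ kw a A x z :=
  mul_nonneg (wt_nonneg z) (Real.rpow_nonneg (kq_nonneg hA x z) _)

theorem wt_isometry (R : Space d ≃ₗᵢ[ℝ] Space d) (z : Space d) : wt (R z) = wt z := by
  rw [wt, wt, R.norm_map]

theorem kw_isometry (a A : ℝ) (R : Space d ≃ₗᵢ[ℝ] Space d) (x z : Space d) :
    kw a A (R x) (R z) = kw a A x z := by
  rw [kw, kw, kq_isometry, wt_isometry]

theorem measurable_kw (a A : ℝ) (x : Space d) : Measurable (kw a A x) :=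
  continuous_wt.measurable.mul ((measurable_kq A x).pow_const _)

theorem integrable_abs_rpow {s : ℝ} (hs : s < 1) (r : ℝ) :
    IntegrableOn (fun x : ℝ => ‖x‖ ^ (-s)) (Metric.ball 0 r) := by
  rw [integrableOn_fun_norm_addHaar volume (f := fun y => y ^ (-s))]
  simp only [Module.finrank_self, tsub_self, pow_zero, one_smul]
  by_cases hr : 0 ≤ r
  · rw [← intervalIntegrable_iff_integrableOn_Ioo_of_le hr]
    exact intervalIntegral.intervalIntegrable_rpow' (by linarith)
  · rw [Set.Ioo_eq_empty (by linarith)]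
    exact integrableOn_empty

theorem integrable_kw_single {a : ℝ} (ha : 0 ≤ a) (i₀ : Fin (d - 1))
    (had : 2 * a < ((d - 1 : ℕ) : ℝ) - 1) :
    Integrable (kw a 2 (EuclideanSpace.single i₀ (1 : ℝ))) := by
  set N : ℝ := ((d - 1 : ℕ) : ℝ) - 1 with hN
  have hN0 : 0 < N := by linarith
  set b : ℝ := a / N with hb
  have hb0 : 0 ≤ b := by positivity
  have hb1 : 2 * b < 1 := by rw [hb, ← mul_div_assoc, div_lt_one hN0]; exact had
  set e : Space d := EuclideanSpace.single i₀ (1 : ℝ) with he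
  have hen : ‖e‖ = 1 := by simp [he]
  set f : Fin (d - 1) → ℝ → ℝ := fun i => (Metric.ball (0 : ℝ) 3).indicator
    fun s => if i = i₀ then 1 else 4 ^ b * ‖s‖ ^ (-(2 * b)) with hf
  have hfi : ∀ i, Integrable (f i) := fun i => by
    rw [hf]
    simp only
    rw [integrable_indicator_iff Metric.isOpen_ball.measurableSet]
    split_ifs
    · exact integrableOn_const measure_ball_lt_top.ne
    · exact (integrable_abs_rpow hb1 3).const_mul _
  have hprod : Integrable fun z : Space d => ∏ i, f i (z i) := by
    have h1 : Integrable fun y : Fin (d - 1) → ℝ => ∏ i, f i (y i) := Integrable.fintype_prod hfi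
    exact (PiLp.volume_preserving_ofLp (Fin (d - 1))).integrable_comp_of_integrable h1
  have hae : ∀ᵐ z : Space d, ∀ i, z i ≠ 0 := by
    refine (PiLp.volume_preserving_ofLp (Fin (d - 1))).quasiMeasurePreserving.ae
      (p := fun y : Fin (d - 1) → ℝ => ∀ i, y i ≠ 0) ?_
    exact ae_all_iff.2 fun i => Measure.ae_eval_ne _ i 0
  refine hprod.mono' (measurable_kw a 2 e).aestronglyMeasurable ?_
  filter_upwards [hae] with z hz
  rw [Real.norm_of_nonneg (kw_nonneg a le_rfl e z)]
  have hf0 : ∀ i, 0 ≤ f i (z i) := fun i => by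
    refine Set.indicator_nonneg (fun s _ => ?_) _
    split_ifs
    · exact zero_le_one
    · positivity
  by_cases hzs : z ∈ shell d
  swap
  · rw [kw_eq_zero _ _ _ hzs]
    exact Finset.prod_nonneg fun i _ => hf0 i
  have hz0 : z ≠ 0 := shell_subset hzs
  have hzn : 0 < ‖z‖ := norm_pos_iff.2 hz0
  set q := kq 2 e z with hq
  have hqi : ∀ i, i ≠ i₀ → z i ^ 2 / 4 ≤ q := fun i hi => by
    rw [hq, kq_two hen hz0]
    have h1 : ‖(e - ‖z‖⁻¹ • z) i‖ ≤ ‖e - ‖z‖⁻¹ • z‖ := PiLp.norm_apply_le _ i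
    have h2 : (e - ‖z‖⁻¹ • z) i = -(‖z‖⁻¹ * z i) := by
      simp [he, hi]
    have h3 : ‖(e - ‖z‖⁻¹ • z) i‖ ^ 2 ≤ ‖e - ‖z‖⁻¹ • z‖ ^ 2 := by gcongr
    refine le_trans ?_ h3
    rw [h2, norm_neg, Real.norm_eq_abs, sq_abs, mul_pow, inv_pow, div_eq_inv_mul]
    have h4 : ‖z‖ ^ 2 ≤ 4 := by nlinarith [hzs.2]
    gcongr
  have hfi' : ∀ i, i ≠ i₀ → q ^ (-b) ≤ f i (z i) := fun i hi => by
    have hzi : |z i| < 3 := lt_of_le_of_lt ((PiLp.norm_apply_le z i).trans hzs.2) (by norm_num)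
    have h1 : f i (z i) = (z i ^ 2 / 4) ^ (-b) := by
      rw [hf]
      simp only
      rw [Set.indicator_of_mem (by simpa using hzi), if_neg hi, Real.div_rpow (by positivity)
        (by positivity), ← sq_abs, ← Real.rpow_natCast, ← Real.rpow_mul (abs_nonneg _),
        Real.rpow_neg (by positivity : (0 : ℝ) ≤ 4), div_inv_eq_mul, mul_comm, Real.norm_eq_abs]
      congr 2
      push_cast
      ring
    rw [h1]
    have h2 : 0 < z i ^ 2 / 4 := by have := hz i; positivity
    exact Real.rpow_le_rpow_of_nonpos h2 (hqi i hi) (by linarith)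
  have hfi0 : f i₀ (z i₀) = 1 := by
    have hzi : |z i₀| < 3 := lt_of_le_of_lt ((PiLp.norm_apply_le z i₀).trans hzs.2) (by norm_num)
    rw [hf]
    simp only
    rw [Set.indicator_of_mem (by simpa using hzi), if_pos trivial]
  have hq0 : 0 ≤ q := kq_nonneg le_rfl e z
  have hqa : q ^ (-a) = ∏ i ∈ Finset.univ.erase i₀, q ^ (-b) := by
    rw [Finset.prod_const, Finset.card_erase_of_mem (Finset.mem_univ _), Finset.card_univ,
      Fintype.card_fin, ← Real.rpow_natCast, ← Real.rpow_mul hq0]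
    congr 1
    have hpos : 1 ≤ d - 1 := by have := i₀.2; omega
    rw [Nat.cast_sub hpos, Nat.cast_one, ← hN, hb]
    field_simp
  calc kw a 2 e z ≤ 1 * q ^ (-a) :=
        mul_le_mul_of_nonneg_right radialBump.le_one (Real.rpow_nonneg hq0 _)
    _ = ∏ i ∈ Finset.univ.erase i₀, q ^ (-b) := by rw [one_mul, hqa]
    _ ≤ ∏ i ∈ Finset.univ.erase i₀, f i (z i) :=
        Finset.prod_le_prod (fun i _ => Real.rpow_nonneg hq0 _)
          fun i hi => hfi' i (Finset.ne_of_mem_erase hi)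
    _ = ∏ i, f i (z i) := by
        rw [← Finset.mul_prod_erase _ _ (Finset.mem_univ i₀), hfi0, one_mul]

theorem exists_isometry {x y : Space d} (h : ‖x‖ = ‖y‖) :
    ∃ R : Space d ≃ₗᵢ[ℝ] Space d, R x = y := ⟨_, Submodule.reflection_sub h⟩

theorem integral_isometry (R : Space d ≃ₗᵢ[ℝ] Space d) (f : Space d → ℝ) :
    ∫ z, f (R z) = ∫ z, f z :=
  R.measurePreserving.integral_comp R.toHomeomorph.measurableEmbedding f

theorem integrable_kw_two (hd : 2 ≤ d) {a : ℝ} (ha : 0 ≤ a)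
    (had : 2 * a < ((d - 1 : ℕ) : ℝ) - 1) {x : Space d} (hx : ‖x‖ = 1) :
    Integrable (kw a 2 x) := by
  have i₀ : Fin (d - 1) := ⟨0, by omega⟩
  obtain ⟨R, hR⟩ := exists_isometry (x := x) (y := EuclideanSpace.single i₀ (1 : ℝ)) (by simp [hx])
  have h := R.measurePreserving.integrable_comp_of_integrable (integrable_kw_single ha i₀ had)
  rw [← hR] at h
  exact h.congr (Filter.Eventually.of_forall fun z => kw_isometry a 2 R x z)

theorem ae_kq_two_pos (hd : 3 ≤ d) {x : Space d} (hx : ‖x‖ = 1) :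
    ∀ᵐ z : Space d, 0 < kq 2 x z := by
  have hspan : (Submodule.span ℝ {x} : Submodule ℝ (Space d)) ≠ ⊤ := fun h => by
    have h1 := finrank_span_le_card (R := ℝ) ({x} : Set (Space d))
    rw [h, finrank_top, finrank_euclideanSpace_fin] at h1
    simp at h1
    omega
  have h0 := Measure.addHaar_submodule volume _ hspan
  filter_upwards [compl_mem_ae_iff.2 h0] with z hz
  refine (kq_nonneg le_rfl x z).lt_of_ne fun h => hz ?_
  by_cases hz0 : z = 0
  · rw [hz0]; exact Submodule.zero_mem _
  rw [kq_two hx hz0, eq_comm, sq_eq_zero_iff, norm_eq_zero, sub_eq_zero] at h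
  rw [SetLike.mem_coe, Submodule.mem_span_singleton]
  exact ⟨‖z‖, by rw [h, smul_smul, mul_inv_cancel₀ (norm_ne_zero_iff.2 hz0), one_smul]⟩

theorem kw_le_kw_two {a A : ℝ} (ha : 0 ≤ a) (hA : 2 ≤ A) {x z : Space d} (h : 0 < kq 2 x z) :
    kw a A x z ≤ kw a 2 x z := by
  refine mul_le_mul_of_nonneg_left (Real.rpow_le_rpow_of_nonpos h ?_ (by linarith)) (wt_nonneg z)
  rw [kq, kq]
  have := mul_le_mul_of_nonneg_right hA (norm_nonneg x)
  linarith

theorem integrable_kw (hd : 3 ≤ d) {a A : ℝ} (ha : 0 ≤ a)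
    (had : 2 * a < ((d - 1 : ℕ) : ℝ) - 1) (hA : 2 ≤ A) {x : Space d} (hx : ‖x‖ = 1) :
    Integrable (kw a A x) := by
  refine (integrable_kw_two (by omega) ha had hx).mono'
    (measurable_kw a A x).aestronglyMeasurable ?_
  filter_upwards [ae_kq_two_pos hd hx] with z hz
  rw [Real.norm_of_nonneg (kw_nonneg a hA x z)]
  exact kw_le_kw_two ha hA hz

theorem tendsto_integral_kw (hd : 3 ≤ d) {a : ℝ} (ha : 0 ≤ a)
    (had : 2 * a < ((d - 1 : ℕ) : ℝ) - 1) {x : Space d} (hx : ‖x‖ = 1) {h : Space d → ℝ}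
    (hh : ContinuousOn h (shell d)) :
    Filter.Tendsto (fun A => ∫ z, kw a A x z * h z) (nhdsWithin 2 (Set.Ioi 2))
      (nhds (∫ z, kw a 2 x z * h z)) := by
  have hi := integrable_weight_smul isCompact_shell (integrable_kw_two (by omega) ha had hx)
    (fun z hz => kw_eq_zero a 2 x hz) hh
  simp only [smul_eq_mul] at hi
  refine tendsto_integral_filter_of_dominated_convergence (fun z => ‖kw a 2 x z * h z‖) ?_ ?_
    hi.norm ?_
  · filter_upwards [self_mem_nhdsWithin] with A hA
    exact aestronglyMeasurable_weight_smul isCompact_shell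
      (measurable_kw a A x).aestronglyMeasurable (fun z hz => kw_eq_zero a A x hz) hh
  · filter_upwards [self_mem_nhdsWithin] with A hA
    filter_upwards [ae_kq_two_pos hd hx] with z hz
    rw [norm_mul, norm_mul]
    refine mul_le_mul_of_nonneg_right ?_ (norm_nonneg _)
    rw [Real.norm_of_nonneg (kw_nonneg a (le_of_lt hA) x z),
      Real.norm_of_nonneg (kw_nonneg a le_rfl x z)]
    exact kw_le_kw_two ha (le_of_lt hA) hz
  · filter_upwards [ae_kq_two_pos hd hx] with z hz
    have hc : ContinuousAt (fun A : ℝ => kw a A x z * h z) 2 := by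
      have h1 : ContinuousAt (fun A : ℝ => kq A x z) 2 := by unfold kq; fun_prop
      exact (continuousAt_const.mul (h1.rpow_const (Or.inl hz.ne'))).mul continuousAt_const
    exact hc.tendsto.mono_left nhdsWithin_le_nhds

end Sm

end

section

open MeasureTheory

namespace Sm

variable {d : ℕ}

/-- The potential of `g` with kernel `(A |y| - 2 ⟪y, z / |z|⟫)^(-a)`. -/
def pot (a A : ℝ) (g : Sm d) (p : ℝ × Space d) : ℝ := ∫ z, kw a A p.2 z * g (p.1, z)

/-- Reflection of `z` in the line spanned by `v`. -/
def lineRefl (v z : Space d) : Space d := (2 * (inner ℝ v z / ‖v‖ ^ 2)) • v - z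

theorem lineRefl_eq (v z : Space d) :
    lineRefl v z = Submodule.reflection (Submodule.span ℝ {v}) z := by
  have h := Submodule.reflection_singleton_apply (𝕜 := ℝ) v z
  rw [lineRefl, h, two_smul, two_mul, add_smul]
  rfl

theorem lineRefl_ne_zero (v : Space d) {z : Space d} (hz : z ≠ 0) : lineRefl v z ≠ 0 := by
  rw [lineRefl_eq]
  exact (map_ne_zero_iff _ (LinearIsometryEquiv.injective _)).2 hz

theorem lineRefl_bisector {x y : Space d} (hx : ‖x‖ = 1) (hy : y ≠ 0) (hv : ‖y‖ • x + y ≠ 0) :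
    ‖y‖ • lineRefl (‖y‖ • x + y) x = y := by
  have hyn : ‖y‖ ≠ 0 := norm_ne_zero_iff.2 hy
  have h1 : ‖‖y‖ • x + y‖ ^ 2 = 2 * ‖y‖ * inner ℝ (‖y‖ • x + y) x := by
    rw [norm_add_sq_real, norm_smul, norm_norm, hx, inner_add_left, real_inner_smul_left,
      real_inner_smul_left, real_inner_self_eq_norm_sq, hx, real_inner_comm]
    ring
  have h2 : ‖‖y‖ • x + y‖ ^ 2 ≠ 0 := pow_ne_zero 2 (norm_ne_zero_iff.2 hv)
  have h3 : ‖y‖ * (2 * (inner ℝ (‖y‖ • x + y) x / ‖‖y‖ • x + y‖ ^ 2)) = 1 := by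
    rw [h1] at h2 ⊢
    have h4 : inner ℝ (‖y‖ • x + y) x ≠ 0 := fun h => h2 (by rw [h, mul_zero])
    field_simp
  rw [lineRefl, smul_sub, smul_smul, h3, one_smul, add_sub_cancel_left]

/-- The integrand of the potential after rotating the pole of the kernel to `x`. -/
def rotInt (a : ℝ) (x : Space d) (g : Sm d) (r : (ℝ × Space d) × Space d) : ℝ :=
  ‖r.1.2‖ ^ (-a) * g (r.1.1, lineRefl (‖r.1.2‖ • x + r.1.2) r.2)

/-- The domain on which the rotated integrand is smooth. -/
def rotDom (x : Space d) : Set (ℝ × Space d) := {p | p.2 ≠ 0 ∧ ‖p.2‖ • x + p.2 ≠ 0}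

theorem isOpen_rotDom (x : Space d) : IsOpen (rotDom x) :=
  (isOpen_ne_fun continuous_snd continuous_const).inter
    (isOpen_ne_fun (by fun_prop) continuous_const)

theorem rotDom_subset (x : Space d) : rotDom x ⊆ Om d := fun _ hp => hp.1

theorem mem_rotDom {p : ℝ × Space d} (hp : p ∈ Om d) : p ∈ rotDom (‖p.2‖⁻¹ • p.2) := by
  refine ⟨hp, ?_⟩
  rw [smul_smul, mul_inv_cancel₀ (norm_ne_zero_iff.2 hp), one_smul, ← two_smul ℝ]
  exact smul_ne_zero two_ne_zero hp

theorem contDiffOn_rotInt (a : ℝ) (x : Space d) (g : Sm d) :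
    ContDiffOn ℝ ∞ (rotInt a x g) (rotDom x ×ˢ {z | z ≠ 0}) := by
  have hn : ContDiffOn ℝ ∞ (fun r : (ℝ × Space d) × Space d => ‖r.1.2‖)
      (rotDom x ×ˢ {z | z ≠ 0}) := fun r hr =>
    ((contDiffAt_norm ℝ hr.1.1).comp r (contDiffAt_snd.comp r contDiffAt_fst)).contDiffWithinAt
  have h12 : ContDiffOn ℝ ∞ (fun r : (ℝ × Space d) × Space d => r.1.2)
      (rotDom x ×ˢ {z | z ≠ 0}) := by fun_prop
  have hv : ContDiffOn ℝ ∞ (fun r : (ℝ × Space d) × Space d => ‖r.1.2‖ • x + r.1.2)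
      (rotDom x ×ˢ {z | z ≠ 0}) := (hn.smul contDiffOn_const).add h12
  have hR : ContDiffOn ℝ ∞
      (fun r : (ℝ × Space d) × Space d => lineRefl (‖r.1.2‖ • x + r.1.2) r.2)
      (rotDom x ×ˢ {z | z ≠ 0}) := by
    have hc : ContDiffOn ℝ ∞ (fun r : (ℝ × Space d) × Space d =>
        2 * (inner ℝ (‖r.1.2‖ • x + r.1.2) r.2 / ‖‖r.1.2‖ • x + r.1.2‖ ^ 2))
        (rotDom x ×ˢ {z | z ≠ 0}) :=
      contDiffOn_const.mul ((hv.inner ℝ contDiffOn_snd).div (hv.norm_sq ℝ) fun r hr =>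
        pow_ne_zero 2 (norm_ne_zero_iff.2 hr.1.2))
    exact (hc.smul hv).sub contDiffOn_snd
  refine (hn.rpow_const_of_ne fun r hr => norm_ne_zero_iff.2 hr.1.1).mul
    (g.contDiffOn.comp (ContDiffOn.prodMk (by fun_prop) hR) fun r hr => ?_)
  exact lineRefl_ne_zero _ hr.2

theorem pot_eq (a : ℝ) {A : ℝ} (hA : 2 ≤ A) {x : Space d} (hx : ‖x‖ = 1) (g : Sm d)
    {p : ℝ × Space d} (hp : p ∈ rotDom x) :
    pot a A g p = ∫ z, kw a A x z * rotInt a x g (p, z) := by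
  set R := Submodule.reflection (Submodule.span ℝ {‖p.2‖ • x + p.2}) with hR
  have hRx : ‖p.2‖ • R x = p.2 := by
    rw [hR, ← lineRefl_eq, lineRefl_bisector hx hp.1 hp.2]
  rw [pot, ← integral_isometry R]
  refine integral_congr_ae (Filter.Eventually.of_forall fun z => ?_)
  have h1 : kw a A p.2 (R z) = ‖p.2‖ ^ (-a) * kw a A x z := by
    nth_rewrite 1 [← hRx]
    rw [kw, kw, kq_smul (norm_nonneg _), kq_isometry, wt_isometry,
      Real.mul_rpow (norm_nonneg _) (kq_nonneg hA x z)]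
    ring
  simp only [h1, rotInt]
  rw [lineRefl_eq]
  ring

/-- The range of parameters for which the kernel is integrable. -/
structure KernelRange (d : ℕ) (a A : ℝ) : Prop where
  dim : 3 ≤ d
  nonneg : 0 ≤ a
  lt : 2 * a < ((d - 1 : ℕ) : ℝ) - 1
  two_le : 2 ≤ A

theorem KernelRange.integrable {a A : ℝ} (h : KernelRange d a A) {x : Space d} (hx : ‖x‖ = 1) :
    Integrable (kw a A x) := integrable_kw h.dim h.nonneg h.lt h.two_le hx

theorem contDiffOn_pot {a A : ℝ} (h : KernelRange d a A) (g : Sm d) :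
    ContDiffOn ℝ ∞ (pot a A g) (Om d) := by
  intro p hp
  have hx : ‖‖p.2‖⁻¹ • p.2‖ = 1 := norm_inv_smul_eq hp
  have h1 := contDiffOn_weighted_integral (μ := volume) isCompact_shell (isOpen_rotDom _)
    isOpen_ne_zero shell_subset (h.integrable hx) (fun z hz => kw_eq_zero a A _ hz)
    (contDiffOn_rotInt a (‖p.2‖⁻¹ • p.2) g)
  have h2 : ContDiffOn ℝ ∞ (pot a A g) (rotDom (‖p.2‖⁻¹ • p.2)) :=
    h1.congr fun q hq => pot_eq a h.two_le hx g hq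
  exact (h2.contDiffAt ((isOpen_rotDom _).mem_nhds (mem_rotDom hp))).contDiffWithinAt

/-- The potential as a smooth function. -/
def potSm {a A : ℝ} (h : KernelRange d a A) (g : Sm d) : Sm d := mk (pot a A g) (contDiffOn_pot h g)

theorem hom_potSm {a A : ℝ} (h : KernelRange d a A) (g : Sm d) : Hom (-a) (potSm h g) := by
  intro p hp t ht
  rw [potSm, mk_apply _ _ hp, mk_apply _ _ (smul_mem_Om hp ht), pot, pot, ← integral_const_mul]
  refine integral_congr_ae (Filter.Eventually.of_forall fun z => ?_)
  simp only [kw, kq_smul ht.le, Real.mul_rpow ht.le (kq_nonneg h.two_le _ _)]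
  ring

/-- The second derivative in the `i`-th Cartesian direction of a function with parameter `z`. -/
def secondDeriv (i : Fin (d - 1)) (Φ : (ℝ × Space d) × Space d → ℝ)
    (r : (ℝ × Space d) × Space d) : ℝ :=
  fderiv ℝ (fun r => fderiv ℝ Φ r ((0, EuclideanSpace.single i 1), 0)) r
    ((0, EuclideanSpace.single i 1), 0)

theorem contDiffOn_secondDeriv (i : Fin (d - 1)) {Φ : (ℝ × Space d) × Space d → ℝ}
    {U : Set ((ℝ × Space d) × Space d)} (hU : IsOpen U) (hΦ : ContDiffOn ℝ ∞ Φ U) :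
    ContDiffOn ℝ ∞ (secondDeriv i Φ) U := contDiffOn_fderiv_fderiv hU hΦ _

theorem Dx_Dx_eq_fderiv (i : Fin (d - 1)) (F : Sm d) {U : Set (ℝ × Space d)} (hU : IsOpen U)
    (hUO : U ⊆ Om d) {f : ℝ × Space d → ℝ} (hf : ∀ q ∈ U, F q = f q) {p : ℝ × Space d}
    (hp : p ∈ U) : Dx i (Dx i F) p = fderiv ℝ (fun q => fderiv ℝ f q (0, EuclideanSpace.single i 1))
      p (0, EuclideanSpace.single i 1) := by
  refine dir_apply_of_eventuallyEq _ _ (hUO hp) ?_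
  filter_upwards [hU.mem_nhds hp] with q hq
  refine dir_apply_of_eventuallyEq _ _ (hUO hq) ?_
  filter_upwards [hU.mem_nhds hq] with q' hq' using hf q' hq'

theorem lap_eq_integral {F : Sm d} {U : Set (ℝ × Space d)} (hU : IsOpen U) (hUO : U ⊆ Om d)
    {w : Space d → ℝ} (hw : Integrable w) (hw0 : ∀ z ∉ shell d, w z = 0)
    {Φ : (ℝ × Space d) × Space d → ℝ} (hΦ : ContDiffOn ℝ ∞ Φ (U ×ˢ {z | z ≠ 0}))
    (hF : ∀ q ∈ U, F q = ∫ z, w z * Φ (q, z)) {p : ℝ × Space d} (hp : p ∈ U) :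
    lap F p = ∫ z, w z * ∑ i, secondDeriv i Φ (p, z) := by
  have hc : ∀ i, Integrable fun z => w z * secondDeriv i Φ (p, z) := fun i =>
    integrable_weight_smul isCompact_shell hw hw0
      ((contDiffOn_secondDeriv i (hU.prod isOpen_ne_zero) hΦ).continuousOn.comp
        (f := fun z : Space d => (p, z)) (by fun_prop) fun z hz => ⟨hp, shell_subset hz⟩)
  simp only [Finset.mul_sum]
  rw [lap_apply, sum_apply, integral_finsetSum _ fun i _ => hc i]
  refine Finset.sum_congr rfl fun i _ => ?_
  rw [Dx_Dx_eq_fderiv i F hU hUO hF hp]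
  exact fderiv_fderiv_weighted_integral isCompact_shell hU isOpen_ne_zero shell_subset hw hw0 hΦ
    hp _

theorem sum_secondDeriv_eq_lap {U : Set (ℝ × Space d)} (hU : IsOpen U) (hUO : U ⊆ Om d)
    {Φ : (ℝ × Space d) × Space d → ℝ} (hΦ : ContDiffOn ℝ ∞ Φ (U ×ˢ {z | z ≠ 0}))
    {F : Sm d} {z : Space d} (hz : z ≠ 0) (hF : ∀ q ∈ U, F q = Φ (q, z)) {p : ℝ × Space d}
    (hp : p ∈ U) : ∑ i, secondDeriv i Φ (p, z) = lap F p := by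
  rw [lap_apply, sum_apply]
  refine Finset.sum_congr rfl fun i _ => ?_
  rw [Dx_Dx_eq_fderiv i F hU hUO hF hp]
  exact fderiv_fderiv_slice (hU.prod isOpen_ne_zero) hΦ ⟨hp, hz⟩ _

/-- The Laplacian of the rotated integrand at its pole `x`. -/
def rotLap (a : ℝ) (g : Sm d) (u : ℝ) (x : Sph d) (z : Space d) : ℝ :=
  ∑ i, secondDeriv i (rotInt a x g) ((u, x), z)

theorem norm_coe (x : Sph d) : ‖(x : Space d)‖ = 1 := mem_sphere_zero_iff_norm.1 x.2

theorem coe_mem_rotDom (u : ℝ) (x : Sph d) : (u, (x : Space d)) ∈ rotDom (x : Space d) := by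
  have := mem_rotDom (coe_mem_Om u x)
  simpa [norm_coe] using this

theorem continuousOn_rotLap (a : ℝ) (g : Sm d) (u : ℝ) (x : Sph d) :
    ContinuousOn (rotLap a g u x) (shell d) := by
  refine continuousOn_finsetSum _ fun i _ => ?_
  have h1 := (contDiffOn_secondDeriv i ((isOpen_rotDom (x : Space d)).prod isOpen_ne_zero)
    (contDiffOn_rotInt a (x : Space d) g)).continuousOn
  have h2 : ContinuousOn (fun z : Space d => ((u, (x : Space d)), z)) (shell d) := by fun_prop
  exact h1.comp h2 fun z hz => Set.mk_mem_prod (coe_mem_rotDom u x) (shell_subset hz)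

theorem lap_potSm {a A : ℝ} (h : KernelRange d a A) (g : Sm d) (u : ℝ) (x : Sph d) :
    lap (potSm h g) (u, x) = ∫ z, kw a A x z * rotLap a g u x z :=
  lap_eq_integral (isOpen_rotDom (x : Space d)) (rotDom_subset _) (h.integrable (norm_coe x))
    (fun z hz => kw_eq_zero a A _ hz) (contDiffOn_rotInt a x g)
    (fun q hq => by
      rw [potSm, mk_apply _ _ (rotDom_subset _ hq), pot_eq a h.two_le (norm_coe x) g hq])
    (coe_mem_rotDom u x)

theorem rotLap_one (a : ℝ) (u : ℝ) (x : Sph d) {z : Space d} (hz : z ≠ 0) :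
    rotLap a 1 u x z = -a * (-a + ((d - 1 : ℕ) : ℝ) - 2) := by
  have h0 : ∀ q ∈ rotDom (x : Space d), (rp (-a) : Sm d) q = rotInt a x 1 (q, z) := fun q hq => by
    have h1 : (q.1, lineRefl (‖q.2‖ • (x : Space d) + q.2) z) ∈ Om d := lineRefl_ne_zero _ hz
    rw [rp_apply _ (rotDom_subset _ hq), rotInt, one_apply h1, mul_one]
  have h2 := sum_secondDeriv_eq_lap (isOpen_rotDom (x : Space d)) (rotDom_subset _)
    (contDiffOn_rotInt a (x : Space d) 1) hz h0 (coe_mem_rotDom u x)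
  rw [rotLap, h2, lap_rp, smul_apply, rp_apply_sphere, mul_one]

/-! ### The regularized kernel -/

/-- The regularized kernel with a power, as a smooth function. -/
theorem contDiffOn_kq_rpow {A : ℝ} (hA : 2 < A) (β : ℝ) :
    ContDiffOn ℝ ∞ (fun r : (ℝ × Space d) × Space d => kq A r.1.2 r.2 ^ β)
      (Om d ×ˢ {z | z ≠ 0}) := by
  have hn : ContDiffOn ℝ ∞ (fun r : (ℝ × Space d) × Space d => ‖r.1.2‖)
      (Om d ×ˢ {z | z ≠ 0}) := fun r hr =>
    ((contDiffAt_norm ℝ hr.1).comp r (contDiffAt_snd.comp r contDiffAt_fst)).contDiffWithinAt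
  have hz : ContDiffOn ℝ ∞ (fun r : (ℝ × Space d) × Space d => ‖r.2‖)
      (Om d ×ˢ {z | z ≠ 0}) := fun r hr =>
    ((contDiffAt_norm ℝ hr.2).comp r contDiffAt_snd).contDiffWithinAt
  have h12 : ContDiffOn ℝ ∞ (fun r : (ℝ × Space d) × Space d => r.1.2)
      (Om d ×ˢ {z | z ≠ 0}) := by fun_prop
  refine ContDiffOn.rpow_const_of_ne ?_ fun r hr => (kq_pos hA hr.1 r.2).ne'
  exact (contDiffOn_const.mul hn).sub (contDiffOn_const.mul (h12.inner ℝ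
    ((hz.inv fun r hr => norm_ne_zero_iff.2 hr.2).smul contDiffOn_snd)))

/-- The kernel `A |y| - 2 ⟪y, z / |z|⟫` as a function of `y`. -/
def kqSm (A : ℝ) (z : Space d) : Sm d := A • rp 1 - (2 : ℝ) • ∑ i, (‖z‖⁻¹ * z i) • Y i

theorem kqSm_apply (A : ℝ) (z : Space d) {p : ℝ × Space d} (hp : p ∈ Om d) :
    kqSm A z p = kq A p.2 z := by
  simp only [kqSm, sub_apply, smul_apply, sum_apply, Y_apply _ hp, rp_apply _ hp, Real.rpow_one,
    kq, PiLp.inner_apply]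
  congr 2

/-- Powers of the regularized kernel as functions of `y`. -/
def kqPow {A : ℝ} (hA : 2 < A) {z : Space d} (hz : z ≠ 0) (β : ℝ) : Sm d :=
  mk (fun p => kq A p.2 z ^ β) ((contDiffOn_kq_rpow hA β).comp
    (f := fun p : ℝ × Space d => (p, z)) (by fun_prop) fun _ hp => ⟨hp, hz⟩)

theorem kqPow_apply {A : ℝ} (hA : 2 < A) {z : Space d} (hz : z ≠ 0) (β : ℝ) {p : ℝ × Space d}
    (hp : p ∈ Om d) : kqPow hA hz β p = kq A p.2 z ^ β := mk_apply _ _ hp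

theorem Dx_kqPow {A : ℝ} (hA : 2 < A) {z : Space d} (hz : z ≠ 0) (β : ℝ) (i : Fin (d - 1)) :
    Dx i (kqPow hA hz β) = β • (kqPow hA hz (β - 1) * Dx i (kqSm A z)) := by
  refine Sm.ext fun p hp => ?_
  have h1 : (kqPow hA hz β : ℝ × Space d → ℝ) =ᶠ[nhds p] fun q => kqSm A z q ^ β := by
    filter_upwards [isOpen_Om.mem_nhds hp] with q hq
    rw [kqPow_apply hA hz β hq, kqSm_apply A z hq]
  have h2 : kqSm A z p ≠ 0 := by rw [kqSm_apply A z hp]; exact (kq_pos hA hp z).ne'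
  have h3 := ((kqSm A z).differentiableAt hp).hasFDerivAt.rpow_const (p := β) (Or.inl h2)
  rw [Dx, dir_apply_of_eventuallyEq _ _ hp h1, h3.fderiv, smul_apply, mul_apply,
    kqPow_apply hA hz _ hp, dir_apply _ _ hp, kqSm_apply A z hp]
  simp [mul_assoc]

theorem Dx_kqSm (A : ℝ) (z : Space d) (i : Fin (d - 1)) :
    Dx i (kqSm A z) = A • (Y i * rp (-1)) - (2 * (‖z‖⁻¹ * z i)) • 1 := by
  rw [kqSm, map_sub, Dx_smul, Dx_smul, Dx_rp, map_sum, show (1 : ℝ) - 2 = -1 by norm_num, one_smul]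
  simp only [Dx_smul, Dx_Y, smul_ite, smul_zero, Finset.sum_ite_eq, Finset.mem_univ, if_true,
    smul_smul]

theorem lap_kqPow {A : ℝ} (hA : 2 < A) {z : Space d} (hz : z ≠ 0) {a : ℝ}
    (ha : 2 * a = ((d - 1 : ℕ) : ℝ) - 3) (u : ℝ) (x : Sph d) :
    lap (kqPow hA hz (-a)) (u, x) = -(a * (a + 1) * (A ^ 2 - 4)) * kq A x z ^ (-a - 2) := by
  have hp : (u, (x : Space d)) ∈ Om d := coe_mem_Om u x
  have h1 : ∀ i, Dx i (Dx i (kqPow hA hz (-a)))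
      = (-a * (-a - 1)) • (kqPow hA hz (-a - 2) * (Dx i (kqSm A z) * Dx i (kqSm A z)))
        + (-a) • (kqPow hA hz (-a - 1) * Dx i (Dx i (kqSm A z))) := fun i => by
    rw [Dx_kqPow, Dx_smul, Dx_mul, Dx_kqPow, show -a - 1 - 1 = -a - 2 by ring]
    refine Sm.ext fun p _ => ?_
    simp only [smul_apply, add_apply, mul_apply]
    ring
  have h2 : lap (kqSm A z) (u, x) = A * (((d - 1 : ℕ) : ℝ) - 1) := by
    have h3 : lap (kqSm A z) = A • lap (rp 1) := by
      rw [kqSm, map_sub, map_smul, map_smul, map_sum]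
      simp [lap_Y]
    rw [h3, lap_rp, smul_apply, smul_apply, rp_apply_sphere]
    ring
  set q := kq A x z with hq
  have hq0 : 0 < q := kq_pos hA (ne_zero_of_mem_unit_sphere x) z
  have hxz : 2 * ∑ i, (x : Space d) i * (‖z‖⁻¹ * z i) = A - q := by
    rw [hq, kq, norm_coe, PiLp.inner_apply]
    simp [mul_comm]
  have hxx : ∑ i, (x : Space d) i * (x : Space d) i = 1 := by
    have := EuclideanSpace.real_norm_sq_eq (x : Space d)
    rw [norm_coe] at this
    simpa [sq] using this.symm
  have hzz : ∑ i, (‖z‖⁻¹ * z i) * (‖z‖⁻¹ * z i) = 1 := by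
    have := EuclideanSpace.real_norm_sq_eq (‖z‖⁻¹ • z)
    rw [norm_inv_smul_eq hz] at this
    simpa [sq] using this.symm
  have h4 : ∑ i, Dx i (kqSm A z) (u, x) * Dx i (kqSm A z) (u, x) = 4 - A ^ 2 + 2 * A * q := by
    have h5 : ∀ i, Dx i (kqSm A z) (u, x) * Dx i (kqSm A z) (u, x)
        = A ^ 2 * ((x : Space d) i * (x : Space d) i)
          - 2 * A * (2 * ((x : Space d) i * (‖z‖⁻¹ * z i)))
          + 4 * ((‖z‖⁻¹ * z i) * (‖z‖⁻¹ * z i)) := fun i => by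
      rw [Dx_kqSm]
      simp only [sub_apply, smul_apply, mul_apply, Y_apply _ hp, rp_apply_sphere, one_apply hp]
      ring
    simp only [h5, Finset.sum_add_distrib, Finset.sum_sub_distrib, ← Finset.mul_sum]
    rw [hxz, hxx, hzz]
    ring
  rw [lap_apply, sum_apply]
  simp only [h1, add_apply, smul_apply, mul_apply]
  rw [Finset.sum_add_distrib, ← Finset.mul_sum, ← Finset.mul_sum, ← Finset.mul_sum,
    ← Finset.mul_sum, h4]
  have h6 : ∑ i, Dx i (Dx i (kqSm A z)) (u, x) = A * (((d - 1 : ℕ) : ℝ) - 1) := by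
    rw [← h2, lap_apply, sum_apply]
  rw [h6, kqPow_apply hA hz _ hp, kqPow_apply hA hz _ hp]
  have h7 : kq A x z ^ (-a - 1) = kq A x z ^ (-a - 2) * q := by
    rw [← hq, ← Real.rpow_add_one hq0.ne']
    congr 1
    ring
  simp only
  rw [h7, ← hq]
  have h8 : ((d - 1 : ℕ) : ℝ) = 2 * a + 3 := by linarith
  rw [h8]
  ring

end Sm

end

section

open MeasureTheory

namespace Sm

variable {d : ℕ}

/-- A function of retarded time only. -/
def atPoint (g : Sm d) {z : Space d} (hz : z ≠ 0) : Sm d :=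
  mk (fun p => g (p.1, z)) (g.contDiffOn.comp (by fun_prop) fun _ _ => hz)

theorem Dx_atPoint (g : Sm d) {z : Space d} (hz : z ≠ 0) (i : Fin (d - 1)) :
    Dx i (atPoint g hz) = 0 := by
  refine Sm.ext fun p hp => ?_
  have hq : (p.1, z) ∈ Om d := hz
  have h1 : HasFDerivAt (fun q : ℝ × Space d => (q.1, z))
      ((ContinuousLinearMap.fst ℝ ℝ (Space d)).prod 0) p :=
    hasFDerivAt_fst.prodMk (hasFDerivAt_const z p)
  have h2 : HasFDerivAt (fun q : ℝ × Space d => g (q.1, z)) _ p :=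
    ((g.differentiableAt hq).hasFDerivAt).comp p h1
  rw [Dx, dir_apply_of_eventuallyEq _ (atPoint g hz) hp (eventuallyEq_mk _ _ hp), h2.fderiv,
    zero_apply]
  simp only [ContinuousLinearMap.comp_apply, ContinuousLinearMap.prod_apply,
    ContinuousLinearMap.coe_fst']
  exact map_zero _

theorem lap_atPoint (g : Sm d) {z : Space d} (hz : z ≠ 0) : lap (atPoint g hz) = 0 := by
  rw [lap_apply]
  simp only [Dx_atPoint, map_zero, Finset.sum_const_zero]

theorem atPoint_apply (g : Sm d) {z : Space d} (hz : z ≠ 0) {p : ℝ × Space d} (hp : p ∈ Om d) :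
    atPoint g hz p = g (p.1, z) :=
  mk_apply _ _ hp

theorem integrable_kq_rpow {A : ℝ} (hA : 2 < A) (β u : ℝ) (g : Sm d) {x : Space d} (hx : x ≠ 0) :
    Integrable fun z => wt z * (kq A x z ^ β * g (u, z)) := by
  have h1 : ContinuousOn (fun z => kq A x z ^ β) {z : Space d | z ≠ 0} :=
    (contDiffOn_kq_rpow hA β).continuousOn.comp (f := fun z : Space d => (((0 : ℝ), x), z))
      (by fun_prop) fun z hz => Set.mk_mem_prod hx hz
  exact integrable_weight_smul isCompact_shell integrable_wt (fun _ => wt_eq_zero)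
    ((h1.mul (continuousOn_slice g u)).mono shell_subset)

theorem lap_potSm_of_lt {a A : ℝ} (h : KernelRange d a A) (hA : 2 < A)
    (ha : 2 * a = ((d - 1 : ℕ) : ℝ) - 3) (g : Sm d) (u : ℝ) (x : Sph d) :
    lap (potSm h g) (u, x)
      = -(a * (a + 1) * (A ^ 2 - 4)) * ∫ z, wt z * (kq A x z ^ (-a - 2) * g (u, z)) := by
  set Φ : (ℝ × Space d) × Space d → ℝ := fun r => kq A r.1.2 r.2 ^ (-a) * g (r.1.1, r.2) with hΦd
  have hΦ : ContDiffOn ℝ ∞ Φ (Om d ×ˢ {z | z ≠ 0}) :=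
    (contDiffOn_kq_rpow hA (-a)).mul (g.contDiffOn.comp (by fun_prop) fun r hr => hr.2)
  have h1 := lap_eq_integral (F := potSm h g) isOpen_Om subset_rfl integrable_wt
    (fun _ => wt_eq_zero) hΦ (fun q hq => by
      rw [potSm, mk_apply _ _ hq, pot]
      simp only [kw, hΦd, mul_assoc]) (coe_mem_Om u x)
  rw [h1, ← integral_const_mul]
  refine integral_congr_ae (Filter.Eventually.of_forall fun z => ?_)
  by_cases hzs : z ∈ shell d
  swap
  · simp only [wt_eq_zero hzs, zero_mul, mul_zero]
  have hz : z ≠ 0 := shell_subset hzs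
  have h2 : ∀ q ∈ Om d, (kqPow hA hz (-a) * atPoint g hz) q = Φ (q, z) := fun q hq => by
    rw [mul_apply, kqPow_apply hA hz _ hq, atPoint_apply g hz hq]
  have h3 := sum_secondDeriv_eq_lap isOpen_Om subset_rfl hΦ hz h2 (coe_mem_Om u x)
  simp only [h3, lap_mul, Dx_atPoint, mul_zero, Finset.sum_const_zero, smul_zero, add_zero]
  rw [lap_atPoint, mul_zero, zero_add, mul_apply, lap_kqPow hA hz ha,
    atPoint_apply g hz (coe_mem_Om u x)]
  ring

/-- The total mass of the kernel. -/
def kwMass (a : ℝ) (x : Space d) : ℝ := ∫ z, kw a 2 x z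

theorem kwMass_eq (a : ℝ) (x y : Sph d) : kwMass a (x : Space d) = kwMass a (y : Space d) := by
  obtain ⟨R, hR⟩ := exists_isometry (x := (x : Space d)) (y := (y : Space d))
    (by rw [norm_coe, norm_coe])
  rw [kwMass, kwMass, ← hR, ← integral_isometry R (fun z => kw a 2 (R x) z)]
  simp only [kw_isometry]

theorem kwMass_pos {a : ℝ} (h : KernelRange d a 2) (x : Sph d) : 0 < kwMass a (x : Space d) := by
  have hn : 0 ≤ fun z => kw a 2 (x : Space d) z := fun z => kw_nonneg a (le_refl 2) (x : Space d) z
  have hi : Integrable fun z => kw a 2 (x : Space d) z := h.integrable (norm_coe x)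
  refine lt_of_le_of_ne (integral_nonneg hn) fun h0 => ?_
  have h1 := (integral_eq_zero_iff_of_nonneg hn hi).1 h0.symm
  have h2 : ∀ᵐ z : Space d, wt z = 0 := by
    filter_upwards [h1, ae_kq_two_pos h.dim (norm_coe x)] with z hz hz'
    exact (mul_eq_zero.1 hz).resolve_right (Real.rpow_pos_of_pos hz' _).ne'
  have h3 := continuous_wt.ae_eq_iff_eq volume continuous_zero |>.1 h2
  have h4 := congrFun h3 ((3 / 2 : ℝ) • (x : Space d))
  exact (wt_pos (by rw [norm_smul, norm_coe]; norm_num)).ne' h4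

theorem exists_quartic_bound {g : Sm d} (hg : Hom 0 g) (u : ℝ) (x : Sph d) {ε : ℝ} (hε : 0 < ε) :
    ∃ C, 0 ≤ C ∧ ∀ z ∈ shell d, |g (u, z) - g (u, x)| ≤ ε + C * kq 2 (x : Space d) z ^ 2 := by
  have hx : (x : Space d) ≠ 0 := ne_zero_of_mem_unit_sphere x
  have hc : ContinuousAt (fun z => g (u, z)) (x : Space d) :=
    (continuousOn_slice g u).continuousAt (isOpen_ne_zero.mem_nhds hx)
  obtain ⟨η, hη, hηg⟩ := Metric.continuousAt_iff.1 hc ε hε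
  obtain ⟨M, hM⟩ := isCompact_shell.exists_bound_of_continuousOn
    (((continuousOn_slice g u).sub (continuousOn_const (c := g (u, x)))).mono
      (shell_subset (d := d)))
  have hM0 : 0 ≤ M := (norm_nonneg _).trans
    (hM (x : Space d) ⟨by rw [norm_coe], by rw [norm_coe]; norm_num⟩)
  refine ⟨M / η ^ 4, by positivity, fun z hz => ?_⟩
  have hz0 : z ≠ 0 := shell_subset hz
  have hzn : 0 < ‖z‖ := norm_pos_iff.2 hz0
  rw [kq_two (norm_coe x) hz0]
  by_cases h : dist (‖z‖⁻¹ • z) (x : Space d) < η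
  · have h1 := hηg h
    have h2 : g (u, ‖z‖⁻¹ • z) = g (u, z) := by
      have := hg (u, z) hz0 ‖z‖⁻¹ (inv_pos.2 hzn)
      rwa [Real.rpow_zero, one_mul] at this
    rw [h2, Real.dist_eq] at h1
    exact h1.le.trans (le_add_of_nonneg_right (by positivity))
  · rw [not_lt, dist_comm, dist_eq_norm] at h
    have h1 : η ^ 4 ≤ (‖(x : Space d) - ‖z‖⁻¹ • z‖ ^ 2) ^ 2 := by
      rw [← pow_mul]
      gcongr
    have h2 : M ≤ M / η ^ 4 * (‖(x : Space d) - ‖z‖⁻¹ • z‖ ^ 2) ^ 2 := by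
      rw [div_mul_eq_mul_div, le_div_iff₀ (by positivity)]
      exact mul_le_mul_of_nonneg_left h1 hM0
    have h3 := hM z hz
    rw [Real.norm_eq_abs] at h3
    change |g (u, z) - g (u, x)| ≤ M at h3
    linarith

theorem lap_potSm_two {a : ℝ} (h : KernelRange d a 2) (ha : 2 * a = ((d - 1 : ℕ) : ℝ) - 3)
    {g : Sm d} (hg : Hom 0 g) (u : ℝ) (x : Sph d) :
    lap (potSm h g) (u, x) = -(a * (a + 1) * kwMass a (x : Space d)) * g (u, x) := by
  have hA : ∀ {A : ℝ}, 2 < A → KernelRange d a A := fun hA =>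
    ⟨h.dim, h.nonneg, h.lt, le_of_lt hA⟩
  have ha0 := h.nonneg
  have hx : (x : Space d) ≠ 0 := ne_zero_of_mem_unit_sphere x
  set I : ℝ → Sm d → ℝ := fun A f =>
    a * (a + 1) * (A ^ 2 - 4) * ∫ z, wt z * (kq A x z ^ (-a - 2) * f (u, z)) with hI
  set m : ℝ → ℝ := fun A => ∫ z, kw a A (x : Space d) z with hm
  have hI1 : ∀ f : Sm d, ∀ A, 2 < A → I A f = -∫ z, kw a A x z * rotLap a f u x z := by
    intro f A h2
    rw [← lap_potSm (hA h2), lap_potSm_of_lt (hA h2) h2 ha]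
    ring
  have hmt : Filter.Tendsto m (nhdsWithin 2 (Set.Ioi 2)) (nhds (kwMass a (x : Space d))) := by
    have := tendsto_integral_kw h.dim h.nonneg h.lt (norm_coe x)
      (continuousOn_const (c := (1 : ℝ)) (s := shell d))
    simpa only [mul_one, hm, kwMass] using this
  have hIone : ∀ A, 2 < A → I A 1 = a * (a + 1) * m A := by
    intro A h2
    rw [hI1 1 A h2, hm]
    simp only
    rw [← integral_const_mul, ← integral_neg]
    refine integral_congr_ae (Filter.Eventually.of_forall fun z => ?_)
    by_cases hzs : z ∈ shell d
    · simp only [rotLap_one a u x (shell_subset hzs)]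
      have : ((d - 1 : ℕ) : ℝ) = 2 * a + 3 := by linarith
      rw [this]
      ring
    · simp only [kw_eq_zero _ _ _ hzs, zero_mul, mul_zero, neg_zero]
  have hlim1 : Filter.Tendsto (fun A => I A g) (nhdsWithin 2 (Set.Ioi 2))
      (nhds (-lap (potSm h g) (u, x))) := by
    rw [lap_potSm h]
    refine ((tendsto_integral_kw h.dim h.nonneg h.lt (norm_coe x)
      (continuousOn_rotLap a g u x)).neg).congr' ?_
    filter_upwards [self_mem_nhdsWithin] with A h2
    rw [hI1 g A h2]
  have hlim2 : Filter.Tendsto (fun A => I A 1 * g (u, x)) (nhdsWithin 2 (Set.Ioi 2))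
      (nhds (a * (a + 1) * kwMass a (x : Space d) * g (u, x))) := by
    refine ((hmt.const_mul (a * (a + 1))).mul_const (g (u, x))).congr' ?_
    filter_upwards [self_mem_nhdsWithin] with A h2
    rw [hIone A h2]
  have hbound : ∀ ε > 0, ∃ C, 0 ≤ C ∧ ∀ A, 2 < A → |I A g - I A 1 * g (u, x)|
      ≤ ε * (a * (a + 1) * m A) + C * ((A ^ 2 - 4) * m A) := by
    intro ε hε
    obtain ⟨C, hC0, hC⟩ := exists_quartic_bound hg u x hε
    refine ⟨a * (a + 1) * C, by positivity, fun A h2 => ?_⟩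
    have hA4 : 0 ≤ A ^ 2 - 4 := by nlinarith
    have hint : ∀ f : Sm d, Integrable fun z => wt z * (kq A x z ^ (-a - 2) * f (u, z)) :=
      fun f => integrable_kq_rpow h2 (-a - 2) u f hx
    have e1 : I A g - I A 1 * g (u, x) = a * (a + 1) * (A ^ 2 - 4)
        * ∫ z, (wt z * (kq A x z ^ (-a - 2) * g (u, z))
          - wt z * (kq A x z ^ (-a - 2) * (1 : Sm d) (u, z)) * g (u, x)) := by
      rw [integral_sub (hint g) ((hint 1).mul_const _), integral_mul_const]
      simp only [hI]
      ring
    have e2 : ε * (a * (a + 1) * m A) + a * (a + 1) * C * ((A ^ 2 - 4) * m A)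
        = a * (a + 1) * (A ^ 2 - 4) * ∫ z, (ε * (wt z * (kq A x z ^ (-a - 2) * (1 : Sm d) (u, z)))
          + C * kw a A x z) := by
      rw [← hIone A h2, integral_add ((hint 1).const_mul _)
        (((hA h2).integrable (norm_coe x)).const_mul _), integral_const_mul, integral_const_mul]
      simp only [hI, hm]
      ring
    rw [e1, e2, abs_mul, abs_of_nonneg (by positivity : 0 ≤ a * (a + 1) * (A ^ 2 - 4))]
    refine mul_le_mul_of_nonneg_left ?_ (by positivity)
    rw [← Real.norm_eq_abs]
    refine norm_integral_le_of_norm_le (((hint 1).const_mul _).add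
        (((hA h2).integrable (norm_coe x)).const_mul _))
      (Filter.Eventually.of_forall fun z => ?_)
    by_cases hzs : z ∈ shell d
    swap
    · simp [wt_eq_zero hzs, kw_eq_zero a A _ hzs]
    have hz0 : z ≠ 0 := shell_subset hzs
    have hp : (u, z) ∈ Om d := hz0
    have hq : 0 < kq A x z := kq_pos h2 hx z
    have hqq : kq 2 (x : Space d) z ≤ kq A x z := by
      rw [kq, kq, norm_coe]
      linarith
    have h3 : kq A x z ^ (-a) = kq A x z ^ (-a - 2) * kq A x z ^ 2 := by
      rw [← Real.rpow_natCast, ← Real.rpow_add hq]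
      congr 1
      push_cast
      ring
    have hr : 0 ≤ kq A x z ^ (-a - 2) := (Real.rpow_pos_of_pos hq _).le
    have h4 : kq 2 (x : Space d) z ^ 2 ≤ kq A x z ^ 2 :=
      pow_le_pow_left₀ (kq_nonneg le_rfl _ _) hqq 2
    simp only [one_apply hp, mul_one, kw, h3]
    have h5 : wt z * (kq A x z ^ (-a - 2) * g (u, z)) - wt z * kq A x z ^ (-a - 2) * g (u, x)
        = (wt z * kq A x z ^ (-a - 2)) * (g (u, z) - g (u, x)) := by ring
    rw [h5, norm_mul, Real.norm_of_nonneg (mul_nonneg (wt_nonneg z) hr), Real.norm_eq_abs]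
    calc wt z * kq A x z ^ (-a - 2) * |g (u, z) - g (u, x)|
        ≤ wt z * kq A x z ^ (-a - 2) * (ε + C * kq A x z ^ 2) := by
          refine mul_le_mul_of_nonneg_left ((hC z hzs).trans ?_) (mul_nonneg (wt_nonneg z) hr)
          gcongr
      _ = _ := by ring
  have hlim3 : Filter.Tendsto (fun A => I A g - I A 1 * g (u, x)) (nhdsWithin 2 (Set.Ioi 2))
      (nhds 0) := by
    have hM := kwMass_pos h x
    set M := kwMass a (x : Space d)
    rw [Metric.tendsto_nhds]
    intro ε hε
    have hδ : 0 < ε / (2 * (a * (a + 1) * M + 1)) := by positivity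
    obtain ⟨C, hC0, hC⟩ := hbound _ hδ
    have hA2 : Filter.Tendsto (fun A : ℝ => A ^ 2 - 4) (nhdsWithin 2 (Set.Ioi 2)) (nhds 0) := by
      have : Filter.Tendsto (fun A : ℝ => A ^ 2 - 4) (nhds 2) (nhds (2 ^ 2 - 4)) :=
        (by fun_prop : Continuous fun A : ℝ => A ^ 2 - 4).tendsto 2
      rw [show (2 : ℝ) ^ 2 - 4 = 0 by norm_num] at this
      exact this.mono_left nhdsWithin_le_nhds
    have hlim := ((hmt.const_mul (a * (a + 1))).const_mul
      (ε / (2 * (a * (a + 1) * M + 1)))).add ((hA2.mul hmt).const_mul C)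
    have hlt : ε / (2 * (a * (a + 1) * M + 1)) * (a * (a + 1) * M) + C * (0 * M) < ε := by
      rw [zero_mul, mul_zero, add_zero, div_mul_eq_mul_div, div_lt_iff₀ (by positivity)]
      have : 0 ≤ a * (a + 1) * M := by positivity
      nlinarith
    filter_upwards [self_mem_nhdsWithin, hlim.eventually (gt_mem_nhds hlt)] with A h2 h3
    rw [Real.dist_eq, sub_zero]
    exact (hC A h2).trans_lt h3
  have hlim4 := hlim1.sub hlim2
  have h6 := tendsto_nhds_unique hlim4 hlim3
  linarith

theorem lapSurj_conformal {a : ℝ} (ha0 : 0 < a) (ha : 2 * a = ((d - 1 : ℕ) : ℝ) - 3) :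
    LapSurj d (-a) := by
  have hd : (3 : ℝ) < ((d - 1 : ℕ) : ℝ) := by linarith
  have hd' : 3 < d - 1 := by exact_mod_cast hd
  have h : KernelRange d a 2 := ⟨by omega, ha0.le, by linarith, le_rfl⟩
  intro G hG
  set e : Sph d := ⟨EuclideanSpace.single ⟨0, by omega⟩ 1, by simp⟩
  set C : ℝ := a * (a + 1) * kwMass a (e : Space d) with hC
  have hC0 : 0 < C := by have := kwMass_pos h e; positivity
  have hg : Hom 0 (rp (a + 2) * G) := ((hom_rp _).mul hG).congr (by ring)
  refine ⟨(-C⁻¹) • potSm h (rp (a + 2) * G), (hom_potSm h _).smul _, ?_⟩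
  refine (((hom_potSm h _).smul _).lap).ext hG fun u x => ?_
  rw [map_smul, smul_apply, lap_potSm_two h ha hg, kwMass_eq a x e, ← hC, mul_apply,
    rp_apply_sphere]
  field_simp

end Sm

end

section

namespace Sm

variable {d : ℕ}

/-! ### The Laplacian at the orders of the expansion -/

theorem lap_ladder {τ : ℝ} (hi : LapInj d τ) (hi' : LapInj d (τ - 1)) (hs : LapSurj d τ) (j : ℕ)
    (h : ∀ i : ℕ, i < j → τ + i + 1 ≠ 0 ∧ τ + i ≠ 1) :
    LapInj d (τ + j) ∧ LapInj d (τ + j - 1) ∧ LapSurj d (τ + j) := by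
  induction j with
  | zero => simpa using ⟨hi, hi', hs⟩
  | succ j ih =>
    obtain ⟨h1, h2, h3⟩ := ih fun i hij => h i (by omega)
    obtain ⟨h4, h5⟩ := h j (by omega)
    have e : τ + ((j + 1 : ℕ) : ℝ) = τ + j + 1 := by push_cast; ring
    rw [e, add_sub_cancel_right]
    exact ⟨h1.succ h4, h1, h3.succ h2 h4 (sub_ne_zero.2 h5)⟩

theorem lapInj_lapSurj_order (hd : 4 ≤ d) {k : ℕ} (hk : 1 ≤ k)
    (h : Odd d ∨ (d : ℝ) / 2 - 1 + k ≤ d - 3) :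
    LapInj d (1 - ((d : ℝ) / 2 - 1 + k)) ∧ LapSurj d (1 - ((d : ℝ) / 2 - 1 + k)) := by
  have hk' : (1 : ℝ) ≤ k := by exact_mod_cast hk
  have hd5 : (4 : ℝ) < d := by
    rcases h with h | h
    · have : d ≠ 4 := by rintro rfl; exact absurd h (by decide)
      exact_mod_cast lt_of_le_of_ne hd this.symm
    · linarith
  have hN : ((d - 1 : ℕ) : ℝ) = d - 1 := by rw [Nat.cast_sub (by omega), Nat.cast_one]
  have ha0 : 0 < ((d : ℝ) - 4) / 2 := by linarith
  have hi : LapInj d (-(((d : ℝ) - 4) / 2)) := lapInj_of_neg (by rw [hN]; nlinarith)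
  have hs : LapSurj d (-(((d : ℝ) - 4) / 2)) := lapSurj_conformal ha0 (by rw [hN]; ring)
  have hi' : LapInj d (-(((d : ℝ) - 4) / 2) - 1) := hi.kelvin (by rw [hN]; ring)
  obtain ⟨h1, -, h2⟩ := lap_ladder hi hi' hs (k - 1) fun i hik => by
    rcases h with h | h
    · obtain ⟨e, rfl⟩ := h
      push_cast
      constructor <;> intro h0
      · have : (2 * (i : ℝ) + 5) = 2 * e := by linarith
        have : 2 * i + 5 = 2 * e := by exact_mod_cast this
        omega
      · have : (2 * (i : ℝ) + 1) = 2 * e := by linarith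
        have : 2 * i + 1 = 2 * e := by exact_mod_cast this
        omega
    · have : (i : ℝ) + 2 ≤ k := by exact_mod_cast (by omega : i + 2 ≤ k)
      constructor <;> intro h0 <;> linarith
  have e : 1 - ((d : ℝ) / 2 - 1 + k)
      = 2 - ((d - 1 : ℕ) : ℝ) - (-(((d : ℝ) - 4) / 2) + ((k - 1 : ℕ) : ℝ)) := by
    rw [hN, Nat.cast_sub hk, Nat.cast_one]
    ring
  exact ⟨h1.kelvin e, h2.kelvin e⟩

/-! ### Chains of wave equations -/

theorem wave_of_zero {F : ℝ → Sm d} {n : ℝ} (h : F (n - 1) = 0) :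
    wave F n = (2 * n - d + 2) • (rp (-1) * Dt (F n)) := by
  rw [wave, h, map_zero, zero_add]

theorem Dt_eq_of_wave {F : ℝ → Sm d} {n : ℝ} (hn : 2 * n - d + 2 ≠ 0) :
    Dt (F n) = (2 * n - d + 2)⁻¹ • (rp 1 * (wave F n - lap (F (n - 1)))) := by
  rw [wave, add_sub_cancel_left, mul_smul_comm, smul_smul, inv_mul_cancel₀ hn, one_smul,
    rp_mul_cancel]

theorem exists_chain_zero {c u₀ : ℝ} (hc : ∀ k : ℕ, 2 * (c + (k + 1)) - d + 2 ≠ 0)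
    {S b : ℝ → Sm d} (hS : ∀ n, Hom (-n - 1) (S n)) (hS0 : ∀ n, (¬ ∃ k : ℕ, n = c + k) → S n = 0)
    (hb : ∀ k : ℕ, Hom (-(c + (k + 1))) (b (c + (k + 1)))) {a : Sm d} (ha : Hom (-c) a) :
    ∃ F : ℝ → Sm d, (∀ n, Hom (-n) (F n)) ∧ (∀ n, (¬ ∃ k : ℕ, n = c + k) → F n = 0) ∧
      (∀ n, n ≠ c → wave F n = S n) ∧ F c = a ∧
      ∀ k : ℕ, ∀ y : Space d, y ≠ 0 → F (c + (k + 1)) (u₀, y) = b (c + (k + 1)) (u₀, y) := by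
  have step : ∀ (k : ℕ) (F : Sm d), ∃ F' : Sm d, Hom (-(c + k)) F →
      Hom (-(c + (k + 1))) F' ∧ Dt F' = (2 * (c + (k + 1)) - d + 2)⁻¹ •
        (rp 1 * (S (c + (k + 1)) - lap F)) ∧
      ∀ y : Space d, y ≠ 0 → F' (u₀, y) = b (c + (k + 1)) (u₀, y) := by
    intro k F
    by_cases hF : Hom (-(c + k)) F
    · obtain ⟨F', h⟩ := exists_Dt_eq u₀ (((hom_rp 1).mul ((hS (c + (k + 1))).sub
        (hF.lap.congr (by ring)))).smul (2 * (c + (k + 1)) - d + 2)⁻¹ |>.congr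
          (by ring : _ = -(c + (k + 1)))) (hb k)
      exact ⟨F', fun _ => h⟩
    · exact ⟨0, fun h => absurd h hF⟩
  choose f hf using step
  set g : ℕ → Sm d := fun k => Nat.rec a (fun k F => f k F) k with hg
  have hgs : ∀ k, g (k + 1) = f k (g k) := fun k => rfl
  have hgH : ∀ k : ℕ, Hom (-(c + k)) (g k) := fun k => by
    induction k with
    | zero => exact ha.congr (by simp)
    | succ k ih =>
      rw [hgs]
      exact (hf k _ ih).1.congr (by push_cast; ring)
  have hinj : Function.Injective fun k : ℕ => c + k := fun k l h => by simpa using h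
  set F : ℝ → Sm d := Function.extend (fun k : ℕ => c + k) g 0 with hF
  have hFk : ∀ k : ℕ, F (c + k) = g k := fun k => hinj.extend_apply g 0 k
  have hF0 : ∀ n, (¬ ∃ k : ℕ, n = c + k) → F n = 0 := fun n hn =>
    Function.extend_apply' _ _ _ fun ⟨k, hk⟩ => hn ⟨k, hk.symm⟩
  have hFs : ∀ k : ℕ, F (c + (k + 1)) = g (k + 1) := fun k => by
    rw [← hFk (k + 1)]; push_cast; rfl
  refine ⟨F, fun n => ?_, hF0, fun n hn => ?_, (by simpa using hFk 0 : F c = g 0), fun k y hy => ?_⟩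
  · by_cases h : ∃ k : ℕ, n = c + k
    · obtain ⟨k, rfl⟩ := h
      rw [hFk]
      exact hgH k
    · rw [hF0 n h]
      exact Hom.zero
  · by_cases h : ∃ k : ℕ, n = c + k
    · obtain ⟨_ | k, rfl⟩ := h
      · simp at hn
      · push_cast
        rw [wave, hFs, show c + ((k : ℝ) + 1) - 1 = c + k by ring, hFk, hgs, (hf k _ (hgH k)).2.1,
          mul_smul_comm, smul_smul, mul_inv_cancel₀ (hc k), one_smul]
        have := rp_mul_cancel (-1) (S (c + (k + 1)) - lap (g k))
        rw [neg_neg] at this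
        rw [this]
        abel
    · have h1 : ¬ ∃ k : ℕ, n - 1 = c + k := fun ⟨k, hk⟩ => h ⟨k + 1, by push_cast; linarith⟩
      rw [wave, hF0 n h, hF0 _ h1, hS0 n h, map_zero, map_zero, mul_zero, smul_zero, add_zero]
  · rw [hFs]
    exact (hf k _ (hgH k)).2.2 y hy

theorem exists_chain {c u₀ : ℝ} (hc : ∀ k : ℕ, 2 * (c + (k + 1)) - d + 2 ≠ 0)
    {S : ℝ → Sm d} (hS : ∀ n, Hom (-n - 1) (S n)) (hS0 : ∀ n, (¬ ∃ k : ℕ, n = c + k) → S n = 0)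
    (M : ℕ) (hL : ∀ k : ℕ, k < M → LapSurj d (1 - (c + (k + 1)))) (b : ℝ → Sm d)
    (hb : ∀ k : ℕ, M ≤ k → Hom (-(c + (k + 1))) (b (c + (k + 1)))) {a : Sm d}
    (ha : Hom (-(c + M)) a) :
    ∃ F : ℝ → Sm d, (∀ n, Hom (-n) (F n)) ∧ (∀ n, (¬ ∃ k : ℕ, n = c + k) → F n = 0) ∧
      (∀ n, n ≠ c → wave F n = S n) ∧ F (c + M) = a ∧
      ∀ k : ℕ, M ≤ k → ∀ y : Space d, y ≠ 0 →
        F (c + (k + 1)) (u₀, y) = b (c + (k + 1)) (u₀, y) := by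
  induction M generalizing a b with
  | zero =>
    obtain ⟨F, h1, h2, h3, h4, h5⟩ := exists_chain_zero (u₀ := u₀) hc hS hS0
      (fun k => hb k (Nat.zero_le k)) (ha.congr (by simp))
    exact ⟨F, h1, h2, h3, by simpa using h4, fun k _ => h5 k⟩
  | succ M ih =>
    have hM : c + ((M + 1 : ℕ) : ℝ) = c + (M + 1) := by push_cast; ring
    rw [hM] at ha
    obtain ⟨a', ha', hla⟩ := hL M (by omega)
      (S (c + (M + 1)) - (2 * (c + (M + 1)) - d + 2) • (rp (-1) * Dt a))
      (((hS _).congr (by ring)).sub ((((hom_rp _).mul ha.Dt).smul _).congr (by ring)))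
    obtain ⟨F, h1, h2, h3, h4, h5⟩ := ih (fun k hk => hL k (by omega))
      (Function.update b (c + (M + 1)) a) (fun k hk => by
        by_cases hkM : k = M
        · rw [hkM, Function.update_self]
          exact ha
        · rw [Function.update_of_ne (by simpa using hkM)]
          exact hb k (by omega)) (ha'.congr (by ring))
    refine ⟨F, h1, h2, h3, ?_, fun k hk y hy => ?_⟩
    · rw [hM]
      refine eq_of_Dt_eq (u₀ := u₀) ?_ fun y hy => ?_
      · have hw := h3 (c + (M + 1)) (by
          have : (0 : ℝ) ≤ M := Nat.cast_nonneg M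
          intro h; linarith)
        rw [Dt_eq_of_wave (hc M), hw, show c + ((M : ℝ) + 1) - 1 = c + M by ring, h4, hla,
          sub_sub_cancel, mul_smul_comm, smul_smul, inv_mul_cancel₀ (hc M), one_smul,
          rp_mul_cancel]
      · rw [h5 M le_rfl y hy, Function.update_self]
    · rw [h5 k (by omega) y hy, Function.update_of_ne]
      have : k ≠ M := by omega
      simpa using this

theorem chain_eq_zero_up {c u₀ : ℝ} (hc : ∀ k : ℕ, 2 * (c + (k + 1)) - d + 2 ≠ 0)
    {F : ℝ → Sm d} {M : ℕ} (hw : ∀ k : ℕ, M ≤ k → wave F (c + (k + 1)) = 0) (hM : F (c + M) = 0)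
    (h0 : ∀ k : ℕ, M ≤ k → ∀ y : Space d, y ≠ 0 → F (c + (k + 1)) (u₀, y) = 0) (k : ℕ)
    (hk : M ≤ k) : F (c + k) = 0 := by
  induction k, hk using Nat.le_induction with
  | base => exact hM
  | succ k hk ih =>
    push_cast
    refine eq_of_Dt_eq (u₀ := u₀) ?_ fun y hy => ?_
    · rw [Dt_eq_of_wave (hc k), hw k hk, show c + ((k : ℝ) + 1) - 1 = c + k by ring, ih]
      simp only [map_zero, sub_zero, mul_zero, smul_zero]
    · rw [h0 k hk y hy, zero_apply]

theorem chain_eq_zero_down {c : ℝ} {F : ℝ → Sm d} (hF : ∀ n, Hom (-n) (F n)) {M : ℕ}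
    (hL : ∀ k : ℕ, k < M → LapInj d (1 - (c + (k + 1))))
    (hw : ∀ k : ℕ, k < M → wave F (c + (k + 1)) = 0) (hM : F (c + M) = 0) (k : ℕ)
    (hk : k ≤ M) : F (c + k) = 0 := by
  induction M with
  | zero =>
    obtain rfl : k = 0 := by omega
    exact hM
  | succ M ih =>
    rcases hk.lt_or_eq with hk | rfl
    · refine ih (fun k hk => hL k (by omega)) (fun k hk => hw k (by omega)) ?_ (by omega)
      push_cast at hM
      have h1 := hw M (by omega)
      rw [wave, hM, map_zero, mul_zero, smul_zero, add_zero,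
        show c + ((M : ℝ) + 1) - 1 = c + M by ring] at h1
      exact hL M (by omega) _ ((hF _).congr (by ring)) h1
    · exact hM

theorem chain_eq_zero {c u₀ : ℝ} (hc : ∀ k : ℕ, 2 * (c + (k + 1)) - d + 2 ≠ 0)
    {F : ℝ → Sm d} (hF : ∀ n, Hom (-n) (F n)) {M : ℕ}
    (hL : ∀ k : ℕ, k < M → LapInj d (1 - (c + (k + 1))))
    (hw : ∀ k : ℕ, wave F (c + (k + 1)) = 0) (hM : F (c + M) = 0)
    (h0 : ∀ k : ℕ, M ≤ k → ∀ y : Space d, y ≠ 0 → F (c + (k + 1)) (u₀, y) = 0) (k : ℕ) :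
    F (c + k) = 0 := by
  rcases le_total M k with h | h
  · exact chain_eq_zero_up hc (fun k _ => hw k) hM h0 k h
  · exact chain_eq_zero_down hF hL (fun k _ => hw k) hM k h

end Sm

end

section

namespace Sm

variable {d : ℕ}

/-! ### Differential operators on the sphere in Cartesian coordinates -/

theorem hasFDerivAt_space (F : Sm d) {p : ℝ × Space d} (hp : p ∈ Om d) :
    HasFDerivAt (fun y => F (p.1, y))
      ((fderiv ℝ F p).comp (ContinuousLinearMap.inr ℝ ℝ (Space d))) p.2 := by
  have h1 : HasFDerivAt (fun y : Space d => (p.1, y)) (ContinuousLinearMap.inr ℝ ℝ (Space d)) p.2 :=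
    hasFDerivAt_prodMk_right p.1 p.2
  exact (F.differentiableAt hp).hasFDerivAt.comp p.2 h1

section

variable {κ W : Type*} [Fintype κ] [NormedAddCommGroup W] [NormedSpace ℝ W]
  {T : Sph d → W} {G : κ → Sm d} {w : κ → W} {u : ℝ}

/-- `T` is, at retarded time `u`, the combination of the vectors `w k` with coefficients `G k`. -/
def IsComb (T : Sph d → W) (G : κ → Sm d) (w : κ → W) (u : ℝ) : Prop :=
  ∀ x : Sph d, T x = ∑ k, G k (u, x) • w k

theorem radialExt_eq_sum (hG : ∀ k, Hom 0 (G k)) (h : IsComb T G w u)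
    {y : Space d} (hy : y ≠ 0) : radialExt T y = ∑ k, G k (u, y) • w k := by
  rw [radialExt, dif_neg hy, h]
  refine Finset.sum_congr rfl fun k _ => ?_
  congr 1
  have := hG k (u, y) hy ‖y‖⁻¹ (inv_pos.2 (norm_pos_iff.2 hy))
  rwa [Real.rpow_zero, one_mul] at this

theorem hasFDerivAt_radialExt (hG : ∀ k, Hom 0 (G k))
    (h : IsComb T G w u) (x : Sph d) :
    HasFDerivAt (radialExt T) (∑ k, ((fderiv ℝ (G k) (u, (x : Space d))).comp
      (ContinuousLinearMap.inr ℝ ℝ (Space d))).smulRight (w k)) (x : Space d) := by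
  have h1 : HasFDerivAt (fun y => ∑ k, G k (u, y) • w k)
      (∑ k, ((fderiv ℝ (G k) (u, (x : Space d))).comp
      (ContinuousLinearMap.inr ℝ ℝ (Space d))).smulRight (w k)) (x : Space d) :=
    HasFDerivAt.fun_sum fun k _ => (hasFDerivAt_space (G k) (coe_mem_Om u x)).smul_const (w k)
  refine h1.congr_of_eventuallyEq ?_
  filter_upwards [isOpen_ne_zero.mem_nhds (ne_zero_of_mem_unit_sphere x)] with y hy
    using radialExt_eq_sum hG h hy

theorem fderiv_radialExt_single (hG : ∀ k, Hom 0 (G k))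
    (h : IsComb T G w u) (x : Sph d) (i : Fin (d - 1)) :
    fderiv ℝ (radialExt T) (x : Space d) (EuclideanSpace.single i 1)
      = ∑ k, Dx i (G k) (u, x) • w k := by
  rw [(hasFDerivAt_radialExt hG h x).fderiv, _root_.sum_apply]
  refine Finset.sum_congr rfl fun k _ => ?_
  rw [Dx, dir_apply _ _ (coe_mem_Om u x)]
  rfl

theorem fderiv_radialExt_tangentProj (hG : ∀ k, Hom 0 (G k))
    (h : IsComb T G w u) (x : Sph d) (v : Space d) :
    fderiv ℝ (radialExt T) (x : Space d) (tangentProj x v)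
      = fderiv ℝ (radialExt T) (x : Space d) v := by
  have h0 : fderiv ℝ (radialExt T) (x : Space d) (x : Space d) = 0 := by
    rw [(hasFDerivAt_radialExt hG h x).fderiv, _root_.sum_apply]
    refine Finset.sum_eq_zero fun k _ => ?_
    have h1 := euler_apply (G k) (coe_mem_Om u x)
    rw [(hG k).euler_eq, zero_smul, zero_apply] at h1
    change fderiv ℝ (G k) (u, (x : Space d)) (0, (x : Space d)) • w k = 0
    rw [← h1, zero_smul]
  simp only [tangentProj, _root_.sub_apply, ContinuousLinearMap.id_apply,
    ContinuousLinearMap.smulRight_apply, map_sub, map_smul, h0, smul_zero, sub_zero]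

end

theorem tangentProj_apply (x : Sph d) (v : Space d) (i : Fin (d - 1)) :
    tangentProj x v i = v i - (∑ l, x.1 l * v l) * x.1 i := by
  have : inner ℝ (x : Space d) v = ∑ l, x.1 l * v l := by
    rw [PiLp.inner_apply]
    exact Finset.sum_congr rfl fun l _ => by simp [mul_comm]
  simp [tangentProj, this]

theorem Y_apply_sphere (i : Fin (d - 1)) (u : ℝ) (x : Sph d) : (Y i : Sm d) (u, x) = x.1 i :=
  Y_apply i (coe_mem_Om u x)

theorem sum_coe_mul_self (x : Sph d) : ∑ i, x.1 i * x.1 i = 1 := by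
  have h := congrArg (fun F : Sm d => F (0, (x : Space d))) (sum_Y_mul_Y (d := d))
  simpa only [sum_apply, mul_apply, Y_apply_sphere, rp_apply_sphere] using h

theorem sum_coe_mul_Dx {F : Sm d} (hF : Hom 0 F) (u : ℝ) (x : Sph d) :
    ∑ i, x.1 i * Dx i F (u, x) = 0 := by
  have h := congrArg (fun F : Sm d => F (u, (x : Space d))) hF.euler_eq
  simpa only [euler, sum_apply, mul_apply, Y_apply_sphere, zero_smul, zero_apply] using h

theorem sphGrad_apply {F : Sm d} (hF : Hom 0 F) {f : Sph d → ℝ} {u : ℝ}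
    (h : ∀ x : Sph d, f x = F (u, x)) (x : Sph d) (i : Fin (d - 1)) :
    sphGrad f x i = Dx i F (u, x) := by
  have h1 := fderiv_radialExt_single (κ := Unit) (G := fun _ => F) (w := fun _ => (1 : ℝ))
    (T := f) (u := u) (fun _ => hF) (fun x => by simp [h]) x i
  have h2 : sphGrad f x i = inner ℝ (sphGrad f x) (EuclideanSpace.single i (1 : ℝ)) := by
    simp [EuclideanSpace.inner_single_right]
  rw [h2, sphGrad, gradient, InnerProductSpace.toDual_symm_apply, h1]
  simp

theorem eq_sum_single (v : Space d) : v = ∑ k, v k • EuclideanSpace.single k (1 : ℝ) := by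
  ext j
  simp [Pi.single_apply]

theorem covDeriv_single {G : Fin (d - 1) → Sm d} (hG : ∀ i, Hom 0 (G i)) {V : Sph d → Space d}
    {u : ℝ} (h : ∀ (x : Sph d) i, V x i = G i (u, x)) (x : Sph d) (i j : Fin (d - 1)) :
    covDeriv V x (EuclideanSpace.single i 1) j
      = Dx i (G j) (u, x) - (∑ l, x.1 l * Dx i (G l) (u, x)) * x.1 j := by
  have h' : IsComb V G (fun k => EuclideanSpace.single k (1 : ℝ)) u := fun x => by
    rw [eq_sum_single (V x)]
    simp only [h]
  have h1 : ∀ l, (∑ k, Dx i (G k) (u, x) • EuclideanSpace.single k (1 : ℝ) : Space d) l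
      = Dx i (G l) (u, x) := fun l => by simp [Pi.single_apply]
  rw [covDeriv, ContinuousLinearMap.comp_apply, ContinuousLinearMap.comp_apply,
    fderiv_radialExt_tangentProj hG h', fderiv_radialExt_single hG h', tangentProj_apply]
  simp only [h1]

theorem sphDiv_eq {G : Fin (d - 1) → Sm d} (hG : ∀ i, Hom 0 (G i)) {V : Sph d → Space d}
    {u : ℝ} (h : ∀ (x : Sph d) i, V x i = G i (u, x)) (x : Sph d) :
    sphDiv V x = ∑ i, Dx i (G i) (u, x) := by
  rw [sphDiv, LinearMap.trace_eq_sum_inner _ (EuclideanSpace.basisFun (Fin (d - 1)) ℝ)]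
  have h1 : ∀ i, inner ℝ (EuclideanSpace.basisFun (Fin (d - 1)) ℝ i)
      ((covDeriv V x : Space d →ₗ[ℝ] Space d) (EuclideanSpace.basisFun (Fin (d - 1)) ℝ i))
      = Dx i (G i) (u, x) - ∑ l, x.1 l * (x.1 i * Dx i (G l) (u, x)) := fun i => by
    rw [EuclideanSpace.basisFun_apply, EuclideanSpace.inner_single_left]
    simp only [map_one, one_mul, ContinuousLinearMap.coe_coe]
    rw [covDeriv_single hG h, Finset.sum_mul]
    congr 1
    exact Finset.sum_congr rfl fun l _ => by ring
  simp only [h1, Finset.sum_sub_distrib]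
  rw [Finset.sum_comm]
  simp only [← Finset.mul_sum, sum_coe_mul_Dx (hG _), mul_zero, Finset.sum_const_zero, sub_zero]

theorem sphLap_eq {F : Sm d} (hF : Hom 0 F) {f : Sph d → ℝ} {u : ℝ}
    (h : ∀ x : Sph d, f x = F (u, x)) (x : Sph d) : sphLap f x = lap F (u, x) := by
  rw [sphLap, sphDiv_eq (G := fun i => rp 1 * Dx i F) (u := u)
    (fun i => ((hom_rp 1).mul (hF.Dx i)).congr (by ring))
    (fun x i => by rw [sphGrad_apply hF h, mul_apply, rp_apply_sphere, one_mul])]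
  have h1 : ∀ i, Dx i (rp 1 * Dx i F) (u, x) = Dx i (Dx i F) (u, x) + x.1 i * Dx i F (u, x) :=
    fun i => by
      rw [Dx_mul, Dx_rp]
      simp only [add_apply, mul_apply, smul_apply, rp_apply_sphere, Y_apply_sphere]
      ring
  simp only [h1, Finset.sum_add_distrib, sum_coe_mul_Dx hF, add_zero, lap_apply, sum_apply]

theorem sum_Y_mul_lap {G : Fin (d - 1) → Sm d} (ht : ∑ i, Y i * G i = 0) :
    ∑ i, Y i * lap (G i) = (-2 : ℝ) • ∑ i, Dx i (G i) := by
  have h1 := congrArg lap ht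
  rw [map_sum, map_zero] at h1
  have h2 : ∀ i, lap (Y i * G i) = Y i * lap (G i) + (2 : ℝ) • Dx i (G i) := fun i => by
    rw [lap_mul, lap_Y, mul_zero, add_zero]
    simp [Dx_Y]
  simp only [h2, Finset.sum_add_distrib, ← Finset.smul_sum] at h1
  rw [eq_neg_of_add_eq_zero_left h1, neg_smul]

/-- The matrix unit sending the `k`-th basis vector to the `j`-th one. -/
def matUnit (q : Fin (d - 1) × Fin (d - 1)) : Space d →L[ℝ] Space d :=
  (EuclideanSpace.proj q.2 : Space d →L[ℝ] ℝ).smulRight (EuclideanSpace.single q.1 (1 : ℝ))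

theorem sum_smul_matUnit_apply (f : Fin (d - 1) × Fin (d - 1) → ℝ) (v : Space d)
    (k : Fin (d - 1)) : (∑ q, f q • matUnit q) v k = ∑ i, f (k, i) * v i := by
  have h1 : (∑ q, f q • matUnit q) v k
      = ∑ q : Fin (d - 1) × Fin (d - 1), f q * (v q.2 * if k = q.1 then 1 else 0) := by
    rw [_root_.sum_apply, WithLp.ofLp_sum, Finset.sum_apply]
    refine Finset.sum_congr rfl fun q _ => ?_
    change f q * (v q.2 * (EuclideanSpace.single q.1 (1 : ℝ) : Space d) k) = _
    rw [PiLp.single_apply]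
  rw [h1, Fintype.sum_prod_type, Finset.sum_comm]
  simp only [mul_ite, mul_one, mul_zero, Finset.sum_ite_eq, Finset.mem_univ, if_true]

/-- The matrix entries of the covariant derivative of a tangent field. -/
def covEntry (G : Fin (d - 1) → Sm d) (q : Fin (d - 1) × Fin (d - 1)) : Sm d :=
  rp 1 * Dx q.2 (G q.1) + rp (-1) * (Y q.1 * G q.2)

theorem hom_covEntry {G : Fin (d - 1) → Sm d} (hG : ∀ i, Hom 0 (G i))
    (q : Fin (d - 1) × Fin (d - 1)) : Hom 0 (covEntry G q) :=
  (((hom_rp 1).mul ((hG _).Dx _)).congr (by ring)).add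
    (((hom_rp (-1)).mul ((hom_Y _).mul (hG _))).congr (by ring))

theorem sum_coe_mul_of_tangent {G : Fin (d - 1) → Sm d} (ht : ∑ i, Y i * G i = 0) (u : ℝ)
    (x : Sph d) : ∑ l, x.1 l * G l (u, x) = 0 := by
  simpa only [sum_apply, mul_apply, Y_apply_sphere, zero_apply] using
    congrArg (fun F : Sm d => F (u, (x : Space d))) ht

theorem covDeriv_eq {G : Fin (d - 1) → Sm d} (hG : ∀ i, Hom 0 (G i))
    (ht : ∑ i, Y i * G i = 0) {V : Sph d → Space d}
    {u : ℝ} (h : ∀ (x : Sph d) i, V x i = G i (u, x)) :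
    IsComb (covDeriv V) (covEntry G) matUnit u := by
  intro x
  have htan : ∀ i, ∑ l, x.1 l * Dx i (G l) (u, x) = -G i (u, x) := fun i => by
    have h1 := congrArg (fun F : Sm d => F (u, (x : Space d))) (congrArg (Dx i) ht)
    simp only [map_sum, Dx_mul, Dx_Y, mul_ite, mul_one, mul_zero, Finset.sum_add_distrib,
      Finset.sum_ite_eq, Finset.mem_univ, if_true, map_zero, zero_apply, add_apply, sum_apply,
      mul_apply, Y_apply_sphere] at h1
    linarith
  refine ContinuousLinearMap.ext fun v => ?_
  ext k
  have h1 : covDeriv V x v k = ∑ i, v i * covDeriv V x (EuclideanSpace.single i 1) k := by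
    conv_lhs => rw [eq_sum_single v, map_sum]
    simp
  rw [h1, sum_smul_matUnit_apply]
  refine Finset.sum_congr rfl fun i _ => ?_
  rw [covDeriv_single hG h, htan, covEntry]
  simp only [add_apply, mul_apply, rp_apply_sphere, Y_apply_sphere]
  ring

theorem sum_Dx_covEntry {G : Fin (d - 1) → Sm d} (hG : ∀ i, Hom 0 (G i))
    (ht : ∑ i, Y i * G i = 0) (u : ℝ) (x : Sph d) (j : Fin (d - 1)) :
    ∑ i, Dx i (covEntry G (j, i)) (u, x)
      = lap (G j) (u, x) + G j (u, x) + (∑ i, Dx i (G i) (u, x)) * x.1 j := by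
  have h1 : ∀ i, Dx i (covEntry G (j, i)) (u, x)
      = x.1 i * Dx i (G j) (u, x) + Dx i (Dx i (G j)) (u, x)
      - x.1 j * (x.1 i * G i (u, x)) + (if i = j then G i (u, x) else 0)
      + Dx i (G i) (u, x) * x.1 j := fun i => by
    simp only [covEntry, map_add, Dx_mul, Dx_rp, Dx_Y, add_apply, mul_apply, smul_apply,
      rp_apply_sphere, Y_apply_sphere]
    split_ifs <;> simp only [zero_apply, one_apply (coe_mem_Om u x)] <;> ring
  simp only [h1, Finset.sum_add_distrib, Finset.sum_sub_distrib, ← Finset.mul_sum,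
    ← Finset.sum_mul, sum_coe_mul_Dx (hG _), sum_coe_mul_of_tangent ht, Finset.sum_ite_eq',
    Finset.mem_univ, if_true, lap_apply, sum_apply]
  ring

theorem sphVecLap_apply {G : Fin (d - 1) → Sm d} (hG : ∀ i, Hom 0 (G i))
    (ht : ∑ i, Y i * G i = 0) {V : Sph d → Space d}
    {u : ℝ} (h : ∀ (x : Sph d) i, V x i = G i (u, x)) (x : Sph d) (j : Fin (d - 1)) :
    sphVecLap V x j
      = lap (G j) (u, x) + 2 * (∑ i, Dx i (G i) (u, x)) * x.1 j + G j (u, x) := by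
  have hCH := hom_covEntry hG
  have hcov := covDeriv_eq hG ht h
  have hD : ∀ i j, ((fderiv ℝ (radialExt (covDeriv V)) (x : Space d)
        (tangentProj x (EuclideanSpace.single i (1 : ℝ))))
      (tangentProj x (EuclideanSpace.single i (1 : ℝ)))) j
      = Dx i (covEntry G (j, i)) (u, x)
        - ∑ k, x.1 k * (x.1 i * Dx i (covEntry G (j, k)) (u, x)) := fun i j => by
    have h1 := fderiv_radialExt_tangentProj (T := covDeriv V) (w := matUnit) hCH hcov x
      (EuclideanSpace.single i (1 : ℝ))
    have h2 := fderiv_radialExt_single (T := covDeriv V) (w := matUnit) hCH hcov x i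
    rw [h1, h2, sum_smul_matUnit_apply]
    simp only [mul_ite, mul_one, mul_zero, Finset.sum_ite_eq', Finset.mem_univ,
      if_true, tangentProj_apply, PiLp.single_apply, mul_sub, Finset.sum_sub_distrib]
    congr 1
    exact Finset.sum_congr rfl fun i _ => by ring
  have hS : ∀ j, (∑ i : Fin (d - 1), (fderiv ℝ (radialExt (covDeriv V)) (x : Space d)
        (tangentProj x (EuclideanSpace.single i (1 : ℝ))))
      (tangentProj x (EuclideanSpace.single i (1 : ℝ)))) j
      = lap (G j) (u, x) + G j (u, x) + (∑ i, Dx i (G i) (u, x)) * x.1 j := fun j => by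
    rw [WithLp.ofLp_sum, Finset.sum_apply, ← sum_Dx_covEntry hG ht]
    simp only [hD, Finset.sum_sub_distrib]
    rw [Finset.sum_comm]
    simp only [← Finset.mul_sum, sum_coe_mul_Dx (hCH _), mul_zero, Finset.sum_const_zero,
      sub_zero]
  have hlap : ∑ l, x.1 l * lap (G l) (u, x) = -2 * ∑ i, Dx i (G i) (u, x) := by
    simpa only [sum_apply, smul_apply, mul_apply, Y_apply_sphere] using
      congrArg (fun F : Sm d => F (u, (x : Space d))) (sum_Y_mul_lap ht)
  rw [sphVecLap, tangentProj_apply]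
  simp only [hS, mul_add, Finset.sum_add_distrib, hlap, sum_coe_mul_of_tangent ht]
  have h1 : ∑ l, x.1 l * ((∑ i, Dx i (G i) (u, x)) * x.1 l) = ∑ i, Dx i (G i) (u, x) := by
    have : ∀ l, x.1 l * ((∑ i, Dx i (G i) (u, x)) * x.1 l)
        = (∑ i, Dx i (G i) (u, x)) * (x.1 l * x.1 l) := fun l => by ring
    simp only [this, ← Finset.mul_sum, sum_coe_mul_self, mul_one]
  rw [h1]
  ring

end Sm

end

section

namespace Sm

variable {d : ℕ}

/-! ### Cartesian components of coefficients -/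

/-- A family of functions on the sphere, as a function homogeneous of degree `0`. -/
def lift (f : ℝ → Sph d → ℝ) : Sm d := by
  classical exact
    if h : ContDiffOn ℝ ∞ (fun p : ℝ × Space d => radialExt (f p.1) p.2) (Om d) then mk _ h else 0

theorem lift_apply {f : ℝ → Sph d → ℝ}
    (h : ContDiffOn ℝ ∞ (fun p : ℝ × Space d => radialExt (f p.1) p.2) (Om d))
    {p : ℝ × Space d} (hp : p ∈ Om d) : lift f p = radialExt (f p.1) p.2 := by
  rw [lift, dif_pos h, mk_apply _ _ hp]

theorem radialExt_coe {W : Type*} [Zero W] (f : Sph d → W) (x : Sph d) :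
    radialExt f (x : Space d) = f x := by
  rw [radialExt, dif_neg (ne_zero_of_mem_unit_sphere x)]
  congr 1
  ext1
  simp

theorem lift_coe {f : ℝ → Sph d → ℝ}
    (h : ContDiffOn ℝ ∞ (fun p : ℝ × Space d => radialExt (f p.1) p.2) (Om d)) (u : ℝ)
    (x : Sph d) : lift f (u, x) = f u x := by
  rw [lift_apply h (coe_mem_Om u x), radialExt_coe]

theorem radialExt_smul_pos {W : Type*} [Zero W] (f : Sph d → W) {t : ℝ} (ht : 0 < t)
    (y : Space d) : radialExt f (t • y) = radialExt f y := by
  by_cases hy : y = 0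
  · rw [hy, smul_zero]
  · rw [radialExt, radialExt, dif_neg hy, dif_neg (smul_ne_zero ht.ne' hy)]
    congr 2
    rw [norm_smul, Real.norm_of_nonneg ht.le, mul_inv, smul_smul, mul_right_comm,
      inv_mul_cancel₀ ht.ne', one_mul]

theorem hom_lift (f : ℝ → Sph d → ℝ) : Hom 0 (lift f) := by
  by_cases h : ContDiffOn ℝ ∞ (fun p : ℝ × Space d => radialExt (f p.1) p.2) (Om d)
  · intro p hp t ht
    rw [lift_apply h hp, lift_apply h (smul_mem_Om hp ht), radialExt_smul_pos _ ht, Real.rpow_zero,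
      one_mul]
  · rw [lift, dif_neg h]
    exact Hom.zero

theorem contDiffOn_radialExt {σ : ℝ} {F : Sm d} (hF : Hom σ F) {f : ℝ → Sph d → ℝ}
    (h : ∀ u x, f u x = F (u, (x : Space d))) :
    ContDiffOn ℝ ∞ (fun p : ℝ × Space d => radialExt (f p.1) p.2) (Om d) := by
  refine (rp (-σ) * F).contDiffOn.congr fun p hp => ?_
  have hpos : 0 < ‖p.2‖ := norm_pos_iff.2 hp
  rw [mul_apply, rp_apply _ hp, apply_eq_of_hom hF hp, ← mul_assoc, ← Real.rpow_add hpos,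
    neg_add_cancel, Real.rpow_zero, one_mul, radialExt, dif_neg hp, h]

variable {a b : ℝ → Coeff d}

theorem contDiffOn_ang (ha : IsSmoothField a) (i : Fin (d - 1)) :
    ContDiffOn ℝ ∞ (fun p : ℝ × Space d => radialExt (fun x => (a p.1).ang x i) p.2) (Om d) := by
  refine (contDiffOn_euclidean.1 ha.smooth_ang i).congr fun p hp => ?_
  have hp' : p.2 ≠ 0 := hp
  rw [radialExt, radialExt, dif_neg hp', dif_neg hp']

/-- The `u`-component of a coefficient field. -/
def fu (a : ℝ → Coeff d) : Sm d := lift fun u => (a u).u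

/-- The `r`-component of a coefficient field. -/
def fr (a : ℝ → Coeff d) : Sm d := lift fun u => (a u).r

/-- The Cartesian components of the angular part of a coefficient field. -/
def fang (a : ℝ → Coeff d) (i : Fin (d - 1)) : Sm d := lift fun u x => (a u).ang x i

theorem hom_fu (a : ℝ → Coeff d) : Hom 0 (fu a) := hom_lift _

theorem hom_fr (a : ℝ → Coeff d) : Hom 0 (fr a) := hom_lift _

theorem hom_fang (a : ℝ → Coeff d) (i : Fin (d - 1)) : Hom 0 (fang a i) := hom_lift _

theorem fu_coe (ha : IsSmoothField a) (u : ℝ) (x : Sph d) : fu a (u, x) = (a u).u x :=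
  lift_coe ha.smooth_u u x

theorem fr_coe (ha : IsSmoothField a) (u : ℝ) (x : Sph d) : fr a (u, x) = (a u).r x :=
  lift_coe ha.smooth_r u x

theorem fang_coe (ha : IsSmoothField a) (i : Fin (d - 1)) (u : ℝ) (x : Sph d) :
    fang a i (u, x) = (a u).ang x i :=
  lift_coe (f := fun u x => (a u).ang x i) (contDiffOn_ang ha i) u x

theorem inner_eq_sum (x : Sph d) (v : Space d) : inner ℝ (x : Space d) v = ∑ i, x.1 i * v i := by
  rw [PiLp.inner_apply]
  exact Finset.sum_congr rfl fun l _ => by simp [mul_comm]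

theorem sum_coe_mul_ang (ha : IsSmoothField a) (u : ℝ) (x : Sph d) :
    ∑ i, x.1 i * (a u).ang x i = 0 := by
  rw [← inner_eq_sum, ha.tangent]

theorem sum_Y_mul_fang (ha : IsSmoothField a) : ∑ i, Y i * fang a i = 0 := by
  refine (Hom.sum fun i _ => (hom_Y i).mul (hom_fang a i)).ext Hom.zero fun u x => ?_
  simp only [sum_apply, mul_apply, Y_apply_sphere, fang_coe ha, zero_apply]
  exact sum_coe_mul_ang ha u x

/-- The Cartesian components of a coefficient of order `n`, with respect to the inertial
coordinates `t` and `y`. -/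
def cmp (n : ℝ) (a : ℝ → Coeff d) : Option (Fin (d - 1)) → Sm d
  | none => rp (-n) * fu a
  | some i => rp (-n) * ((fr a - fu a) * (rp (-1) * Y i) + fang a i)

theorem hom_unit (i : Fin (d - 1)) : Hom 0 (rp (-1) * Y i : Sm d) :=
  ((hom_rp (-1)).mul (hom_Y i)).congr (by ring)

theorem hom_cmp_aux (a : ℝ → Coeff d) (i : Fin (d - 1)) :
    Hom 0 ((fr a - fu a) * (rp (-1) * Y i) + fang a i) :=
  ((((hom_fr _).sub (hom_fu _)).mul (hom_unit i)).congr (by ring)).add (hom_fang _ _)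

theorem hom_cmp (n : ℝ) (a : ℝ → Coeff d) : ∀ c, Hom (-n) (cmp n a c)
  | none => ((hom_rp _).mul (hom_fu _)).congr (by ring)
  | some i => ((hom_rp _).mul (hom_cmp_aux a i)).congr (by ring)

theorem cmp_none_coe (ha : IsSmoothField a) (n u : ℝ) (x : Sph d) :
    cmp n a none (u, x) = (a u).u x := by
  rw [cmp, mul_apply, rp_apply_sphere, one_mul, fu_coe ha]

theorem cmp_some_coe (ha : IsSmoothField a) (n u : ℝ) (x : Sph d) (i : Fin (d - 1)) :
    cmp n a (some i) (u, x) = ((a u).r x - (a u).u x) * x.1 i + (a u).ang x i := by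
  simp only [cmp, mul_apply, add_apply, sub_apply, rp_apply_sphere, Y_apply_sphere, one_mul,
    fu_coe ha, fr_coe ha, fang_coe ha]

/-- The coefficient field with given Cartesian components. -/
def uncmp (F : Option (Fin (d - 1)) → Sm d) (u : ℝ) : Coeff d where
  u x := F none (u, x)
  r x := ∑ i, x.1 i * F (some i) (u, x) + F none (u, x)
  ang x := WithLp.toLp 2 fun i => F (some i) (u, x) - (∑ l, x.1 l * F (some l) (u, x)) * x.1 i

theorem uncmp_cmp (ha : IsSmoothField a) (n : ℝ) : uncmp (cmp n a) = a := by
  have h : ∀ u (x : Sph d), ∑ i, x.1 i * cmp n a (some i) (u, x) = (a u).r x - (a u).u x := by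
    intro u x
    have h1 : ∀ i, x.1 i * cmp n a (some i) (u, x)
        = ((a u).r x - (a u).u x) * (x.1 i * x.1 i) + x.1 i * (a u).ang x i := fun i => by
      rw [cmp_some_coe ha]; ring
    simp only [h1, Finset.sum_add_distrib, ← Finset.mul_sum, sum_coe_mul_self,
      sum_coe_mul_ang ha, mul_one, add_zero]
  funext u
  refine Coeff.ext (funext fun x => cmp_none_coe ha n u x) (funext fun x => ?_)
    (funext fun x => ?_)
  · simp only [uncmp, h, cmp_none_coe ha]
    ring
  · ext i
    change cmp n a (some i) (u, x) - (∑ l, x.1 l * cmp n a (some l) (u, x)) * x.1 i = _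
    rw [h, cmp_some_coe ha, add_sub_cancel_left]

theorem cmp_injective (ha : IsSmoothField a) (hb : IsSmoothField b) {n : ℝ}
    (h : cmp n a = cmp n b) : a = b := by
  rw [← uncmp_cmp ha n, h, uncmp_cmp hb]

theorem uncmp_congr {F G : Option (Fin (d - 1)) → Sm d} {u : ℝ}
    (h : ∀ c, ∀ y : Space d, y ≠ 0 → F c (u, y) = G c (u, y)) : uncmp F u = uncmp G u := by
  have h' : ∀ c (x : Sph d), F c (u, x) = G c (u, x) := fun c x =>
    h c x (ne_zero_of_mem_unit_sphere x)
  simp only [uncmp, h']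

theorem uncmp_zero : uncmp (fun _ => (0 : Sm d)) = 0 := by
  funext u
  refine Coeff.ext (funext fun x => ?_) (funext fun x => ?_) (funext fun x => ?_)
  · exact zero_apply _
  · simp only [uncmp, zero_apply, mul_zero, Finset.sum_const_zero, add_zero]
    rfl
  · ext i
    simp only [uncmp, zero_apply, mul_zero, Finset.sum_const_zero, zero_mul, sub_zero]
    rfl

theorem isSmoothField_uncmp {n : ℝ} {F : Option (Fin (d - 1)) → Sm d} (hF : ∀ c, Hom n (F c)) :
    IsSmoothField (uncmp F) := by
  have hR : Hom n (∑ i, rp (-1) * Y i * F (some i)) :=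
    Hom.sum fun i _ => ((hom_unit i).mul (hF _)).congr (by ring)
  refine ⟨fun u x => ?_, contDiffOn_radialExt (hF none) fun u x => rfl,
    contDiffOn_radialExt (f := fun u => (uncmp F u).r) (hR.add (hF none)) fun u x => ?_,
    contDiffOn_euclidean.2 fun i => ?_⟩
  · rw [inner_eq_sum]
    have h1 : ∀ i, x.1 i * (uncmp F u).ang x i = x.1 i * F (some i) (u, x)
        - (∑ l, x.1 l * F (some l) (u, x)) * (x.1 i * x.1 i) := fun i => by
      simp only [uncmp]; ring
    simp only [h1, Finset.sum_sub_distrib, ← Finset.mul_sum, sum_coe_mul_self, mul_one, sub_self]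
  · simp only [uncmp, add_apply, sum_apply, mul_apply, rp_apply_sphere, Y_apply_sphere, one_mul]
  · have h1 := contDiffOn_radialExt (f := fun u x => (uncmp F u).ang x i)
      ((hF (some i)).sub ((hR.mul (hom_unit i)).congr (by ring))) fun u x => by
        simp only [uncmp, sub_apply, sum_apply, mul_apply, rp_apply_sphere, Y_apply_sphere, one_mul]
    refine h1.congr fun p hp => ?_
    have hp' : p.2 ≠ 0 := hp
    rw [radialExt, radialExt, dif_neg hp', dif_neg hp']

theorem cmp_uncmp {n : ℝ} {F : Option (Fin (d - 1)) → Sm d} (hF : ∀ c, Hom (-n) (F c)) :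
    cmp n (uncmp F) = F := by
  have hs := isSmoothField_uncmp hF
  funext c
  refine (hom_cmp n _ c).ext (hF c) fun u x => ?_
  cases c with
  | none => exact cmp_none_coe hs n u x
  | some i =>
    rw [cmp_some_coe hs]
    simp only [uncmp]
    ring

theorem isSmoothField_zero : IsSmoothField (0 : ℝ → Coeff d) := by
  rw [← uncmp_zero]
  exact isSmoothField_uncmp (n := 0) fun _ => Hom.zero

theorem cmp_zero (n : ℝ) : cmp n (0 : ℝ → Coeff d) = fun _ => 0 := by
  rw [← uncmp_zero]
  exact cmp_uncmp fun _ => Hom.zero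

theorem cmp_congr (ha : IsSmoothField a) (hb : IsSmoothField b) (n : ℝ) {u : ℝ} (h : a u = b u)
    (c : Option (Fin (d - 1))) {y : Space d} (hy : y ≠ 0) :
    cmp n a c (u, y) = cmp n b c (u, y) := by
  rw [apply_eq_of_hom (hom_cmp n a c) (p := (u, y)) hy,
    apply_eq_of_hom (hom_cmp n b c) (p := (u, y)) hy]
  congr 1
  have hx : ‖y‖⁻¹ • y ∈ Metric.sphere (0 : Space d) 1 := by
    rw [mem_sphere_zero_iff_norm, norm_smul, norm_inv, norm_norm,
      inv_mul_cancel₀ (norm_ne_zero_iff.2 hy)]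
  cases c with
  | none =>
    have h1 := cmp_none_coe ha n u ⟨_, hx⟩
    have h2 := cmp_none_coe hb n u ⟨_, hx⟩
    rw [h, ← h2] at h1
    exact h1
  | some i =>
    have h1 := cmp_some_coe ha n u ⟨_, hx⟩ i
    have h2 := cmp_some_coe hb n u ⟨_, hx⟩ i
    rw [h, ← h2] at h1
    exact h1

theorem isSmoothField_const {s : Coeff d} (hs : s.IsSmooth) : IsSmoothField fun _ => s where
  tangent _ x := hs.tangent x
  smooth_u := hs.smooth_u.comp contDiffOn_snd fun _ hp => hp
  smooth_r := hs.smooth_r.comp contDiffOn_snd fun _ hp => hp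
  smooth_ang := hs.smooth_ang.comp contDiffOn_snd fun _ hp => hp

theorem deriv_u (ha : IsSmoothField a) (u : ℝ) (x : Sph d) :
    deriv (fun v => (a v).u x) u = Dt (fu a) (u, x) := by
  simp only [← fu_coe ha]
  exact (hasDerivAt_time (fu a) (coe_mem_Om u x)).deriv

theorem deriv_r (ha : IsSmoothField a) (u : ℝ) (x : Sph d) :
    deriv (fun v => (a v).r x) u = Dt (fr a) (u, x) := by
  simp only [← fr_coe ha]
  exact (hasDerivAt_time (fr a) (coe_mem_Om u x)).deriv

theorem deriv_ang (ha : IsSmoothField a) (u : ℝ) (x : Sph d) (i : Fin (d - 1)) :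
    deriv (fun v => (a v).ang x) u i = Dt (fang a i) (u, x) := by
  have h1 : HasDerivAt (fun v => ∑ k, fang a k (v, x) • EuclideanSpace.single k (1 : ℝ))
      (∑ k, Dt (fang a k) (u, x) • EuclideanSpace.single k (1 : ℝ)) u :=
    HasDerivAt.fun_sum fun k _ => (hasDerivAt_time (fang a k) (coe_mem_Om u x)).smul_const _
  have h2 : (fun v => (a v).ang x)
      = fun v => ∑ k, fang a k (v, x) • EuclideanSpace.single k (1 : ℝ) := by
    funext v
    rw [eq_sum_single ((a v).ang x)]
    simp only [fang_coe ha]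
  rw [h2, h1.deriv]
  simp [Pi.single_apply]

/-! ### The wave equation and the divergence in components -/

theorem lap_order {G : Sm d} (hd : 1 ≤ d) (hG : Hom 0 G) (n u : ℝ) (x : Sph d) :
    lap (rp (-(n - 1)) * G) (u, x) = lap G (u, x) + (n - 1) * (n - d + 2) * G (u, x) := by
  rw [lap_rp_mul hG]
  simp only [add_apply, smul_apply, mul_apply, rp_apply_sphere]
  rw [Nat.cast_sub hd, Nat.cast_one]
  ring

variable {A : Expansion d}

theorem wave_none (hd : 1 ≤ d) (hA : ∀ n, IsSmoothField (A n)) (n u : ℝ) (x : Sph d) :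
    wave (fun m => cmp m (A m) none) n (u, x)
      = sphLap (A (n - 1) u).u x + (n - 1) * (n - d + 2) * (A (n - 1) u).u x
      + (2 * n - d + 2) * deriv (fun v => (A n v).u x) u := by
  rw [deriv_u (hA n), sphLap_eq (hom_fu _) (fun x => (fu_coe (hA (n - 1)) u x).symm),
    ← fu_coe (hA (n - 1))]
  simp only [wave, cmp, Dt_mul, Dt_rp, mul_zero, add_zero]
  rw [add_apply, lap_order hd (hom_fu _), smul_apply]
  simp only [mul_apply, rp_apply_sphere, one_mul]

theorem lap_radial_part {G : Sm d} (hd : 1 ≤ d) (hG : Hom 0 G) (i : Fin (d - 1)) (u : ℝ)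
    (x : Sph d) : lap (G * (rp (-1) * Y i)) (u, x)
      = (lap G (u, x) - (d - 2) * G (u, x)) * x.1 i + 2 * Dx i G (u, x) := by
  have h1 : ∑ k, Dx k G (u, x) * Dx k (rp (-1) * Y i) (u, x) = Dx i G (u, x) := by
    have h2 : ∀ k, Dx k G (u, x) * Dx k (rp (-1) * Y i) (u, x)
        = (if k = i then Dx k G (u, x) else 0) - x.1 i * (x.1 k * Dx k G (u, x)) := fun k => by
      rw [Dx_unit]
      simp only [sub_apply, mul_apply, rp_apply_sphere, Y_apply_sphere]
      split_ifs <;> simp only [rp_apply_sphere, zero_apply] <;> ring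
    simp only [h2, Finset.sum_sub_distrib, ← Finset.mul_sum, sum_coe_mul_Dx hG,
      Finset.sum_ite_eq', Finset.mem_univ, if_true, mul_zero, sub_zero]
  rw [lap_mul, lap_unit]
  simp only [add_apply, smul_apply, mul_apply, rp_apply_sphere, Y_apply_sphere, sum_apply, h1]
  rw [Nat.cast_sub hd, Nat.cast_one]
  ring

theorem wave_some (hd : 1 ≤ d) (hA : ∀ n, IsSmoothField (A n)) (n u : ℝ) (x : Sph d)
    (i : Fin (d - 1)) : wave (fun m => cmp m (A m) (some i)) n (u, x)
      = ((sphLap (A (n - 1) u).r x + n * (n - d + 1) * (A (n - 1) u).r x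
      + ((d : ℝ) - 2) * (A (n - 1) u).u x
      + (2 * n - d + 2) * deriv (fun v => (A n v).r x) u
      - 2 * sphDiv (A (n - 1) u).ang x)
      - (sphLap (A (n - 1) u).u x + (n - 1) * (n - d + 2) * (A (n - 1) u).u x
      + (2 * n - d + 2) * deriv (fun v => (A n v).u x) u)) * x.1 i
      + (sphVecLap (A (n - 1) u).ang x + ((n - 1) * (n - d + 2) - 1) • (A (n - 1) u).ang x
      - (2 : ℝ) • (sphGrad (A (n - 1) u).u x - sphGrad (A (n - 1) u).r x)
      + (2 * n - d + 2) • deriv (fun v => (A n v).ang x) u) i := by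
  have hu := fun x => (fu_coe (hA (n - 1)) u x).symm
  have hr := fun x => (fr_coe (hA (n - 1)) u x).symm
  have ha := fun x i => (fang_coe (hA (n - 1)) i u x).symm
  simp only [PiLp.add_apply, PiLp.sub_apply, PiLp.smul_apply, smul_eq_mul]
  rw [deriv_u (hA n), deriv_r (hA n), deriv_ang (hA n), sphLap_eq (hom_fu _) hu,
    sphLap_eq (hom_fr _) hr, sphDiv_eq (hom_fang _) ha,
    sphVecLap_apply (hom_fang _) (sum_Y_mul_fang (hA (n - 1))) ha,
    sphGrad_apply (hom_fu _) hu, sphGrad_apply (hom_fr _) hr, hu, hr, ha]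
  simp only [wave, cmp, Dt_mul, Dt_rp, Dt_Y, map_add, map_sub, mul_zero, add_zero]
  rw [add_apply, lap_order hd (hom_cmp_aux _ i), smul_apply, map_add, add_apply,
    lap_radial_part hd ((hom_fr _).sub (hom_fu _))]
  simp only [add_apply, sub_apply, mul_apply, map_sub, rp_apply_sphere, Y_apply_sphere, zero_apply]
  ring

theorem cdiv_coe (hd : 1 ≤ d) (hA : ∀ n, IsSmoothField (A n)) (n u : ℝ) (x : Sph d) :
    cdiv (fun m => cmp m (A m)) n (u, x) = divergence A n u x := by
  have ha := fun x i => (fang_coe (hA (n - 1)) i u x).symm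
  rw [divergence, deriv_r (hA n), sphDiv_eq (hom_fang _) ha, ← fu_coe (hA (n - 1)),
    ← fr_coe (hA (n - 1))]
  have htn : ∑ l, x.1 l * fang (A (n - 1)) l (u, x) = 0 :=
    sum_coe_mul_of_tangent (sum_Y_mul_fang (hA (n - 1))) u x
  have htd : ∑ l, x.1 l * Dt (fang (A n) l) (u, x) = 0 := by
    have h1 := congrArg (fun F : Sm d => F (u, (x : Space d)))
      (congrArg Dt (sum_Y_mul_fang (hA n)))
    simpa only [map_sum, Dt_mul, Dt_Y, mul_zero, add_zero, sum_apply, mul_apply, Y_apply_sphere,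
      map_zero, zero_apply] using h1
  have hs := sum_coe_mul_self x
  set W := fr (A (n - 1)) - fu (A (n - 1)) with hW
  have hWH : Hom 0 W := (hom_fr _).sub (hom_fu _)
  have h1 : ∀ i, Dx i (rp (-(n - 1)) * (W * (rp (-1) * Y i) + fang (A (n - 1)) i)) (u, x)
      = -n * (W (u, x) * (x.1 i * x.1 i)) - (n - 1) * (x.1 i * fang (A (n - 1)) i (u, x))
        + x.1 i * Dx i W (u, x) + W (u, x) + Dx i (fang (A (n - 1)) i) (u, x) := fun i => by
    simp only [Dx_mul, Dx_rp, Dx_Y, map_add, add_apply, mul_apply, smul_apply, rp_apply_sphere,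
      Y_apply_sphere, if_true, one_apply (coe_mem_Om u x)]
    ring
  have h2 : ∀ i, (rp (-1) * Y i * Dt (rp (-n) * ((fr (A n) - fu (A n)) * (rp (-1) * Y i)
      + fang (A n) i)) : Sm d) (u, x) = (Dt (fr (A n)) (u, x) - Dt (fu (A n)) (u, x)) * (x.1 i * x.1 i)
        + x.1 i * Dt (fang (A n) i) (u, x) := fun i => by
    simp only [Dt_mul, Dt_rp, Dt_Y, map_add, map_sub, mul_zero, add_zero, add_apply, mul_apply,
      sub_apply, rp_apply_sphere, Y_apply_sphere, zero_apply]
    ring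
  simp only [cdiv, cmp, sub_apply, sum_apply, ← hW, h1, h2, Finset.sum_add_distrib,
    Finset.sum_sub_distrib, ← Finset.mul_sum, hs, htn, htd, sum_coe_mul_Dx hWH]
  simp only [Dt_mul, Dt_rp, mul_zero, add_zero, mul_apply, rp_apply_sphere, Finset.sum_const,
    Finset.card_univ, Fintype.card_fin, nsmul_eq_mul]
  rw [Nat.cast_sub hd, Nat.cast_one, hW, sub_apply]
  ring

end Sm

end

section

namespace Sm

variable {d : ℕ} {j A : Expansion d}

/-! ### Recursion relations, Lorenz condition and constraints -/

/-- The Cartesian components of an expansion. -/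
def comps (A : Expansion d) (n : ℝ) : Option (Fin (d - 1)) → Sm d := cmp n (A n)

theorem hom_comps (A : Expansion d) (n : ℝ) (c : Option (Fin (d - 1))) : Hom (-n) (comps A n c) :=
  hom_cmp n (A n) c

theorem sum_coe_mul_smooth_ang {a : ℝ → Coeff d} (ha : IsSmoothField a) (u : ℝ) (x : Sph d) :
    ∑ i, x.1 i * (sphVecLap (a u).ang x) i = 0
      ∧ ∑ i, x.1 i * (sphGrad (a u).u x) i = 0 ∧ ∑ i, x.1 i * (sphGrad (a u).r x) i = 0
      ∧ ∑ i, x.1 i * (deriv (fun v => (a v).ang x) u) i = 0 := by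
  refine ⟨?_, ?_, ?_, ?_⟩
  · have h : ∀ v : Space d, ∑ i, x.1 i * (tangentProj x v) i = 0 := fun v => by
      simp only [tangentProj_apply, mul_sub, Finset.sum_sub_distrib]
      have h1 : ∀ i, x.1 i * ((∑ l, x.1 l * v l) * x.1 i)
          = (∑ l, x.1 l * v l) * (x.1 i * x.1 i) := fun i => by ring
      simp only [h1, ← Finset.mul_sum, sum_coe_mul_self, mul_one, sub_self]
    exact h _
  · simp only [sphGrad_apply (hom_fu a) fun x => (fu_coe ha u x).symm]
    exact sum_coe_mul_Dx (hom_fu a) u x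
  · simp only [sphGrad_apply (hom_fr a) fun x => (fr_coe ha u x).symm]
    exact sum_coe_mul_Dx (hom_fr a) u x
  · simp only [deriv_ang ha]
    have h1 := congrArg (fun F : Sm d => F (u, (x : Space d))) (congrArg Dt (sum_Y_mul_fang ha))
    simpa only [map_sum, Dt_mul, Dt_Y, mul_zero, add_zero, sum_apply, mul_apply, Y_apply_sphere,
      map_zero, zero_apply] using h1

theorem wave_comps (hd : 1 ≤ d) (hj : ∀ n, IsSmoothField (j n)) (hA : IsRecursionSolution j A)
    (n : ℝ) (c : Option (Fin (d - 1))) :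
    wave (fun m => comps A m c) n = (-4 * Real.pi) • comps j (n + 1) c := by
  refine (hom_wave (fun m => hom_comps A m c) n).ext
    (((hom_comps j (n + 1) c).smul _).congr (by ring)) fun u x => ?_
  rw [smul_apply]
  cases c with
  | none =>
    refine (wave_none hd hA.smooth n u x).trans ?_
    rw [hA.rec_u, comps, cmp_none_coe (hj _)]
  | some i =>
    refine (wave_some hd hA.smooth n u x i).trans ?_
    rw [hA.rec_u, hA.rec_r, hA.rec_ang, comps, cmp_some_coe (hj _), PiLp.smul_apply, smul_eq_mul]
    ring

theorem isRecursionSolution_of_wave (hd : 1 ≤ d) (hj : ∀ n, IsSmoothField (j n))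
    (hA : ∀ n, IsSmoothField (A n)) (hA0 : ∀ n, n ∉ orders d → A n = 0)
    (hw : ∀ n c, wave (fun m => comps A m c) n = (-4 * Real.pi) • comps j (n + 1) c) :
    IsRecursionSolution j A := by
  have hu : ∀ (n u : ℝ) (x : Sph d), sphLap (A (n - 1) u).u x
      + (n - 1) * (n - d + 2) * (A (n - 1) u).u x + (2 * n - d + 2) * deriv (fun v => (A n v).u x) u
      = -4 * Real.pi * (j (n + 1) u).u x := fun n u x => by
    have h1 := congrArg (fun F : Sm d => F (u, (x : Space d))) (hw n none)
    simp only [smul_apply, comps, cmp_none_coe (hj _)] at h1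
    exact (wave_none hd hA n u x).symm.trans h1
  have hs : ∀ (n u : ℝ) (x : Sph d) (i : Fin (d - 1)),
      ((sphLap (A (n - 1) u).r x + n * (n - d + 1) * (A (n - 1) u).r x
      + ((d : ℝ) - 2) * (A (n - 1) u).u x + (2 * n - d + 2) * deriv (fun v => (A n v).r x) u
      - 2 * sphDiv (A (n - 1) u).ang x) - -4 * Real.pi * (j (n + 1) u).r x) * x.1 i
      + (sphVecLap (A (n - 1) u).ang x + ((n - 1) * (n - d + 2) - 1) • (A (n - 1) u).ang x
      - (2 : ℝ) • (sphGrad (A (n - 1) u).u x - sphGrad (A (n - 1) u).r x)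
      + (2 * n - d + 2) • deriv (fun v => (A n v).ang x) u
      - (-4 * Real.pi) • (j (n + 1) u).ang x) i = 0 := fun n u x i => by
    have h1 := congrArg (fun F : Sm d => F (u, (x : Space d))) (hw n (some i))
    simp only [smul_apply, comps, cmp_some_coe (hj _)] at h1
    have h2 := (wave_some hd hA n u x i).symm.trans h1
    rw [hu] at h2
    have h3 : ((-4 * Real.pi) • (j (n + 1) u).ang x) i = -4 * Real.pi * (j (n + 1) u).ang x i := rfl
    rw [PiLp.sub_apply, h3]
    linear_combination h2
  have hr : ∀ (n u : ℝ) (x : Sph d), sphLap (A (n - 1) u).r x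
      + n * (n - d + 1) * (A (n - 1) u).r x + ((d : ℝ) - 2) * (A (n - 1) u).u x
      + (2 * n - d + 2) * deriv (fun v => (A n v).r x) u - 2 * sphDiv (A (n - 1) u).ang x
      = -4 * Real.pi * (j (n + 1) u).r x := fun n u x => by
    obtain ⟨t1, t2, t3, -⟩ := sum_coe_mul_smooth_ang (hA (n - 1)) u x
    obtain ⟨-, -, -, t4⟩ := sum_coe_mul_smooth_ang (hA n) u x
    have t5 := sum_coe_mul_ang (hA (n - 1)) u x
    have t6 := sum_coe_mul_ang (hj (n + 1)) u x
    set E := sphLap (A (n - 1) u).r x + n * (n - d + 1) * (A (n - 1) u).r x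
      + ((d : ℝ) - 2) * (A (n - 1) u).u x + (2 * n - d + 2) * deriv (fun v => (A n v).r x) u
      - 2 * sphDiv (A (n - 1) u).ang x
    have h1 : ∑ i, (E - -4 * Real.pi * (j (n + 1) u).r x) * (x.1 i * x.1 i) + ∑ i, x.1 i
        * (sphVecLap (A (n - 1) u).ang x + ((n - 1) * (n - d + 2) - 1) • (A (n - 1) u).ang x
      - (2 : ℝ) • (sphGrad (A (n - 1) u).u x - sphGrad (A (n - 1) u).r x)
      + (2 * n - d + 2) • deriv (fun v => (A n v).ang x) u
      - (-4 * Real.pi) • (j (n + 1) u).ang x) i = 0 := by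
      rw [← Finset.sum_add_distrib]
      refine Finset.sum_eq_zero fun i _ => ?_
      linear_combination x.1 i * hs n u x i
    have h2 : ∀ i, x.1 i
        * (sphVecLap (A (n - 1) u).ang x + ((n - 1) * (n - d + 2) - 1) • (A (n - 1) u).ang x
      - (2 : ℝ) • (sphGrad (A (n - 1) u).u x - sphGrad (A (n - 1) u).r x)
      + (2 * n - d + 2) • deriv (fun v => (A n v).ang x) u
      - (-4 * Real.pi) • (j (n + 1) u).ang x) i
      = x.1 i * (sphVecLap (A (n - 1) u).ang x) i
        + ((n - 1) * (n - d + 2) - 1) * (x.1 i * (A (n - 1) u).ang x i)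
        - 2 * (x.1 i * (sphGrad (A (n - 1) u).u x) i)
        + 2 * (x.1 i * (sphGrad (A (n - 1) u).r x) i)
        + (2 * n - d + 2) * (x.1 i * (deriv (fun v => (A n v).ang x) u) i)
        - (-4 * Real.pi) * (x.1 i * (j (n + 1) u).ang x i) := fun i => by
      simp only [PiLp.sub_apply, PiLp.add_apply, PiLp.smul_apply, smul_eq_mul]
      ring
    simp only [h2, Finset.sum_add_distrib, Finset.sum_sub_distrib, ← Finset.mul_sum, t1, t2, t3,
      t4, t5, t6, sum_coe_mul_self] at h1
    linarith
  refine ⟨hA, hA0, hu, hr, fun n u x => ?_⟩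
  ext i
  have h1 := hs n u x i
  rw [hr, sub_self, zero_mul, zero_add, PiLp.sub_apply] at h1
  exact sub_eq_zero.1 h1

theorem cdiv_eq_zero_of_divergence (hd : 1 ≤ d) (hA : ∀ n, IsSmoothField (A n)) {n : ℝ}
    (h : ∀ u x, divergence A n u x = 0) : cdiv (comps A) n = 0 := by
  refine (hom_cdiv (hom_comps A) n).ext Hom.zero fun u x => ?_
  rw [zero_apply, ← h u x]
  exact cdiv_coe hd hA n u x

theorem divergence_eq_zero_of_cdiv (hd : 1 ≤ d) (hA : ∀ n, IsSmoothField (A n)) {n : ℝ}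
    (h : cdiv (comps A) n = 0) (u : ℝ) (x : Sph d) : divergence A n u x = 0 := by
  rw [← cdiv_coe hd hA n u x]
  change cdiv (comps A) n (u, x) = 0
  rw [h, zero_apply]

theorem wave_cdiv_comps (hd : 1 ≤ d) (hj : IsCurrent j) (hA : IsRecursionSolution j A) (n : ℝ) :
    wave (cdiv (comps A)) n = 0 :=
  wave_cdiv hd (hom_comps A) (wave_comps hd hj.smooth hA)
    (fun n => cdiv_eq_zero_of_divergence hd hj.smooth (hj.conserved n)) n

theorem constraint_iff (hd : 1 ≤ d) (hA : IsRecursionSolution j A) (n u : ℝ)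
    (hn : 2 * n - d + 4 ≠ 0) : Constraint n (A n u) (j (n + 2) u).r
      ↔ ∀ x : Sph d, cdiv (comps A) (n + 1) (u, x) = 0 := by
  refine forall_congr' fun x => ?_
  have h1 : cdiv (comps A) (n + 1) (u, x) = divergence A (n + 1) u x :=
    cdiv_coe hd hA.smooth _ u x
  have h2 := hA.rec_r (n + 1) u x
  rw [h1, divergence]
  rw [show n + 1 - 1 = n by ring] at h2 ⊢
  rw [show n + 1 + 1 = n + 2 by ring] at h2
  have h3 : sphLap (A n u).r x - (n - d + 2) * (n - d + 3) * (A n u).r x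
      + (2 * n - d + 2) * (n - d + 3) * (A n u).u x
      + (2 * n - d + 2) * sphDiv (A n u).ang x - -4 * Real.pi * (j (n + 2) u).r x
      = (2 * n - d + 4) * (sphDiv (A n u).ang x + ((d : ℝ) - (n + 1) - 1)
        * ((A n u).r x - (A n u).u x) - deriv (fun v => (A (n + 1) v).r x) u) := by
    linear_combination h2
  rw [← sub_eq_zero, h3, mul_eq_zero, or_iff_right hn]

end Sm

end

section

open MeasureTheory

namespace Sm

variable {d : ℕ} {j A : Expansion d}

/-! ### Means over the sphere and charge conservation -/

theorem integral_polar (hd : 2 ≤ d) (g : ℝ → ℝ) (f : Sph d → ℝ) :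
    ∫ z : Space d, g ‖z‖ * radialExt f z
      = (∫ x, f x ∂(volume : Measure (Space d)).toSphere)
        * ∫ r : Set.Ioi (0 : ℝ), g r ∂Measure.volumeIoiPow (Module.finrank ℝ (Space d) - 1) := by
  have : Nonempty (Fin (d - 1)) := ⟨⟨0, by omega⟩⟩
  calc ∫ z : Space d, g ‖z‖ * radialExt f z
      = ∫ z : ({(0 : Space d)}ᶜ : Set (Space d)), g ‖z.1‖ * radialExt f z.1
          ∂((volume : Measure (Space d)).comap (↑)) := by
        rw [integral_subtype_comap (measurableSet_singleton _).compl
          fun z : Space d => g ‖z‖ * radialExt f z, restrict_compl_singleton]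
    _ = ∫ p : Sph d × Set.Ioi (0 : ℝ), f p.1 * g p.2 ∂((volume : Measure (Space d)).toSphere.prod
          (Measure.volumeIoiPow (Module.finrank ℝ (Space d) - 1))) := by
        rw [← (volume : Measure (Space d)).measurePreserving_homeomorphUnitSphereProd.integral_comp
          (Homeomorph.measurableEmbedding _) (fun p : Sph d × Set.Ioi (0 : ℝ) => f p.1 * g p.2)]
        refine integral_congr_ae (Filter.Eventually.of_forall fun z => ?_)
        have hz : (z : Space d) ≠ 0 := z.2
        have h1 : ((homeomorphUnitSphereProd (Space d) z).2 : ℝ) = ‖(z : Space d)‖ := by simp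
        have h2 : radialExt f (z : Space d) = f (homeomorphUnitSphereProd (Space d) z).1 := by
          rw [radialExt, dif_neg hz]
          congr 1
          ext1
          simp
        simp only [h1, h2]
        ring
    _ = _ := integral_prod_mul f fun r : Set.Ioi (0 : ℝ) => g r

theorem shellInt_eq_monopole (hd : 2 ≤ d) {F : Sm d} (hF : Hom 0 F) {f : Sph d → ℝ} {u : ℝ}
    (h : ∀ x : Sph d, f x = F (u, x)) :
    shellInt F u = monopole f * ∫ z : Space d, wt z := by
  have : Nonempty (Fin (d - 1)) := ⟨⟨0, by omega⟩⟩
  have h1 : ∀ z : Space d, wt z * F (u, z) = radialBump ‖z‖ * radialExt f z := fun z => by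
    by_cases hz : z = 0
    · rw [wt_eq_zero (fun h => shell_subset h hz), zero_mul, radialExt, dif_pos hz, mul_zero]
    · rw [radialExt_eq_sum (κ := Unit) (G := fun _ => F) (w := fun _ => (1 : ℝ)) (u := u)
        (fun _ => hF) (fun x => by simp [h]) hz, wt]
      simp
  have h2 : ∀ z : Space d, wt z = radialBump ‖z‖ * radialExt (fun _ : Sph d => (1 : ℝ)) z :=
    fun z => by
      by_cases hz : z = 0
      · rw [wt_eq_zero (fun h => shell_subset h hz), radialExt, dif_pos hz, mul_zero]
      · rw [radialExt, dif_neg hz, mul_one, wt]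
  rw [shellInt]
  simp only [h1]
  conv_rhs => enter [2, 2, z]; rw [h2 z]
  rw [integral_polar hd, integral_polar hd, monopole, average_eq, integral_const, smul_eq_mul,
    smul_eq_mul, mul_one]
  have h3 : (volume : Measure (Space d)).toSphere.real Set.univ ≠ 0 := by
    rw [Measure.real, ENNReal.toReal_ne_zero]
    refine ⟨?_, measure_ne_top _ _⟩
    rw [Measure.measure_univ_ne_zero]
    intro h0
    have := Measure.toSphere_real_apply_univ (volume : Measure (Space d))
    rw [h0] at this
    have hb : 0 < (volume : Measure (Space d)).real (Metric.ball 0 1) :=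
      ENNReal.toReal_pos (Metric.measure_ball_pos _ _ one_pos).ne' (measure_ball_lt_top).ne
    have hp : (0 : ℝ) < Module.finrank ℝ (Space d) := by exact_mod_cast Module.finrank_pos
    have : (0 : ℝ) < 0 := by
      calc (0 : ℝ) < _ := mul_pos hp hb
        _ = 0 := by simpa using this.symm
    exact lt_irrefl _ this
  field_simp

theorem integral_wt_pos (hd : 2 ≤ d) : 0 < ∫ z : Space d, wt z := by
  rw [integral_pos_iff_support_of_nonneg (fun z => wt_nonneg z) integrable_wt]
  refine (continuous_wt.isOpen_support).measure_pos _
    ⟨(3 / 2 : ℝ) • EuclideanSpace.single ⟨0, by omega⟩ (1 : ℝ), ?_⟩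
  exact (wt_pos (by rw [norm_smul]; simp)).ne'

theorem sphArea_pos (hd : 2 ≤ d) : 0 < sphArea d := by
  have : (2 : ℝ) ≤ d := by exact_mod_cast hd
  have := Real.Gamma_pos_of_pos (s := ((d : ℝ) - 1) / 2) (by linarith)
  rw [sphArea]
  positivity

theorem shellInt_of_chargeConservation (hd : 2 ≤ d) {a s : ℝ → Coeff d}
    (ha : IsSmoothField a) (hs : IsSmoothField s) (hjs : j ((d : ℝ) - 2) = s)
    (hQ : ChargeConservation j a) (u : ℝ) :
    shellInt (Dt (fr a)) u + ((d : ℝ) - 4) * shellInt (Dt (fu a)) u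
      = -(4 * Real.pi) * shellInt (fu s) u := by
  have hC := integral_wt_pos hd
  have hS := sphArea_pos hd
  set C := ∫ z : Space d, wt z with hCd
  have h1 : ∀ v, charge (a v) = sphArea d / (4 * Real.pi) * (C⁻¹ *
      shellInt (fr a + ((d : ℝ) - 4) • fu a) v) := fun v => by
    rw [shellInt_eq_monopole hd ((hom_fr a).add ((hom_fu a).smul _))
      (f := fun x => (a v).r x + ((d : ℝ) - 4) * (a v).u x) (u := v)
      (fun x => by rw [add_apply, smul_apply, fr_coe ha, fu_coe ha]), charge, ← hCd]
    field_simp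
  have h2 := (hasDerivAt_shellInt (fr a + ((d : ℝ) - 4) • fu a) u).const_mul C⁻¹ |>.const_mul
    (sphArea d / (4 * Real.pi))
  have h3 := hQ u
  simp only [h1] at h3
  have h4 := h3.unique h2
  rw [map_add, Dt_smul, shellInt_add, shellInt_smul] at h4
  have h5 := shellInt_eq_monopole hd (hom_fu s) (f := (s u).u) (u := u)
    (fun x => (fu_coe hs u x).symm)
  rw [hjs] at h4
  rw [h5]
  have hpi := Real.pi_pos
  field_simp at h4
  linarith

theorem current_r_eq_zero (hj : IsCurrent j) (u : ℝ) : (j ((d : ℝ) - 2) u).r = 0 := by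
  funext x
  have h0 : j ((d : ℝ) - 2 - 1) = 0 := hj.ansatz _ fun ⟨k, hk⟩ => by
    have : (0 : ℝ) ≤ k := Nat.cast_nonneg k
    linarith
  have h1 : ∀ v, HasDerivAt (fun v => (j ((d : ℝ) - 2) v).r x) 0 v := fun v => by
    have h2 := hj.conserved ((d : ℝ) - 2) v x
    have h3 : sphDiv ((0 : ℝ → Coeff d) v).ang x = 0 := by
      rw [sphDiv_eq (fun i => hom_fang (0 : ℝ → Coeff d) i)
        (fun x i => (fang_coe isSmoothField_zero i v x).symm)]
      refine Finset.sum_eq_zero fun i _ => ?_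
      have : fang (0 : ℝ → Coeff d) i = 0 := (hom_fang _ _).ext Hom.zero fun u x => by
        rw [fang_coe isSmoothField_zero, zero_apply]; rfl
      rw [this, map_zero, zero_apply]
    rw [divergence, h0, h3] at h2
    have h4 : ((0 : ℝ → Coeff d) v).r x - ((0 : ℝ → Coeff d) v).u x = 0 := sub_self 0
    rw [h4, mul_zero, add_zero, zero_sub, neg_eq_zero] at h2
    rw [deriv_r (hj.smooth _)] at h2
    simp only [← fr_coe (hj.smooth ((d : ℝ) - 2))]
    rw [← h2]
    exact hasDerivAt_time _ (coe_mem_Om v x)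
  have h5 : ∀ v, (j ((d : ℝ) - 2) v).r x = (j ((d : ℝ) - 2) u).r x := fun v =>
    is_const_of_deriv_eq_zero (fun v => (h1 v).differentiableAt) (fun v => (h1 v).deriv) v u
  have h6 := hj.decay_r x
  simp only [h5] at h6
  exact tendsto_nhds_unique tendsto_const_nhds h6

theorem cdiv_coulomb_eq_zero (hd : 4 ≤ d) (hj : IsCurrent j) (hA : IsRecursionSolution j A)
    (hQ : ChargeConservation j (A ((d : ℝ) - 3)))
    (h : cdiv (comps A) ((d : ℝ) - 2) = 0) : cdiv (comps A) ((d : ℝ) - 3) = 0 := by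
  have hd4 : (4 : ℝ) ≤ d := by exact_mod_cast hd
  have hN : ((d - 1 : ℕ) : ℝ) = d - 1 := by rw [Nat.cast_sub (by omega), Nat.cast_one]
  set a := A ((d : ℝ) - 3) with ha
  set a' := A ((d : ℝ) - 3 - 1) with ha'
  have hs : IsSmoothField a := hA.smooth _
  have hs' : IsSmoothField a' := hA.smooth _
  have hjs := hj.smooth ((d : ℝ) - 2)
  set Ψ := rp ((d : ℝ) - 3) * cdiv (comps A) ((d : ℝ) - 3) with hΨ
  set D : Sm d := ∑ i, Dx i (rp 1 * fang a' i) with hD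
  have hDH : Hom 0 D := Hom.sum fun i _ =>
    (((hom_rp 1).mul (hom_fang a' i)).Dx i).congr (by ring)
  have hΨH : Hom 0 Ψ :=
    ((hom_rp _).mul (hom_cdiv (hom_comps A) _)).congr (by ring)
  have hDc : ∀ (u : ℝ) (x : Sph d), D (u, x) = sphDiv (a' u).ang x := fun u x => by
    have h1 : ∀ i, Dx i (rp 1 * fang a' i) (u, x)
        = Dx i (fang a' i) (u, x) + x.1 i * fang a' i (u, x) := fun i => by
      rw [Dx_mul, Dx_rp]
      simp only [add_apply, mul_apply, smul_apply, rp_apply_sphere, Y_apply_sphere]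
      ring
    rw [sphDiv_eq (hom_fang a') (fun x i => (fang_coe hs' i u x).symm)]
    simp only [hD, sum_apply, h1, Finset.sum_add_distrib,
      sum_coe_mul_of_tangent (sum_Y_mul_fang hs'), add_zero]
  have hDI : ∀ u, shellInt D u = 0 := fun u => by
    refine shellInt_div ?_ u
    have : ∀ i, Y i * (rp 1 * fang a' i) = rp 1 * (Y i * fang a' i) := fun i => by ring
    simp only [this]
    rw [← Finset.mul_sum, sum_Y_mul_fang hs', mul_zero]
  have hHl : ∀ {F : Sm d}, Hom 0 F → Hom 0 (rp 2 * lap F) := fun hF =>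
    ((hom_rp 2).mul hF.lap).congr (by ring)
  have hEu : rp 2 * lap (fu a') + ((d : ℝ) - 4) • Dt (fu a) - ((d : ℝ) - 4) • fu a'
      = (-4 * Real.pi) • fu (j ((d : ℝ) - 2)) := by
    refine (((hHl (hom_fu _)).add ((hom_fu _).Dt.smul _)).sub ((hom_fu _).smul _)).ext
      ((hom_fu _).smul _) fun u x => ?_
    have h1 := hA.rec_u ((d : ℝ) - 3) u x
    rw [show (d : ℝ) - 3 + 1 = d - 2 by ring, deriv_u hs,
      sphLap_eq (hom_fu _) (fun x => (fu_coe hs' u x).symm), ← fu_coe hs', ← fu_coe hjs] at h1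
    simp only [add_apply, sub_apply, smul_apply, mul_apply, rp_apply_sphere]
    linear_combination h1
  have hEr : rp 2 * lap (fr a') - (2 * ((d : ℝ) - 3)) • fr a' + ((d : ℝ) - 2) • fu a'
      + ((d : ℝ) - 4) • Dt (fr a) - (2 : ℝ) • D = 0 := by
    refine (((((hHl (hom_fr _)).sub ((hom_fr _).smul _)).add ((hom_fu _).smul _)).add
      ((hom_fr _).Dt.smul _)).sub (hDH.smul _)).ext Hom.zero fun u x => ?_
    have h1 := hA.rec_r ((d : ℝ) - 3) u x
    rw [show (d : ℝ) - 3 + 1 = d - 2 by ring, deriv_r hs,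
      sphLap_eq (hom_fr _) (fun x => (fr_coe hs' u x).symm), ← fu_coe hs', ← fr_coe hs',
      current_r_eq_zero hj, ← ha', ← hDc, Pi.zero_apply, mul_zero] at h1
    simp only [add_apply, sub_apply, smul_apply, mul_apply, rp_apply_sphere, zero_apply]
    linear_combination h1
  have hΨe : Ψ = D + (2 : ℝ) • (fr a' - fu a') - Dt (fr a) := by
    refine hΨH.ext ((hDH.add (((hom_fr _).sub (hom_fu _)).smul _)).sub (hom_fr _).Dt)
      fun u x => ?_
    have h1 : cdiv (comps A) ((d : ℝ) - 3) (u, x) = divergence A ((d : ℝ) - 3) u x :=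
      cdiv_coe (by omega) hA.smooth _ u x
    simp only [add_apply, sub_apply, smul_apply, hΨ, mul_apply, rp_apply_sphere]
    rw [h1, divergence, deriv_r hs, ← ha', ← hDc, ← fu_coe hs', ← fr_coe hs']
    ring
  have hI : ∀ u, shellInt Ψ u = 0 := fun u => by
    have h1 := congrArg (fun F : Sm d => shellInt F u) hEu
    have h2 := congrArg (fun F : Sm d => shellInt F u) hEr
    have h3 := shellInt_of_chargeConservation (by omega) hs hjs rfl hQ u
    simp only [shellInt_add, shellInt_sub, shellInt_smul, shellInt_zero,
      shellInt_lap (hom_fu a'), shellInt_lap (hom_fr a'), hDI] at h1 h2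
    rw [hΨe]
    simp only [shellInt_add, shellInt_sub, shellInt_smul, hDI]
    have h4 : ((d : ℝ) - 3) * (0 + 2 * (shellInt (fr a') u - shellInt (fu a') u)
        - shellInt (Dt (fr a)) u) = 0 := by
      linear_combination -h2 + h1 - h3
    exact (mul_eq_zero.1 h4).resolve_left (by linarith)
  have hlap : lap (cdiv (comps A) ((d : ℝ) - 3)) = 0 := by
    have h1 := wave_cdiv_comps (by omega) hj hA ((d : ℝ) - 2)
    rwa [wave, h, map_zero, mul_zero, smul_zero, add_zero,
      show (d : ℝ) - 2 - 1 = d - 3 by ring] at h1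
  have hΨl : lap Ψ = 0 := by
    rw [hΨ, lap_rp_mul (hom_cdiv (hom_comps A) _), hlap, mul_zero, zero_add, hN]
    convert zero_smul ℝ (_ : Sm d) using 2
    ring
  have hΨ0 := eq_zero_of_lap_eq_zero (by omega) hΨH hΨl hI
  have h1 := rp_mul_cancel (-((d : ℝ) - 3)) (cdiv (comps A) ((d : ℝ) - 3))
  rw [neg_neg, ← hΨ, hΨ0, mul_zero] at h1
  exact h1.symm

end Sm

end

section

namespace Sm

variable {d : ℕ} {j A A' : Expansion d} {u₀ m : ℝ} {a b : ℝ → Coeff d} {M : ℕ}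

/-! ### Existence and uniqueness for the recursion relations -/

theorem wave_sub (F G : ℝ → Sm d) (n : ℝ) :
    wave (fun n => F n - G n) n = wave F n - wave G n := by
  simp only [wave, map_sub, mul_sub, smul_sub]
  abel

theorem wave_add (F G : ℝ → Sm d) (n : ℝ) :
    wave (fun n => F n + G n) n = wave F n + wave G n := by
  simp only [wave, map_add, mul_add, smul_add]
  abel

theorem rad_ne_zero (k : ℕ) : 2 * ((d : ℝ) / 2 - 1 + ((k : ℝ) + 1)) - d + 2 ≠ 0 := by
  have : (0 : ℝ) ≤ k := Nat.cast_nonneg k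
  intro h
  linarith

theorem coul_ne_zero (hd : 4 ≤ d) (ho : Odd d) (k : ℕ) :
    2 * ((d : ℝ) - 4 + ((k : ℝ) + 1)) - d + 2 ≠ 0 := by
  have : (0 : ℝ) ≤ k := Nat.cast_nonneg k
  have h4 : d ≠ 4 := by rintro rfl; exact absurd ho (by decide)
  have h5 : (5 : ℝ) ≤ d := by exact_mod_cast (by omega : 5 ≤ d)
  intro h
  linarith

theorem rad_ne_coul (ho : Odd d) (k l : ℕ) : (d : ℝ) / 2 - 1 + k ≠ d - 4 + l := by
  obtain ⟨e, rfl⟩ := ho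
  intro h
  push_cast at h
  have : (2 * k + 5 : ℝ) = 2 * e + 2 * l := by linarith
  have : 2 * k + 5 = 2 * e + 2 * l := by exact_mod_cast this
  omega

theorem mem_radOrders_of_even (hd : 4 ≤ d) (he : ¬ Odd d) (k : ℕ) :
    ∃ l : ℕ, (d : ℝ) - 3 + k = (d : ℝ) / 2 - 1 + l := by
  obtain ⟨e, rfl⟩ := Nat.not_odd_iff_even.1 he
  refine ⟨e - 2 + k, ?_⟩
  rw [Nat.cast_add (e - 2) k, Nat.cast_sub (by omega)]
  push_cast
  ring

theorem notMem_orders (ho : Odd d) {n : ℝ} (h : ∃ l : ℕ, n + l = (d : ℝ) - 4) : n ∉ orders d := by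
  obtain ⟨l, hl⟩ := h
  have hl0 : (0 : ℝ) ≤ l := Nat.cast_nonneg l
  rintro (⟨k, hk⟩ | ⟨k, hk⟩)
  · refine rad_ne_coul ho (k + l) 0 ?_
    push_cast
    linarith
  · have : (0 : ℝ) ≤ k := Nat.cast_nonneg k
    linarith

theorem recursion_unique (hd : 4 ≤ d) (hj : ∀ n, IsSmoothField (j n))
    (hm : m = (d : ℝ) / 2 - 1 + M)
    (hM : ∀ k : ℕ, k < M → Odd d ∨ (d : ℝ) / 2 - 1 + ((k + 1 : ℕ) : ℝ) ≤ d - 3)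
    (hA : IsRecursionSolution j A) (hA' : IsRecursionSolution j A')
    (h : HasData A u₀ m a b) (h' : HasData A' u₀ m a b) : A = A' := by
  set F : Option (Fin (d - 1)) → ℝ → Sm d := fun c n => comps A n c - comps A' n c with hF
  have hFH : ∀ c n, Hom (-n) (F c n) := fun c n => (hom_comps A n c).sub (hom_comps A' n c)
  have hw : ∀ c n, wave (F c) n = 0 := fun c n => by
    rw [hF, wave_sub, wave_comps (by omega) hj hA, wave_comps (by omega) hj hA', sub_self]
  have hinit : ∀ c n, n ∈ initialOrders d m → ∀ y : Space d, y ≠ 0 → F c n (u₀, y) = 0 := by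
    intro c n hn y hy
    rw [hF, sub_apply, sub_eq_zero]
    exact cmp_congr (hA.smooth n) (hA'.smooth n) n ((h.2 n hn).trans (h'.2 n hn).symm) c hy
  have hrad : ∀ c (k : ℕ), F c ((d : ℝ) / 2 - 1 + k) = 0 := fun c k => by
    refine chain_eq_zero (u₀ := u₀) (M := M) rad_ne_zero (hFH c) (fun k hk => ?_)
      (fun k => hw c _) ?_ (fun k hk => hinit c _ (Or.inl ⟨⟨k + 1, by push_cast; ring⟩, ?_⟩)) k
    · have := (lapInj_lapSurj_order hd (by omega : 1 ≤ k + 1) (hM k hk)).1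
      push_cast at this
      exact this
    · rw [← hm, hF, sub_eq_zero, comps, comps, h.1, h'.1]
    · rw [hm]
      have : (M : ℝ) ≤ k := by exact_mod_cast hk
      linarith
  have hcoul : Odd d → ∀ c (k : ℕ), F c ((d : ℝ) - 4 + k) = 0 := fun ho c k => by
    refine chain_eq_zero (u₀ := u₀) (M := 0) (coul_ne_zero hd ho) (hFH c)
      (fun k hk => absurd hk (Nat.not_lt_zero k)) (fun k => hw c _) ?_
      (fun k _ => hinit c _ (Or.inr ⟨ho, k, by ring⟩)) k
    have h0 : (d : ℝ) - 4 + (0 : ℕ) ∉ orders d := notMem_orders ho ⟨0, by simp⟩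
    rw [hF]
    simp only [comps]
    rw [hA.ansatz _ h0, hA'.ansatz _ h0, sub_self]
  funext n
  by_cases hn : n ∈ orders d
  · refine cmp_injective (hA.smooth n) (hA'.smooth n) (n := n) (funext fun c => ?_)
    rw [← sub_eq_zero]
    change F c n = 0
    have hradn : ∀ k : ℕ, n = (d : ℝ) / 2 - 1 + k → F c n = 0 := fun k hk => by
      rw [hk]; exact hrad c k
    rcases hn with ⟨k, hk⟩ | ⟨k, hk⟩
    · exact hradn k hk
    · by_cases ho : Odd d
      · have := hcoul ho c (k + 1)
        rw [hk, ← this]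
        congr 1
        push_cast
        ring
      · obtain ⟨l, hl⟩ := mem_radOrders_of_even hd ho k
        exact hradn l (hk.trans hl)
  · rw [hA.ansatz n hn, hA'.ansatz n hn]

theorem comps_eq_zero {n : ℝ} (h : A n = 0) (c : Option (Fin (d - 1))) : comps A n c = 0 := by
  rw [comps, h, cmp_zero]

theorem current_eq_zero (hd : 4 ≤ d) (hj : IsCurrent j)
    (h4 : d = 4 → ∀ (u : ℝ) (x : Sph d), (j 2 u).u x = 0 ∧ (j 2 u).ang x = 0) :
    j ((d : ℝ) / 2 - 1 + 1) = 0 := by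
  rcases hd.eq_or_lt with h | h
  · have h' := h4 h.symm
    have hr := current_r_eq_zero hj
    have e : (d : ℝ) = 4 := by exact_mod_cast h.symm
    rw [e, show (4 : ℝ) - 2 = 2 by norm_num] at hr
    rw [e, show (4 : ℝ) / 2 - 1 + 1 = 2 by norm_num]
    funext u
    exact Coeff.ext (funext fun x => (h' u x).1) (hr u) (funext fun x => (h' u x).2)
  · refine hj.ansatz _ fun ⟨k, hk⟩ => ?_
    have : (0 : ℝ) ≤ k := Nat.cast_nonneg k
    have : (4 : ℝ) < d := by exact_mod_cast h
    linarith

open Classical in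
theorem exists_recursionSolution (hd : 4 ≤ d) (hj : IsCurrent j)
    (h4 : d = 4 → ∀ (u : ℝ) (x : Sph d), (j 2 u).u x = 0 ∧ (j 2 u).ang x = 0)
    (hm : m = (d : ℝ) / 2 - 1 + M)
    (hM : ∀ k : ℕ, k < M → Odd d ∨ (d : ℝ) / 2 - 1 + ((k + 1 : ℕ) : ℝ) ≤ d - 3)
    (hD : IsData j u₀ m a b) : ∃ A, IsRecursionSolution j A ∧ HasData A u₀ m a b := by
  set β : Option (Fin (d - 1)) → ℝ → Sm d := fun c n => cmp n (fun _ => b n) c with hβ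
  set J : Option (Fin (d - 1)) → ℝ → Sm d := fun c n => (-4 * Real.pi) • comps j (n + 1) c with hJ
  have hJH : ∀ c n, Hom (-n - 1) (J c n) := fun c n =>
    ((hom_comps j (n + 1) c).smul _).congr (by ring)
  have hJ0 : ∀ c n, (¬ ∃ k : ℕ, n = (d : ℝ) - 3 + k) → J c n = 0 := fun c n hn => by
    rw [hJ]
    simp only
    rw [comps_eq_zero, smul_zero]
    exact hj.ansatz _ fun ⟨k, hk⟩ => hn ⟨k, by linarith⟩
  have hrad : ∀ c, ∃ F : ℝ → Sm d, (∀ n, Hom (-n) (F n)) ∧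
      (∀ n, (¬ ∃ k : ℕ, n = (d : ℝ) / 2 - 1 + k) → F n = 0) ∧
      (∀ n, wave F n = if ∃ k : ℕ, n = (d : ℝ) / 2 - 1 + k then J c n else 0) ∧
      F m = cmp m a c ∧ ∀ n ∈ radOrders d, m < n → ∀ y : Space d, y ≠ 0 →
        F n (u₀, y) = β c n (u₀, y) := by
    intro c
    obtain ⟨F, h1, h2, h3, h5, h6⟩ := exists_chain (u₀ := u₀) (c := (d : ℝ) / 2 - 1) rad_ne_zero
      (S := fun n => if ∃ k : ℕ, n = (d : ℝ) / 2 - 1 + k then J c n else 0)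
      (fun n => by
        split_ifs
        · exact hJH c n
        · exact Hom.zero) (fun n hn => if_neg hn) M
      (fun k hk => by
        have := (lapInj_lapSurj_order hd (by omega : 1 ≤ k + 1) (hM k hk)).2
        push_cast at this
        exact this) (β c) (fun k _ => hom_cmp _ _ c) (a := cmp m a c)
      ((hom_cmp m a c).congr (by rw [hm]))
    refine ⟨F, h1, h2, fun n => ?_, by rw [← h5, hm], ?_⟩
    · by_cases hn : n = (d : ℝ) / 2 - 1
      · rw [wave_of_zero, show 2 * n - d + 2 = 0 by rw [hn]; ring, zero_smul]
        · have h0 : J c n = 0 := by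
            rw [hJ]
            simp only
            rw [comps_eq_zero, smul_zero]
            rw [hn]
            exact current_eq_zero hd hj h4
          rw [h0, ite_self]
        · refine h2 _ fun ⟨k, hk⟩ => ?_
          have : (0 : ℝ) ≤ k := Nat.cast_nonneg k
          linarith
      · exact h3 n hn
    · rintro n ⟨k, rfl⟩ hlt y hy
      have hMk : M < k := by
        rw [hm] at hlt
        exact_mod_cast (by linarith : (M : ℝ) < k)
      obtain ⟨k, rfl⟩ : ∃ l, k = l + 1 := ⟨k - 1, by omega⟩
      push_cast
      exact h6 k (by omega) y hy
  have hcoul : ∀ c, ∃ G : ℝ → Sm d, (∀ n, Hom (-n) (G n)) ∧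
      (∀ n, (¬ (Odd d ∧ n ∈ coulOrders d)) → G n = 0) ∧
      (∀ n, wave G n = if ∃ k : ℕ, n = (d : ℝ) / 2 - 1 + k then 0 else J c n) ∧
      (Odd d → ∀ n ∈ coulOrders d, ∀ y : Space d, y ≠ 0 → G n (u₀, y) = β c n (u₀, y)) := by
    intro c
    by_cases ho : Odd d
    swap
    · refine ⟨0, fun n => Hom.zero, fun n _ => rfl, fun n => ?_, fun h => absurd h ho⟩
      rw [wave, Pi.zero_apply, Pi.zero_apply, map_zero, map_zero, mul_zero, smul_zero, add_zero]
      split_ifs with hn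
      · rfl
      · refine (hJ0 c n fun ⟨k, hk⟩ => hn ?_).symm
        obtain ⟨l, hl⟩ := mem_radOrders_of_even hd ho k
        exact ⟨l, hk.trans hl⟩
    have hJ1 : ∀ n, (¬ ∃ k : ℕ, n = (d : ℝ) - 4 + ((k : ℝ) + 1)) → J c n = 0 := fun n hn =>
      hJ0 c n fun ⟨k, hk⟩ => hn ⟨k, by linarith⟩
    obtain ⟨G, h1, h2, h3, h5, h6⟩ := exists_chain_zero (u₀ := u₀) (c := (d : ℝ) - 4)
      (coul_ne_zero hd ho) (S := J c) (b := β c) (hJH c)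
      (fun n hn => hJ1 n fun ⟨k, hk⟩ => hn ⟨k + 1, by push_cast; exact hk⟩)
      (fun k => hom_cmp _ _ c) (a := 0) Hom.zero
    refine ⟨G, h1, fun n hn => ?_, fun n => ?_, fun _ n ⟨k, hk⟩ y hy => ?_⟩
    · by_cases hn4 : n = (d : ℝ) - 4
      · rw [hn4, h5]
      · refine h2 n fun ⟨k, hk⟩ => ?_
        rcases k with _ | k
        · simp only [Nat.cast_zero, add_zero] at hk
          exact hn4 hk
        · exact hn ⟨ho, k, by rw [hk]; push_cast; ring⟩
    · have h7 : wave G n = J c n := by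
        by_cases hn4 : n = (d : ℝ) - 4
        · rw [wave_of_zero, hn4, h5, map_zero, mul_zero, smul_zero, hJ1]
          · rintro ⟨k, hk⟩
            have : (0 : ℝ) ≤ k := Nat.cast_nonneg k
            linarith
          · refine h2 _ fun ⟨k, hk⟩ => ?_
            have : (0 : ℝ) ≤ k := Nat.cast_nonneg k
            linarith
        · exact h3 n hn4
      rw [h7]
      split_ifs with hn
      · refine hJ1 n fun ⟨l, hl⟩ => ?_
        obtain ⟨k, hk⟩ := hn
        refine rad_ne_coul ho k (l + 1) ?_
        push_cast
        rw [← hk, hl]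
      · rfl
    · have := h6 k y hy
      rwa [show (d : ℝ) - 4 + ((k : ℝ) + 1) = n by rw [hk]; ring] at this
  choose F hFH hF0 hFw hFm hFi using hrad
  choose G hGH hG0 hGw hGi using hcoul
  have hH : ∀ n c, Hom (-n) (F c n + G c n) := fun n c => (hFH c n).add (hGH c n)
  set A : Expansion d := fun n => uncmp fun c => F c n + G c n with hA
  have hAc : ∀ n, comps A n = fun c => F c n + G c n := fun n => cmp_uncmp (hH n)
  have hG0' : ∀ c n, n ∈ radOrders d → G c n = 0 := fun c n ⟨k, hk⟩ =>
    hG0 c n fun ⟨ho, l, hl⟩ => rad_ne_coul ho k (l + 1) (by rw [← hk, hl]; push_cast; ring)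
  refine ⟨A, isRecursionSolution_of_wave (by omega) hj.smooth
    (fun n => isSmoothField_uncmp (hH n)) (fun n hn => ?_) (fun n c => ?_), ?_, fun n hn => ?_⟩
  · rw [hA]
    simp only
    rw [← uncmp_zero]
    congr 1
    funext c
    rw [hF0 c n fun h => hn (Or.inl h), hG0 c n fun h => hn (Or.inr h.2), add_zero]
  · simp only [hAc]
    rw [wave_add, hFw, hGw]
    split_ifs
    · rw [add_zero]
    · rw [zero_add]
  · rw [hA]
    simp only
    rw [← uncmp_cmp hD.smooth m]
    congr 1
    funext c
    rw [hFm, hG0' c m ⟨M, hm⟩, add_zero]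
  · have hs := isSmoothField_const (hD.smooth_init n hn)
    have h1 : b n = uncmp (cmp n fun _ => b n) u₀ := by rw [uncmp_cmp hs]
    rw [h1]
    refine uncmp_congr fun c y hy => ?_
    rw [add_apply]
    rcases hn with ⟨hn, hlt⟩ | ⟨ho, hn⟩
    · rw [hFi c n hn hlt y hy, hG0' c n hn, zero_apply, add_zero]
    · rw [hGi c ho n hn y hy, hF0 c n, zero_apply, zero_add]
      rintro ⟨k, hk⟩
      obtain ⟨l, hl⟩ := hn
      exact rad_ne_coul ho k (l + 1) (by rw [← hk, hl]; push_cast; ring)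

/-! ### The Lorenz condition -/

theorem eq_zero_at {σ : ℝ} {F : Sm d} (hF : Hom σ F) {u : ℝ} (h : ∀ x : Sph d, F (u, x) = 0)
    {y : Space d} (hy : y ≠ 0) : F (u, y) = 0 := by
  have hx : ‖y‖⁻¹ • y ∈ Metric.sphere (0 : Space d) 1 := by
    rw [mem_sphere_zero_iff_norm, norm_smul, norm_inv, norm_norm,
      inv_mul_cancel₀ (norm_ne_zero_iff.2 hy)]
  have h1 := h ⟨_, hx⟩
  rw [apply_eq_of_hom hF (p := (u, y)) hy]
  simp only at h1 ⊢
  rw [h1, mul_zero]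

theorem cdiv_rad_eq_zero (hd : 4 ≤ d) (hj : IsCurrent j) (hm : m = (d : ℝ) / 2 - 1 + M)
    (hD : IsData j u₀ m a b) (hA : IsRecursionSolution j A) (h : HasData A u₀ m a b) (k : ℕ)
    (hk : M + 1 ≤ k) : cdiv (comps A) ((d : ℝ) / 2 - 1 + k) = 0 := by
  have hne : ∀ k : ℕ, 2 * ((d : ℝ) / 2 - 1 + k) - d + 4 ≠ 0 := fun k h0 => by
    have : (0 : ℝ) ≤ k := Nat.cast_nonneg k
    linarith
  have hψH := hom_cdiv (hom_comps A)
  refine chain_eq_zero_up (u₀ := u₀) rad_ne_zero (fun k _ => wave_cdiv_comps (by omega) hj hA _)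
    ?_ (fun k hk y hy => eq_zero_at (hψH _) (fun x => ?_) hy) k hk
  · refine (hψH _).ext Hom.zero fun u x => ?_
    rw [zero_apply]
    have h1 := (constraint_iff (by omega) hA m u (by rw [hm]; exact hne M)).1
      (by rw [h.1]; exact hD.constraint u) x
    rw [hm] at h1
    push_cast
    rw [← add_assoc]
    exact h1
  · have hn : (d : ℝ) / 2 - 1 + k ∈ initialOrders d m := Or.inl ⟨⟨k, rfl⟩, by
      rw [hm]
      have : (M : ℝ) + 1 ≤ k := by exact_mod_cast hk
      linarith⟩
    have h1 := (constraint_iff (by omega) hA _ u₀ (hne k)).1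
      (by rw [h.2 _ hn]; exact hD.constraint_init _ hn) x
    rw [← add_assoc]
    exact h1

theorem constraint_zero (n : ℝ) : Constraint n (0 : Coeff d) 0 := by
  intro x
  have h1 : sphLap (0 : Coeff d).r x = 0 := by
    rw [sphLap_eq (f := (0 : Coeff d).r) (F := 0) (u := 0) Hom.zero
      (fun x => (zero_apply _).symm), map_zero, zero_apply]
  have h2 : sphDiv (0 : Coeff d).ang x = 0 := by
    rw [sphDiv_eq (V := (0 : Coeff d).ang) (G := fun _ => 0) (u := 0) (fun _ => Hom.zero) (fun x i => (zero_apply _).symm)]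
    simp only [map_zero, zero_apply, Finset.sum_const_zero]
  rw [h1, h2]
  change 0 - _ * (0 : ℝ) + _ * (0 : ℝ) + _ = _ * (0 : ℝ)
  ring

theorem cdiv_coul_eq_zero (hd : 4 ≤ d) (ho : Odd d) (hj : IsCurrent j)
    (hD : IsData j u₀ m a b) (hA : IsRecursionSolution j A) (h : HasData A u₀ m a b) (k : ℕ) :
    cdiv (comps A) ((d : ℝ) - 4 + k) = 0 := by
  have h4 : (4 : ℝ) < d := by
    have h4 : d ≠ 4 := by rintro rfl; exact absurd ho (by decide)
    exact_mod_cast (by omega : 4 < d)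
  have hψH := hom_cdiv (hom_comps A)
  refine chain_eq_zero_up (u₀ := u₀) (M := 0) (coul_ne_zero hd ho)
    (fun k _ => wave_cdiv_comps (by omega) hj hA _) ?_
    (fun k _ y hy => eq_zero_at (hψH _) (fun x => ?_) hy) k (Nat.zero_le k)
  · have h0 := hA.ansatz ((d : ℝ) - 4 + (0 : ℕ)) (notMem_orders ho ⟨0, by simp⟩)
    have h1 := hA.ansatz ((d : ℝ) - 4 + (0 : ℕ) - 1) (notMem_orders ho ⟨1, by simp⟩)
    simp only [cdiv, comps_eq_zero h0, comps_eq_zero h1, map_zero, mul_zero,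
      Finset.sum_const_zero, sub_zero]
  · have hk0 : (0 : ℝ) ≤ k := Nat.cast_nonneg k
    rw [← add_assoc]
    refine (constraint_iff (by omega) hA _ u₀ (by intro h0; linarith)).1 ?_ x
    rcases k with _ | k
    · rw [hA.ansatz _ (notMem_orders ho ⟨0, by simp⟩),
        show (d : ℝ) - 4 + (0 : ℕ) + 2 = d - 2 by push_cast; ring, current_r_eq_zero hj]
      exact constraint_zero _
    · have hn : (d : ℝ) - 4 + ((k + 1 : ℕ) : ℝ) ∈ initialOrders d m :=
        Or.inr ⟨ho, k, by push_cast; ring⟩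
      rw [h.2 _ hn]
      exact hD.constraint_init _ hn

theorem isLorenzSolution_of_cdiv (hd : 4 ≤ d) (hj : IsCurrent j) (hm : m = (d : ℝ) / 2 - 1 + M)
    (hD : IsData j u₀ m a b) (hA : IsRecursionSolution j A) (h : HasData A u₀ m a b)
    (hψ : ∀ k : ℕ, k ≤ M → cdiv (comps A) ((d : ℝ) / 2 - 1 + k) = 0) : IsLorenzSolution j A := by
  refine ⟨hA, fun n => divergence_eq_zero_of_cdiv (by omega) hA.smooth ?_⟩
  have hrad : (∃ k : ℕ, n = (d : ℝ) / 2 - 1 + k) → cdiv (comps A) n = 0 := by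
    rintro ⟨k, rfl⟩
    rcases Nat.lt_or_ge M k with hk | hk
    · exact cdiv_rad_eq_zero hd hj hm hD hA h k hk
    · exact hψ k hk
  have hcoul : (∃ k : ℕ, n = (d : ℝ) - 3 + k) → cdiv (comps A) n = 0 := by
    rintro ⟨k, rfl⟩
    by_cases ho : Odd d
    · have := cdiv_coul_eq_zero hd ho hj hD hA h (k + 1)
      rw [← this]
      congr 1
      push_cast
      ring
    · exact hrad (mem_radOrders_of_even hd ho k)
  by_cases hn : n ∈ orders d
  · exact hn.elim hrad hcoul
  by_cases hn1 : n - 1 ∈ orders d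
  · rcases hn1 with ⟨k, hk⟩ | ⟨k, hk⟩
    · exact hrad ⟨k + 1, by push_cast; linarith⟩
    · exact hcoul ⟨k + 1, by push_cast; linarith⟩
  simp only [cdiv, comps_eq_zero (hA.ansatz _ hn), comps_eq_zero (hA.ansatz _ hn1), map_zero,
    mul_zero, Finset.sum_const_zero, sub_zero]

theorem cdiv_eq_zero_down (hd : 4 ≤ d) (hj : IsCurrent j) (hA : IsRecursionSolution j A) {K : ℕ}
    (hK : ∀ k : ℕ, k < K → Odd d ∨ (d : ℝ) / 2 - 1 + ((k + 1 : ℕ) : ℝ) ≤ d - 3)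
    (h0 : cdiv (comps A) ((d : ℝ) / 2 - 1 + K) = 0) (k : ℕ) (hk : k ≤ K) :
    cdiv (comps A) ((d : ℝ) / 2 - 1 + k) = 0 :=
  chain_eq_zero_down (hom_cdiv (hom_comps A)) (fun k hk => by
    have := (lapInj_lapSurj_order hd (by omega : 1 ≤ k + 1) (hK k hk)).1
    push_cast at this
    exact this) (fun k _ => wave_cdiv_comps (by omega) hj hA _) h0 k hk

theorem existsUnique_lorenz (hd : 4 ≤ d) (hj : IsCurrent j)
    (h4 : d = 4 → ∀ (u : ℝ) (x : Sph d), (j 2 u).u x = 0 ∧ (j 2 u).ang x = 0)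
    (hm : m = (d : ℝ) / 2 - 1 + M)
    (hM : ∀ k : ℕ, k < M → Odd d ∨ (d : ℝ) / 2 - 1 + ((k + 1 : ℕ) : ℝ) ≤ d - 3)
    (hD : IsData j u₀ m a b)
    (hQ : (Odd d ∨ m + 1 ≤ d - 3) ∨ (m = d - 3 ∧ ChargeConservation j a)) :
    ∃! A : Expansion d, IsLorenzSolution j A ∧ HasData A u₀ m a b := by
  obtain ⟨A, hA, h⟩ := exists_recursionSolution hd hj h4 hm hM hD
  refine ⟨A, ⟨isLorenzSolution_of_cdiv hd hj hm hD hA h fun k hk => ?_, h⟩, fun A' h' =>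
    recursion_unique hd hj.smooth hm hM h'.1.toIsRecursionSolution hA h'.2 h⟩
  have h1 := cdiv_rad_eq_zero hd hj hm hD hA h (M + 1) le_rfl
  rcases hQ with hQ | ⟨hm3, hQ⟩
  · refine cdiv_eq_zero_down hd hj hA (fun k hk => ?_) h1 k (by omega)
    refine hQ.imp id fun hQ => ?_
    have : ((k + 1 : ℕ) : ℝ) ≤ M + 1 := by exact_mod_cast hk
    linarith
  · refine cdiv_eq_zero_down hd hj hA hM ?_ k hk
    rw [← hm, hm3]
    refine cdiv_coulomb_eq_zero hd hj hA (by rw [← hm3, h.1]; exact hQ) ?_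
    rw [← h1]
    congr 1
    push_cast
    linarith

theorem existsUnique_recursion (hd : 4 ≤ d) (hj : IsCurrent j)
    (h4 : d = 4 → ∀ (u : ℝ) (x : Sph d), (j 2 u).u x = 0 ∧ (j 2 u).ang x = 0)
    (hD : IsData j u₀ ((d : ℝ) / 2 - 1) a b) :
    ∃! A : Expansion d, IsRecursionSolution j A ∧ SatisfiesConstraints j A ∧
      HasData A u₀ ((d : ℝ) / 2 - 1) a b := by
  have hm : (d : ℝ) / 2 - 1 = (d : ℝ) / 2 - 1 + (0 : ℕ) := by simp
  have hM : ∀ k : ℕ, k < 0 → Odd d ∨ (d : ℝ) / 2 - 1 + ((k + 1 : ℕ) : ℝ) ≤ d - 3 :=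
    fun k hk => absurd hk (Nat.not_lt_zero k)
  obtain ⟨A, hA, h⟩ := exists_recursionSolution hd hj h4 hm hM hD
  refine ⟨A, ⟨hA, fun n hn u => ?_, h⟩, fun A' h' =>
    recursion_unique hd hj.smooth hm hM h'.1 hA h'.2.2 h⟩
  have hd4 : (4 : ℝ) ≤ d := by exact_mod_cast hd
  have hrad : (∃ k : ℕ, n = (d : ℝ) / 2 - 1 + k) → Constraint n (A n u) (j (n + 2) u).r := by
    rintro ⟨k, rfl⟩
    have hk0 : (0 : ℝ) ≤ k := Nat.cast_nonneg k
    refine (constraint_iff (by omega) hA _ u (by intro h0; linarith)).2 fun x => ?_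
    have := cdiv_rad_eq_zero hd hj hm hD hA h (k + 1) (by omega)
    push_cast at this
    rw [add_assoc, this, zero_apply]
  rcases hn with hn | ⟨k, hk⟩
  · exact hrad hn
  · by_cases ho : Odd d
    · have hk0 : (0 : ℝ) ≤ k := Nat.cast_nonneg k
      refine (constraint_iff (by omega) hA _ u (by intro h0; linarith)).2 fun x => ?_
      have := cdiv_coul_eq_zero hd ho hj hD hA h (k + 2)
      rw [show n + 1 = (d : ℝ) - 4 + ((k + 2 : ℕ) : ℝ) by rw [hk]; push_cast; ring, this,
        zero_apply]
    · obtain ⟨l, hl⟩ := mem_radOrders_of_even hd ho k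
      exact hrad ⟨l, hk.trans hl⟩

end Sm

end

end LorenzMaxwell

end

theorem mainTheorem7 (d : ℕ) (hd : 4 ≤ d) (j : Expansion d) (hj : IsCurrent j)
    (h4 : d = 4 → ∀ (u : ℝ) (x : Sph d), (j 2 u).u x = 0 ∧ (j 2 u).ang x = 0) (u₀ : ℝ) :
    -- radiative order data
    (∀ a b : ℝ → Coeff d, IsData j u₀ ((d : ℝ) / 2 - 1) a b →
      (∃! A : Expansion d, IsRecursionSolution j A ∧ SatisfiesConstraints j A ∧
        HasData A u₀ ((d : ℝ) / 2 - 1) a b) ∧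
      ((d = 4 → ChargeConservation j a) →
        ∃! A : Expansion d, IsLorenzSolution j A ∧ HasData A u₀ ((d : ℝ) / 2 - 1) a b)) ∧
    -- Coulombic order data, even dimensions
    (Even d → ∀ a b : ℝ → Coeff d, IsData j u₀ ((d : ℝ) - 3) a b → ChargeConservation j a →
      ∃! A : Expansion d, IsLorenzSolution j A ∧ HasData A u₀ ((d : ℝ) - 3) a b) ∧
    -- data at any half-integer order, odd dimensions
    (Odd d → ∀ m ∈ radOrders d, ∀ a b : ℝ → Coeff d, IsData j u₀ m a b →
      ∃! A : Expansion d, IsLorenzSolution j A ∧ HasData A u₀ m a b) := by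
  refine ⟨fun a b hD => ⟨Sm.existsUnique_recursion hd hj h4 hD, fun hQ => ?_⟩,
    fun he a b hD hQ => ?_, fun ho m ⟨M, hm⟩ a b hD =>
      Sm.existsUnique_lorenz hd hj h4 hm (fun _ _ => Or.inl ho) hD (Or.inl (Or.inl ho))⟩
  · refine Sm.existsUnique_lorenz (M := 0) hd hj h4 (by simp)
      (fun k hk => absurd hk (Nat.not_lt_zero k)) hD ?_
    rcases Nat.even_or_odd d with he | ho
    · obtain ⟨e, rfl⟩ := he
      rcases hd.eq_or_lt with h | h
      · have he : (e : ℝ) = 2 := by exact_mod_cast (by omega : e = 2)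
        refine Or.inr ⟨?_, hQ h.symm⟩
        push_cast
        rw [he]
        norm_num
      · have he : (3 : ℝ) ≤ e := by exact_mod_cast (by omega : 3 ≤ e)
        refine Or.inl (Or.inr ?_)
        push_cast
        linarith
    · exact Or.inl (Or.inl ho)
  · obtain ⟨e, rfl⟩ := he
    have hc : ((e - 2 : ℕ) : ℝ) = e - 2 := by
      rw [Nat.cast_sub (by omega)]
      norm_num
    refine Sm.existsUnique_lorenz (M := e - 2) hd hj h4 ?_ (fun k hk => Or.inr ?_) hD
      (Or.inr ⟨rfl, hQ⟩)
    · rw [hc]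
      push_cast
      ring
    · have : ((k + 1 : ℕ) : ℝ) ≤ e - 2 := by
        rw [← hc]
        exact_mod_cast hk
      push_cast at this ⊢
      linarith
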